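/- Let $X$ be a complex Banach space. For $\nu\in(0,\pi)$ let $\Sigma_\nu=\{z\in\mathbb C\setminus\{0\}:|\arg z|<\nu\}$, and let $\partial\Sigma_\nu$ be oriented such that $\Sigma_\nu$ lies to its left. An operator $A$ in $X$ is sectorial of angle $\omega\in[0,\pi)$ if it is closed, its spectrum is contained in $\{0\}\cup\{z\ne0:|\arg z|\le\omega\}$, and $\sup\{\|\lambda R(\lambda,A)\|: \lambda\neq0,\ |\arg\lambda|\ge\omega'\}<\infty$ for every $\omega'\in(\omega,\pi)$, where $R(\lambda,A)=(\lambda-A)^{-1}$. Let $A$ and $B$ be sectorial operators in $X$ of angles $\omega_A$ and $\omega_B$, respectively, with dense domains and dense ranges (hence injective). Assume that the resolvents of $A$ commute with those of $B$, that $\omega_A+\omega_B<\pi$, and let $\rho\in(\omega_A,\pi-\omega_B)$. Put $\Gamma=\partial\Sigma_\rho$ and define $$Sx=\frac1{2\pi i}\int_\Gamma(\lambda+B)^{-1}R(\lambda,A)x\,d\lambda,\qquad x\in D(S),$$ where $D(S)$ is the range of the bounded operator $R(\mu,A)\,R(\mu,A^{-1})\,(\mu+B)^{-1}(\mu+B^{-1})^{-1}$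 with $\mu=e^{i\rho}$. For each choice of sign let $\psi_\pm(z)=\dfrac1{e^{\pm i\rho}+z}$ and $\varphi_\pm(z)=\dfrac{z^{1/4}}{(-e^{\pm i\rho}+z)^{1/2}}$ (principal branches). For $t>0$ let $\psi_\pm(tB)=(e^{\pm i\rho}+tB)^{-1}$ and $\varphi_\pm(tA)=\frac1{2\pi i}\int_{\partial\Sigma_\nu}\varphi_\pm(\lambda)R(\lambda,tA)\,d\lambda$, where $\nu\in(\omega_A,\rho)$ is arbitrary. Suppose that there is a constant $C$ such that, for both choices of sign, $$\left|\int_0^\infty\big\langle\psi_\pm(tB)\varphi_\pm(tA)x,\ \big(\varphi_\pm(tA)\big)'x'\big\rangle\,\frac{dt}t\right|\le C\,\|x\|_X\,\|x'\|_{X'}\qquad\text{for all }x\in D(S),\ x'\in X'.$$ Then $D(S)$ is dense in $X$, the integral defining $Sx$ converges absolutely for every $x\in D(S)$, and $Sx\in D(A)$ for every $x\in D(S)$. The operator $AS$ extends to a bounded operator on $X$, and $A+B$ with domain $D(A+B)=D(A)\cap D(B)$ is closed. -/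

import Mathlib

open MeasureTheory Set

noncomputable section

namespace OperatorSum

variable {X : Type*} [NormedAddCommGroup X] [NormedSpace ℂ X]

/-- `R` is a bounded, everywhere defined, two-sided inverse of the (unbounded) operator `T`. -/
def IsBoundedInverse (T : X →ₗ.[ℂ] X) (R : X →L[ℂ] X) : Prop :=
  (∀ x : X, ∃ h : R x ∈ T.domain, T ⟨R x, h⟩ = x) ∧ ∀ y : T.domain, R (T y) = y

open Classical in
/-- The bounded inverse `T⁻¹` of an operator `T` (which is unique); `0` if there is none. -/
def boundedInverse (T : X →ₗ.[ℂ] X) : X →L[ℂ] X :=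
  if h : ∃ R : X →L[ℂ] X, IsBoundedInverse T R then h.choose else 0

/-- The operator `z + T` with domain `D(T)`. -/
def shift (z : ℂ) (T : X →ₗ.[ℂ] X) : X →ₗ.[ℂ] X :=
  (z • (LinearMap.id : X →ₗ[ℂ] X)) +ᵥ T

/-- The resolvent set of `A`: those `z` for which `z - A` has a bounded inverse. -/
def resolventSet (A : X →ₗ.[ℂ] X) : Set ℂ :=
  {z | ∃ R : X →L[ℂ] X, IsBoundedInverse (shift z (-A)) R}

/-- The resolvent `R(z, A) = (z - A)⁻¹`. -/
def resolvent (z : ℂ) (A : X →ₗ.[ℂ] X) : X →L[ℂ] X :=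
  boundedInverse (shift z (-A))

/-- `A` is sectorial of angle `ω ∈ [0, π)`: it is closed, its spectrum is contained in the closed
sector `{0} ∪ {|arg z| ≤ ω}`, and `z R(z, A)` is bounded outside each strictly larger sector. -/
structure IsSectorial (A : X →ₗ.[ℂ] X) (ω : ℝ) : Prop where
  nonneg : 0 ≤ ω
  lt_pi : ω < Real.pi
  closed : A.IsClosed
  mem_resolventSet : ∀ z : ℂ, ω < |z.arg| → z ∈ resolventSet A
  bound : ∀ ω' : ℝ, ω < ω' → ω' < Real.pi →
    ∃ M : ℝ, ∀ z : ℂ, ω' ≤ |z.arg| → ‖z • resolvent z A‖ ≤ M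

/-- The standing assumption: `A` and `B` are sectorial of angles `ωA`, `ωB` with dense domains and
dense ranges, their resolvents commute, `ωA + ωB < π`, and `ρ ∈ (ωA, π - ωB)`. -/
structure AssumptionSigma (A B : X →ₗ.[ℂ] X) (ωA ωB ρ : ℝ) : Prop where
  sectorial_left : IsSectorial A ωA
  sectorial_right : IsSectorial B ωB
  dense_domain_left : Dense (A.domain : Set X)
  dense_domain_right : Dense (B.domain : Set X)
  dense_range_left : Dense (Set.range A)
  dense_range_right : Dense (Set.range B)
  commute : ∀ z ∈ resolventSet A, ∀ w ∈ resolventSet B,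
    Commute (resolvent z A) (resolvent w B)
  angle_sum : ωA + ωB < Real.pi
  lt_rho : ωA < ρ
  rho_lt : ρ < Real.pi - ωB

/-- The integral of `f` along the ray of direction `e^{iθ}`, from `0` to `∞`. -/
def rayIntegral {E : Type*} [NormedAddCommGroup E] [NormedSpace ℂ E] (θ : ℝ) (f : ℂ → E) : E :=
  ∫ r in Ioi (0 : ℝ), Complex.exp (θ * Complex.I) • f (r * Complex.exp (θ * Complex.I))

/-- The integral of `f` along the boundary of the sector `{|arg z| < ν}`, oriented such that the
sector lies to the left: inwards along `e^{iν}(0,∞)`, then outwards along `e^{-iν}(0,∞)`. -/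
def sectorIntegral {E : Type*} [NormedAddCommGroup E] [NormedSpace ℂ E] (ν : ℝ) (f : ℂ → E) : E :=
  rayIntegral (-ν) f - rayIntegral ν f

/-- The elementary functional calculus
`φ(A) = (2πi)⁻¹ ∫_{∂Σ_ν} φ(z) R(z, A) dz` (an integral in operator norm). -/
def funCalc (ν : ℝ) (φ : ℂ → ℂ) (A : X →ₗ.[ℂ] X) : X →L[ℂ] X :=
  (2 * Real.pi * Complex.I : ℂ)⁻¹ • sectorIntegral ν fun z => φ z • resolvent z A

/-- `φ(z) = z^{1/4} / (-e^{iθ} + z)^{1/2}` (principal branches, which are holomorphic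
on `{|arg z| < |θ|}` for `0 < |θ| < π`). -/
def phi (θ : ℝ) (z : ℂ) : ℂ :=
  z ^ (1 / 4 : ℂ) / (-Complex.exp (θ * Complex.I) + z) ^ (1 / 2 : ℂ)

/-- `ψ(T) = (e^{iθ} + T)⁻¹`, i.e. `ψ(z) = 1 / (e^{iθ} + z)` applied to `T`. -/
def psiOp (θ : ℝ) (T : X →ₗ.[ℂ] X) : X →L[ℂ] X :=
  boundedInverse (shift (Complex.exp (θ * Complex.I)) T)

/-- The domain of `S`: the range of `R(μ, A) R(μ, A⁻¹) (μ + B)⁻¹ (μ + B⁻¹)⁻¹` with `μ = e^{iρ}`. -/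
def domS (A B : X →ₗ.[ℂ] X) (ρ : ℝ) : Submodule ℂ X :=
  LinearMap.range
    ((resolvent (Complex.exp (ρ * Complex.I)) A *
      resolvent (Complex.exp (ρ * Complex.I)) A.inverse *
      boundedInverse (shift (Complex.exp (ρ * Complex.I)) B) *
      boundedInverse (shift (Complex.exp (ρ * Complex.I)) B.inverse) : X →L[ℂ] X) : X →ₗ[ℂ] X)

/-- The integrand `(z + B)⁻¹ R(z, A) x` in the definition of `S`. -/
def integrandS (A B : X →ₗ.[ℂ] X) (x : X) (z : ℂ) : X :=
  boundedInverse (shift z B) (resolvent z A x)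

/-- `S x = (2πi)⁻¹ ∫_Γ (z + B)⁻¹ R(z, A) x dz`, where `Γ` is the boundary of `{|arg z| < ρ}`. -/
def opS (A B : X →ₗ.[ℂ] X) (ρ : ℝ) (x : X) : X :=
  (2 * Real.pi * Complex.I : ℂ)⁻¹ • sectorIntegral ρ (integrandS A B x)

/-- The bilinear form `∫₀^∞ ⟨ψ(tB) φ(tA) x, φ(tA)' x'⟩ dt/t`. -/
def bilin (A B : X →ₗ.[ℂ] X) (ν θ : ℝ) (x : X) (x' : StrongDual ℂ X) : ℂ :=
  ∫ t in Ioi (0 : ℝ), (t : ℂ)⁻¹ *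
    (x'.comp (funCalc ν (phi θ) ((t : ℂ) • A)))
      (psiOp θ ((t : ℂ) • B) (funCalc ν (phi θ) ((t : ℂ) • A) x))

end OperatorSum

end

/-!
Let `μ = e^{iρ}`, `P = R(μ, A)` and `J = P Q`, where `Q = R(μ, A⁻¹) (μ + B)⁻¹ (μ + B⁻¹)⁻¹`; the
domain of `S` is the range of `J`, and `J` is injective with dense range. All contour integrals are
written in the coordinate `z = e^w`, in which the boundary of the sector of angle `ν` becomes the
pair of lines `Im w = ± ν`, rays become lines, `dt / t` becomes Lebesgue measure, and `A`, `B` enter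
through the bounded holomorphic functions `a(w) = z R(z, A)` and `b(w) = z (z + B)⁻¹`.

The function `φ_±(tz)²` is, up to a constant, the kernel `(z z')^{1/2} / (z - z')` with
`z' = e^{± iρ} / t`. As the functional calculus is multiplicative (`logCalc_mul_logCalc`), the
bilinear form of the hypothesis is an integral over `Im w' = ± ρ` of `b(w')` times that kernel
applied to `A` (`AssumptionSigma.bilin_eq`). For `x = J y`, Fubini's theorem and Cauchy's formula in
`z'` identify the combination of the two forms with the contour integral
`Υ = (2πi)⁻¹ ∫ (z - μ)⁻¹ b a Q dz / z` over the inner contour `Im w = ± ν`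
(`contourMean_mul_logCalc_sqrtKernel`), so that `‖Υ y‖ ≤ C ‖J y‖`
(`AssumptionSigma.norm_sumTransform_apply_le`). On the other hand, the resolvent identity and
Cauchy's theorem give `A S J = -Υ` (`contourMean_kernel_eq_neg`, `AssumptionSigma.opS_mem_graph`).
Thus `A S` extends to a bounded operator `T` with `T J = -Υ`.

For `x` in the domain of `A + B`, the operator `a b` applied to `(A + B) x` splits as
`a A x + b B x`; the second part is holomorphic inside of the contour and the first one reproduces
the resolvent of `A`, whence `Υ (A + B) x = -J A x` (`AssumptionSigma.sumTransform_apply_add`). As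
`J` is injective and commutes with `T`, this means that `T (A + B) x = A x`. Hence `y = (A + B) x`
if and only if `A x = T y` and `B x = y - T y`, and this condition is closed in `(x, y)`
(`isClosed_add_of_apply_eq`).
-/

noncomputable section

namespace OperatorSum

/-! ### Integrals over horizontal lines -/

open Filter Topology Complex in
/-- The difference of the integrals of `1 / (w - w₀)` over `[-R + ia, R + ia]` and
`[-R + ib, R + ib]`, where `w₀` lies between these segments, tends to `2πi`. -/
theorem tendsto_integral_inv_sub_inv {a b : ℝ} {w₀ : ℂ} (ha : a < w₀.im) (hb : w₀.im < b) :
    Tendsto (fun R : ℝ => (∫ x in (-R)..R, ((x : ℂ) + a * I - w₀)⁻¹) -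
      ∫ x in (-R)..R, ((x : ℂ) + b * I - w₀)⁻¹) atTop (𝓝 (2 * Real.pi * I)) := by
  have hftc : ∀ c : ℝ, c ≠ w₀.im → ∀ R : ℝ, ∫ x in (-R)..R, ((x : ℂ) + c * I - w₀)⁻¹ =
      log ((R : ℂ) + c * I - w₀) - log (((-R : ℝ) : ℂ) + c * I - w₀) := by
    intro c hc R
    have him : ∀ x : ℝ, ((x : ℂ) + c * I - w₀).im ≠ 0 := by
      intro x
      simpa [sub_eq_zero] using hc
    refine intervalIntegral.integral_eq_sub_of_hasDerivAt
      (f := fun x : ℝ => log ((x : ℂ) + c * I - w₀)) (fun x _ => ?_) ?_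
    · have h1 : HasDerivAt (fun x : ℝ => (x : ℂ) + c * I - w₀) 1 x :=
        ((HasDerivAt.ofReal_comp (hasDerivAt_id x)).add_const _).sub_const _
      simpa using h1.clog_real (mem_slitPlane_iff.2 (Or.inr (him x)))
    · refine ContinuousOn.intervalIntegrable (Continuous.continuousOn ?_)
      refine Continuous.inv₀ (by fun_prop) fun x h => him x (by rw [h]; simp)
  have hsplit : ∀ (c : ℝ) (σ : ℝ), c ≠ w₀.im → ∀ᶠ R : ℝ in atTop,
      log (((σ * R : ℝ) : ℂ) + c * I - w₀) =
        Real.log R + log ((σ : ℂ) + (c * I - w₀) * ((R⁻¹ : ℝ) : ℂ)) := by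
    intro c σ hc
    filter_upwards [eventually_gt_atTop 0] with R hR
    have hR' : (R : ℂ) ≠ 0 := by exact_mod_cast hR.ne'
    rw [← log_ofReal_mul hR]
    · congr 1
      push_cast
      field_simp
      ring
    · intro h
      have h2 := congrArg im h
      have h3 : ((c - w₀.im) * R⁻¹ : ℝ) = 0 := by simpa using h2
      rcases mul_eq_zero.1 h3 with h4 | h4
      · exact hc (sub_eq_zero.1 h4)
      · exact hR.ne' (inv_eq_zero.1 h4)
  have hlim : ∀ (c σ : ℝ), Tendsto (fun R : ℝ => (σ : ℂ) + (c * I - w₀) * ((R⁻¹ : ℝ) : ℂ))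
      atTop (𝓝 (σ : ℂ)) := by
    intro c σ
    have : Tendsto (fun R : ℝ => ((R⁻¹ : ℝ) : ℂ)) atTop (𝓝 ((0 : ℝ) : ℂ)) :=
      (continuous_ofReal.tendsto 0).comp tendsto_inv_atTop_zero
    simpa using (this.const_mul (c * I - w₀)).const_add (σ : ℂ)
  have him : ∀ c R : ℝ, (((-1 : ℝ) : ℂ) + (c * I - w₀) * ((R⁻¹ : ℝ) : ℂ)).im =
      (c - w₀.im) * R⁻¹ := by
    intro c R; simp
  have hpos : ∀ c : ℝ, Tendsto (fun R : ℝ => log (((1 : ℝ) : ℂ) + (c * I - w₀) * ((R⁻¹ : ℝ) : ℂ)))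
      atTop (𝓝 0) := by
    intro c
    have h1 : ContinuousAt log ((1 : ℝ) : ℂ) := continuousAt_clog (by simp)
    simpa [Function.comp_def] using h1.tendsto.comp (hlim c 1)
  have hnega : Tendsto (fun R : ℝ => log (((-1 : ℝ) : ℂ) + (a * I - w₀) * ((R⁻¹ : ℝ) : ℂ)))
      atTop (𝓝 (-(Real.pi * I))) := by
    have h1 := tendsto_log_nhdsWithin_im_neg_of_re_neg_of_im_zero (z := ((-1 : ℝ) : ℂ))
      (by simp) (by simp)
    have h2 : Tendsto (fun R : ℝ => ((-1 : ℝ) : ℂ) + (a * I - w₀) * ((R⁻¹ : ℝ) : ℂ))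
        atTop (𝓝[{z : ℂ | z.im < 0}] ((-1 : ℝ) : ℂ)) := by
      refine tendsto_nhdsWithin_iff.2 ⟨hlim a (-1), ?_⟩
      filter_upwards [eventually_gt_atTop 0] with R hR
      rw [him]
      exact mul_neg_of_neg_of_pos (by linarith) (by positivity)
    simpa [Function.comp_def] using h1.comp h2
  have hnegb : Tendsto (fun R : ℝ => log (((-1 : ℝ) : ℂ) + (b * I - w₀) * ((R⁻¹ : ℝ) : ℂ)))
      atTop (𝓝 (Real.pi * I)) := by
    have h1 := tendsto_log_nhdsWithin_im_nonneg_of_re_neg_of_im_zero (z := ((-1 : ℝ) : ℂ))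
      (by simp) (by simp)
    have h2 : Tendsto (fun R : ℝ => ((-1 : ℝ) : ℂ) + (b * I - w₀) * ((R⁻¹ : ℝ) : ℂ))
        atTop (𝓝[{z : ℂ | 0 ≤ z.im}] ((-1 : ℝ) : ℂ)) := by
      refine tendsto_nhdsWithin_iff.2 ⟨hlim b (-1), ?_⟩
      filter_upwards [eventually_gt_atTop 0] with R hR
      rw [him]
      exact mul_nonneg (by linarith) (by positivity)
    simpa [Function.comp_def] using h1.comp h2
  have hall := ((hpos a).sub hnega).sub ((hpos b).sub hnegb)
  have hval : (0 : ℂ) - -(Real.pi * I) - (0 - Real.pi * I) = 2 * Real.pi * I := by ring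
  rw [hval] at hall
  refine hall.congr' ?_
  filter_upwards [hsplit a 1 ha.ne, hsplit a (-1) ha.ne, hsplit b 1 hb.ne', hsplit b (-1) hb.ne']
    with R h1 h2 h3 h4
  rw [one_mul] at h1 h3
  rw [neg_one_mul] at h2 h4
  rw [hftc a ha.ne, hftc b hb.ne', h1, h2, h3, h4]
  ring

section Lines

variable {E : Type*} [NormedAddCommGroup E] [NormedSpace ℂ E]

/-- The integral of `f` over the horizontal line `{Im w = θ}`, from left to right. -/
def lineIntegral (θ : ℝ) (f : ℂ → E) : E := ∫ s : ℝ, f (s + θ * Complex.I)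

/-- `f` decays exponentially at both ends of the horizontal strip `{a ≤ Im w ≤ b}`. -/
def DecaysOnStrip {V : Type*} [NormedAddCommGroup V] (a b : ℝ) (f : ℂ → V) : Prop :=
  ∃ C ε R : ℝ, 0 < ε ∧ ∀ w : ℂ, a ≤ w.im → w.im ≤ b → R ≤ |w.re| →
    ‖f w‖ ≤ C * Real.exp (-ε * |w.re|)

theorem integrable_exp_neg_mul_abs {ε : ℝ} (hε : 0 < ε) :
    Integrable fun s : ℝ => Real.exp (-ε * |s|) := by
  rw [← integrableOn_univ, ← Iic_union_Ioi (a := (0 : ℝ)), integrableOn_union]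
  constructor
  · refine (integrableOn_exp_mul_Iic hε 0).congr_fun (fun s hs => ?_) measurableSet_Iic
    simp only [abs_of_nonpos (show s ≤ 0 from hs)]
    ring_nf
  · refine (integrableOn_exp_mul_Ioi (neg_lt_zero.2 hε) 0).congr_fun (fun s hs => ?_)
      measurableSet_Ioi
    simp only [abs_of_pos (show 0 < s from hs)]

theorem tendsto_exp_neg_mul_atTop {ε : ℝ} (hε : 0 < ε) :
    Filter.Tendsto (fun R : ℝ => Real.exp (-ε * R)) Filter.atTop (nhds 0) :=
  Real.tendsto_exp_atBot.comp ((Filter.tendsto_const_mul_atBot_of_neg (neg_lt_zero.2 hε)).2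
    Filter.tendsto_id)

theorem DecaysOnStrip.integrable {V : Type*} [NormedAddCommGroup V] {a b c : ℝ} {f : ℂ → V}
    (hf : DecaysOnStrip a b f)
    (hac : a ≤ c) (hcb : c ≤ b) (hc : Continuous fun s : ℝ => f (s + c * Complex.I)) :
    Integrable fun s : ℝ => f (s + c * Complex.I) := by
  obtain ⟨C, ε, R, hε, h⟩ := hf
  refine hc.locallyIntegrable.integrable_of_isBigO_cocompact
    (g := fun s : ℝ => Real.exp (-ε * |s|)) ?_
    ((integrable_exp_neg_mul_abs hε).integrableAtFilter _)
  refine Asymptotics.IsBigO.of_bound C ?_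
  have hev : ∀ᶠ s : ℝ in Filter.cocompact ℝ, R ≤ ‖s‖ :=
    (tendsto_norm_cocompact_atTop (E := ℝ)).eventually_ge_atTop R
  filter_upwards [hev] with s hs
  have := h (s + c * Complex.I) (by simpa using hac) (by simpa using hcb) (by simpa using hs)
  simpa [Real.abs_exp] using this

open Filter Topology Complex in
/-- The residue theorem on a strip with a single simple pole `w₀` inside. -/
theorem lineIntegral_sub_lineIntegral_eq_residue [CompleteSpace E] {a b : ℝ} {w₀ : ℂ}
    {f : ℂ → E} {L : E} (ha : a < w₀.im) (hb : w₀.im < b)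
    (hd : ∀ w : ℂ, a ≤ w.im → w.im ≤ b → w ≠ w₀ → DifferentiableAt ℂ f w)
    (hL : Tendsto (fun w => (w - w₀) • f w) (𝓝[≠] w₀) (𝓝 L)) (hdec : DecaysOnStrip a b f) :
    lineIntegral a f - lineIntegral b f = (2 * Real.pi * I : ℂ) • L := by
  have hca : Continuous fun s : ℝ => f (s + a * I) := continuous_iff_continuousAt.2 fun s =>
    ContinuousAt.comp (f := fun s : ℝ => (s : ℂ) + a * I)
      (hd _ (by simp) (by simp; linarith) (fun h => ha.ne (by simp [← h]))).continuousAt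
      (by fun_prop)
  have hcb : Continuous fun s : ℝ => f (s + b * I) := continuous_iff_continuousAt.2 fun s =>
    ContinuousAt.comp (f := fun s : ℝ => (s : ℂ) + b * I)
      (hd _ (by simp; linarith) (by simp) (fun h => hb.ne' (by simp [← h]))).continuousAt
      (by fun_prop)
  have hia := hdec.integrable le_rfl (ha.trans hb).le hca
  have hib := hdec.integrable (ha.trans hb).le le_rfl hcb
  -- `g` is `f` with its principal part `L / (w - w₀)` removed.
  set H : ℂ → E := Function.update (fun w => (w - w₀) • f w) w₀ L with hH
  have hHw₀ : H w₀ = L := by simp [hH]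
  have hHne : ∀ w, w ≠ w₀ → H w = (w - w₀) • f w := fun w hw => by simp [hH, hw]
  have hHd : ∀ w : ℂ, a ≤ w.im → w.im ≤ b → w ≠ w₀ → DifferentiableAt ℂ H w := by
    intro w h1 h2 h3
    have h4 : H =ᶠ[𝓝 w] fun w => (w - w₀) • f w := by
      filter_upwards [isOpen_ne.mem_nhds h3] with z hz using hHne z hz
    rw [h4.differentiableAt_iff]
    exact (differentiableAt_id.sub_const w₀).smul (hd w h1 h2 h3)
  have hHdw₀ : DifferentiableAt ℂ H w₀ := by
    refine (analyticAt_of_differentiable_on_punctured_nhds_of_continuousAt ?_ ?_).differentiableAt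
    · have hopen : IsOpen {w : ℂ | a < w.im ∧ w.im < b} :=
        (isOpen_lt continuous_const continuous_im).inter (isOpen_lt continuous_im continuous_const)
      filter_upwards [self_mem_nhdsWithin, mem_nhdsWithin_of_mem_nhds (hopen.mem_nhds ⟨ha, hb⟩)]
        with w hw hw2 using hHd w hw2.1.le hw2.2.le hw
    · exact continuousAt_update_same.2 hL
  set g : ℂ → E := dslope H w₀ with hg
  have hgne : ∀ w, w ≠ w₀ → g w = f w - (w - w₀)⁻¹ • L := by
    intro w hw
    rw [hg, dslope_of_ne _ hw, slope_def_module, hHne w hw, hHw₀, smul_sub, smul_smul,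
      inv_mul_cancel₀ (sub_ne_zero.2 hw), one_smul]
  have hgc : ∀ w : ℂ, a ≤ w.im → w.im ≤ b → ContinuousAt g w := by
    intro w h1 h2
    by_cases h : w = w₀
    · rw [h]; exact continuousAt_dslope_same.2 hHdw₀
    · exact (continuousAt_dslope_of_ne h).2 (hHd w h1 h2 h).continuousAt
  obtain ⟨C, ε, R₀, hε, hbd⟩ := hdec
  have hrect : ∀ R : ℝ, (∫ x in (-R)..R, f (x + a * I)) - (∫ x in (-R)..R, f (x + b * I)) -
      ((∫ x in (-R)..R, ((x : ℂ) + a * I - w₀)⁻¹) -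
        ∫ x in (-R)..R, ((x : ℂ) + b * I - w₀)⁻¹) • L =
      I • (∫ y in a..b, g ((-R : ℝ) + y * I)) - I • ∫ y in a..b, g (R + y * I) := by
    intro R
    have h := integral_boundary_rect_eq_zero_of_differentiable_on_off_countable g
      (⟨-R, a⟩ : ℂ) ⟨R, b⟩ {w₀} (countable_singleton _) ?_ ?_
    · simp only at h
      have hne : ∀ c : ℝ, c ≠ w₀.im → ∀ x : ℝ, (x : ℂ) + c * I ≠ w₀ := by
        intro c hc x hx
        exact hc (by simp [← hx])
      have hline : ∀ c : ℝ, c ≠ w₀.im → Continuous (fun s : ℝ => f (s + c * I)) →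
          ∫ x in (-R)..R, g (x + c * I) = (∫ x in (-R)..R, f (x + c * I)) -
            (∫ x in (-R)..R, ((x : ℂ) + c * I - w₀)⁻¹) • L := by
        intro c hc hcont
        have hcont2 : Continuous fun x : ℝ => ((x : ℂ) + c * I - w₀)⁻¹ :=
          Continuous.inv₀ (by fun_prop) fun x => sub_ne_zero.2 (hne c hc x)
        have hint : IntervalIntegrable (fun x : ℝ => ((x : ℂ) + c * I - w₀)⁻¹ • L) volume (-R) R :=
          (hcont2.smul continuous_const).intervalIntegrable _ _
        rw [← intervalIntegral.integral_smul_const, ← intervalIntegral.integral_sub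
          (hcont.intervalIntegrable _ _) hint]
        refine intervalIntegral.integral_congr fun x _ => ?_
        simp only [hgne _ (hne c hc x)]
      rw [hline a ha.ne hca, hline b hb.ne' hcb] at h
      rw [sub_smul, ← sub_eq_zero, ← h]
      push_cast
      abel
    · intro w hw
      rw [mem_reProdIm, uIcc_of_le (ha.trans hb).le] at hw
      exact (hgc w hw.2.1 hw.2.2).continuousWithinAt
    · rintro w ⟨hw, hw2⟩
      rw [mem_reProdIm, min_eq_left (ha.trans hb).le, max_eq_right (ha.trans hb).le] at hw
      exact (differentiableAt_dslope_of_ne hw2).2 (hHd w hw.2.1.le hw.2.2.le hw2)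
  have hvert : ∀ σ : ℝ, |σ| = 1 →
      Tendsto (fun R : ℝ => ∫ y in a..b, g ((σ * R : ℝ) + y * I)) atTop (𝓝 0) := by
    intro σ hσ
    have hlim : Tendsto (fun R : ℝ => (C * Real.exp (-ε * R) + (R - |w₀.re|)⁻¹ * ‖L‖) * |b - a|)
        atTop (𝓝 0) := by
      have h1 := (tendsto_exp_neg_mul_atTop hε).const_mul C
      have h2 : Tendsto (fun R : ℝ => (R - |w₀.re|)⁻¹) atTop (𝓝 0) :=
        tendsto_inv_atTop_zero.comp (tendsto_atTop_add_const_right _ _ tendsto_id)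
      simpa using (h1.add (h2.mul_const ‖L‖)).mul_const |b - a|
    refine squeeze_zero_norm' ?_ hlim
    filter_upwards [eventually_ge_atTop R₀, eventually_gt_atTop |w₀.re|] with R hR hR2
    have hR0 : 0 < R := (abs_nonneg _).trans_lt hR2
    refine intervalIntegral.norm_integral_le_of_norm_le_const fun y hy => ?_
    rw [uIoc_of_le (ha.trans hb).le] at hy
    have habs : |((σ * R : ℝ) + y * I : ℂ).re| = R := by
      simp [abs_mul, hσ, abs_of_pos hR0]
    have hdist : R - |w₀.re| ≤ ‖((σ * R : ℝ) + y * I : ℂ) - w₀‖ := by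
      refine le_trans ?_ (abs_re_le_norm _)
      rw [sub_re]
      have := abs_sub_abs_le_abs_sub ((σ * R : ℝ) + y * I : ℂ).re w₀.re
      linarith
    have hne : ((σ * R : ℝ) + y * I : ℂ) ≠ w₀ := by
      intro h
      rw [h, sub_self, norm_zero] at hdist
      linarith
    rw [hgne _ hne]
    refine (norm_sub_le _ _).trans (add_le_add ?_ ?_)
    · have := hbd ((σ * R : ℝ) + y * I) (by simpa using hy.1.le) (by simpa using hy.2)
        (by rw [habs]; exact hR)
      rwa [habs] at this
    · rw [norm_smul, norm_inv]
      gcongr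
  have hl : Tendsto (fun R : ℝ => (∫ x in (-R)..R, f (x + a * I)) -
      (∫ x in (-R)..R, f (x + b * I)) - ((∫ x in (-R)..R, ((x : ℂ) + a * I - w₀)⁻¹) -
        ∫ x in (-R)..R, ((x : ℂ) + b * I - w₀)⁻¹) • L) atTop
      (𝓝 (lineIntegral a f - lineIntegral b f - (2 * Real.pi * I : ℂ) • L)) :=
    ((intervalIntegral_tendsto_integral hia tendsto_neg_atTop_atBot tendsto_id).sub
      (intervalIntegral_tendsto_integral hib tendsto_neg_atTop_atBot tendsto_id)).sub
      ((tendsto_integral_inv_sub_inv ha hb).smul_const L)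
  have hr : Tendsto (fun R : ℝ => I • (∫ y in a..b, g ((-R : ℝ) + y * I)) -
      I • ∫ y in a..b, g (R + y * I)) atTop (𝓝 0) := by
    have h1 := (hvert (-1) (by simp)).const_smul I
    have h2 := (hvert 1 (by simp)).const_smul I
    simpa using h1.sub h2
  simp only [hrect] at hl
  exact sub_eq_zero.1 (tendsto_nhds_unique hl hr)

/-- Cauchy's theorem on a strip. -/
theorem lineIntegral_eq_lineIntegral [CompleteSpace E] {a b : ℝ} {f : ℂ → E} (hab : a < b)
    (hd : ∀ w : ℂ, a ≤ w.im → w.im ≤ b → DifferentiableAt ℂ f w) (hdec : DecaysOnStrip a b f) :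
    lineIntegral a f = lineIntegral b f := by
  have him : (((a + b) / 2 : ℝ) * Complex.I : ℂ).im = (a + b) / 2 := by simp
  have hc : ContinuousAt f (((a + b) / 2 : ℝ) * Complex.I : ℂ) :=
    (hd _ (by rw [him]; linarith) (by rw [him]; linarith)).continuousAt
  have h := lineIntegral_sub_lineIntegral_eq_residue (f := f) (L := 0)
    (w₀ := ((a + b) / 2 : ℝ) * Complex.I) (by rw [him]; linarith) (by rw [him]; linarith)
    (fun w h1 h2 _ => hd w h1 h2) ?_ hdec
  · rw [smul_zero] at h
    exact sub_eq_zero.1 h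
  · have h1 : ContinuousAt (fun w => (w - ((a + b) / 2 : ℝ) * Complex.I) • f w)
        (((a + b) / 2 : ℝ) * Complex.I : ℂ) := (by fun_prop : ContinuousAt _ _).smul hc
    have h2 := h1.tendsto
    simp only [sub_self, zero_smul] at h2
    exact h2.mono_left nhdsWithin_le_nhds

end Lines

/-! ### Estimates for the kernel `1 / (e^w - e^{w'})` -/

theorem norm_exp_sub_exp_ge_sin (w w' : ℂ) :
    |Real.sin ((w.im - w'.im) / 2)| * (Real.exp w.re + Real.exp w'.re) ≤
      ‖Complex.exp w - Complex.exp w'‖ := by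
  refine (sq_le_sq₀ (by positivity) (norm_nonneg _)).1 ?_
  rw [← Complex.normSq_eq_norm_sq, Complex.normSq_apply, mul_pow, sq_abs]
  simp only [Complex.sub_re, Complex.sub_im, Complex.exp_re, Complex.exp_im]
  have hcos : Real.cos w.im * Real.cos w'.im + Real.sin w.im * Real.sin w'.im =
      1 - 2 * Real.sin ((w.im - w'.im) / 2) ^ 2 := by
    have h1 := Real.cos_two_mul' ((w.im - w'.im) / 2)
    rw [Real.cos_sq', mul_div_cancel₀ _ two_ne_zero, Real.cos_sub] at h1
    linarith
  have h1 := Real.sin_sq_add_cos_sq w.im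
  have h2 := Real.sin_sq_add_cos_sq w'.im
  have h3 := Real.sin_sq_le_one ((w.im - w'.im) / 2)
  generalize Real.sin ((w.im - w'.im) / 2) = S at *
  generalize Real.exp w.re = r at *
  generalize Real.exp w'.re = r' at *
  have key : (r * Real.cos w.im - r' * Real.cos w'.im) * (r * Real.cos w.im - r' * Real.cos w'.im) +
      (r * Real.sin w.im - r' * Real.sin w'.im) * (r * Real.sin w.im - r' * Real.sin w'.im) =
      (r - r') ^ 2 + 4 * r * r' * S ^ 2 := by
    linear_combination r ^ 2 * h1 + r' ^ 2 * h2 - 2 * r * r' * hcos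
  rw [key]
  nlinarith [mul_nonneg (sub_nonneg.2 h3) (sq_nonneg (r - r'))]

/-- Points of two lines at angular distance at least `η` modulo `2π`. -/
theorem norm_exp_sub_exp_ge {η : ℝ} (hη : 0 ≤ η) {w w' : ℂ} (h1 : η ≤ |w.im - w'.im|)
    (h2 : |w.im - w'.im| ≤ 2 * Real.pi - η) :
    Real.sin (η / 2) * (Real.exp w.re + Real.exp w'.re) ≤
      ‖Complex.exp w - Complex.exp w'‖ := by
  refine le_trans ?_ (norm_exp_sub_exp_ge_sin w w')
  refine mul_le_mul_of_nonneg_right ?_ (by positivity)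
  have h3 : |Real.sin ((w.im - w'.im) / 2)| = |Real.sin (|w.im - w'.im| / 2)| := by
    rcases abs_cases (w.im - w'.im) with h | h
    · rw [h.1]
    · rw [h.1, neg_div, Real.sin_neg, abs_neg]
  rw [h3]
  refine le_trans ?_ (le_abs_self _)
  rcases le_total |w.im - w'.im| Real.pi with h | h
  · exact Real.sin_le_sin_of_le_of_le_pi_div_two (by linarith [Real.pi_pos]) (by linarith)
      (by linarith)
  · rw [← Real.sin_pi_sub (|w.im - w'.im| / 2)]
    exact Real.sin_le_sin_of_le_of_le_pi_div_two (by linarith [Real.pi_pos]) (by linarith)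
      (by linarith)

theorem norm_exp_sub_exp_ge_of_re {w w' : ℂ} (h : 1 ≤ |w.re - w'.re|) :
    (1 / 3) * (Real.exp w.re + Real.exp w'.re) ≤ ‖Complex.exp w - Complex.exp w'‖ := by
  have key : ∀ x y : ℝ, 1 ≤ x - y →
      (1 / 3) * (Real.exp x + Real.exp y) ≤ Real.exp x - Real.exp y := by
    intro x y hxy
    have h1 : Real.exp x = Real.exp (x - y) * Real.exp y := by rw [← Real.exp_add]; ring_nf
    have h2 := Real.add_one_le_exp (x - y)
    nlinarith [Real.exp_pos y]
  have h3 := norm_sub_norm_le (Complex.exp w) (Complex.exp w')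
  have h4 := norm_sub_norm_le (Complex.exp w') (Complex.exp w)
  rw [norm_sub_rev] at h4
  rw [Complex.norm_exp, Complex.norm_exp] at h3 h4
  rcases le_abs.1 h with h | h
  · linarith [key _ _ h]
  · linarith [key w'.re w.re (by linarith)]

theorem exp_ne_exp_of_im {w w' : ℂ} (h : 0 < |w.im - w'.im|) (h' : |w.im - w'.im| < 2 * Real.pi) :
    Complex.exp w ≠ Complex.exp w' := by
  intro he
  have h1 := norm_exp_sub_exp_ge (η := min |w.im - w'.im| (2 * Real.pi - |w.im - w'.im|))
    (le_min h.le (by linarith)) (min_le_left _ _) (by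
      have := min_le_right (|w.im - w'.im|) (2 * Real.pi - |w.im - w'.im|)
      linarith)
  rw [he, sub_self, norm_zero] at h1
  have h2 : 0 < min |w.im - w'.im| (2 * Real.pi - |w.im - w'.im|) := lt_min h (by linarith)
  have h3 : min |w.im - w'.im| (2 * Real.pi - |w.im - w'.im|) ≤ Real.pi := by
    rcases le_total |w.im - w'.im| Real.pi with h | h
    · exact (min_le_left _ _).trans h
    · exact (min_le_right _ _).trans (by linarith)
  have h4 := Real.sin_pos_of_pos_of_lt_pi (half_pos h2) (by linarith [Real.pi_pos])
  have h5 : 0 < Real.exp w.re + Real.exp w'.re := by positivity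
  nlinarith [mul_pos h4 h5]

theorem exp_ne_exp_of_ne {w w' : ℂ} (h : w ≠ w') (h' : |w.im - w'.im| < 2 * Real.pi) :
    Complex.exp w ≠ Complex.exp w' := by
  intro he
  by_cases him : w.im = w'.im
  · refine h (Complex.ext ?_ him)
    have := congrArg norm he
    rwa [Complex.norm_exp, Complex.norm_exp, Real.exp_eq_exp] at this
  · exact exp_ne_exp_of_im (abs_pos.2 (sub_ne_zero.2 him)) h' he

open Filter Topology in
/-- `1 / (e^w - e^{w₀})` has residue `e^{-w₀}` at `w₀`. -/
theorem tendsto_sub_mul_inv_exp_sub_exp (w₀ : ℂ) :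
    Tendsto (fun w => (w - w₀) * (Complex.exp w - Complex.exp w₀)⁻¹) (𝓝[≠] w₀)
      (𝓝 (Complex.exp (-w₀))) := by
  have h := (hasDerivAt_iff_tendsto_slope.1 (Complex.hasDerivAt_exp w₀)).inv₀
    (Complex.exp_ne_zero _)
  rw [← Complex.exp_neg] at h
  refine h.congr fun w => ?_
  rw [slope_def_field, inv_div, div_eq_mul_inv]

section Kernel

variable {E : Type*} [NormedAddCommGroup E] [NormedSpace ℂ E]

/-- The growth condition on `G` under which `G w / (e^w - e^{w₀})` decays exponentially at both
ends of the strip `{a ≤ Im w ≤ b}`. -/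
def KernelGrowth (a b : ℝ) (G : ℂ → E) : Prop :=
  ∃ C ε : ℝ, 0 < ε ∧ ∀ w : ℂ, a ≤ w.im → w.im ≤ b →
    ‖G w‖ ≤ C * (Real.exp (-ε * |w.re|) * (1 + Real.exp w.re))

theorem one_add_exp_le (s s₀ : ℝ) :
    1 + Real.exp s ≤ (1 + Real.exp (-s₀)) * (Real.exp s + Real.exp s₀) := by
  have h1 : Real.exp (-s₀) * Real.exp s₀ = 1 := by rw [← Real.exp_add]; simp
  nlinarith [Real.exp_pos s, Real.exp_pos s₀, mul_pos (Real.exp_pos (-s₀)) (Real.exp_pos s)]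

theorem norm_inv_smul_le_of_kernel {C c ε : ℝ} (hc : 0 < c) {w w₀ : ℂ} {v : E}
    (hv : ‖v‖ ≤ C * (Real.exp (-ε * |w.re|) * (1 + Real.exp w.re)))
    (hk : c * (Real.exp w.re + Real.exp w₀.re) ≤ ‖Complex.exp w - Complex.exp w₀‖) :
    ‖(Complex.exp w - Complex.exp w₀)⁻¹ • v‖ ≤
      |C| * (1 + Real.exp (-w₀.re)) / c * Real.exp (-ε * |w.re|) := by
  have hpos : 0 < Real.exp w.re + Real.exp w₀.re := by positivity
  have hk' : 0 < c * (Real.exp w.re + Real.exp w₀.re) := by positivity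
  rw [norm_smul, norm_inv]
  calc ‖Complex.exp w - Complex.exp w₀‖⁻¹ * ‖v‖
      ≤ (c * (Real.exp w.re + Real.exp w₀.re))⁻¹ *
        (|C| * (Real.exp (-ε * |w.re|) *
          ((1 + Real.exp (-w₀.re)) * (Real.exp w.re + Real.exp w₀.re)))) := by
        refine mul_le_mul (inv_anti₀ hk' hk) (hv.trans ?_) (norm_nonneg _) (by positivity)
        exact mul_le_mul (le_abs_self C)
          (mul_le_mul_of_nonneg_left (one_add_exp_le _ _) (by positivity)) (by positivity)
          (abs_nonneg _)
    _ = _ := by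
        field_simp

theorem KernelGrowth.decaysOnStrip {a b : ℝ} {G : ℂ → E} (hG : KernelGrowth a b G) (w₀ : ℂ) :
    DecaysOnStrip a b fun w => (Complex.exp w - Complex.exp w₀)⁻¹ • G w := by
  obtain ⟨C, ε, hε, h⟩ := hG
  refine ⟨|C| * (1 + Real.exp (-w₀.re)) / (1 / 3), ε, |w₀.re| + 1, hε, fun w h1 h2 h3 => ?_⟩
  refine norm_inv_smul_le_of_kernel (by norm_num) (h w h1 h2) (norm_exp_sub_exp_ge_of_re ?_)
  linarith [abs_sub_abs_le_abs_sub w.re w₀.re]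

theorem differentiableAt_inv_exp_sub_smul {G : ℂ → E} {w w₀ : ℂ} (hG : DifferentiableAt ℂ G w)
    (hne : Complex.exp w ≠ Complex.exp w₀) :
    DifferentiableAt ℂ (fun w => (Complex.exp w - Complex.exp w₀)⁻¹ • G w) w :=
  DifferentiableAt.smul (DifferentiableAt.inv (by fun_prop) (sub_ne_zero.2 hne)) hG

open Filter Topology in
/-- The residue of `G w / (e^w - e^{w₀})` on a strip containing `w₀` but no other `w₀ + 2πik`. -/
theorem lineIntegral_sub_lineIntegral_kernel [CompleteSpace E] {a b : ℝ} {w₀ : ℂ} {G : ℂ → E}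
    (ha : a < w₀.im) (hb : w₀.im < b) (ha' : w₀.im - a < 2 * Real.pi)
    (hb' : b - w₀.im < 2 * Real.pi)
    (hd : ∀ w : ℂ, a ≤ w.im → w.im ≤ b → DifferentiableAt ℂ G w) (hG : KernelGrowth a b G) :
    lineIntegral a (fun w => (Complex.exp w - Complex.exp w₀)⁻¹ • G w) -
      lineIntegral b (fun w => (Complex.exp w - Complex.exp w₀)⁻¹ • G w) =
      (2 * Real.pi * Complex.I : ℂ) • Complex.exp (-w₀) • G w₀ := by
  refine lineIntegral_sub_lineIntegral_eq_residue ha hb (fun w h1 h2 h3 => ?_) ?_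
    (hG.decaysOnStrip w₀)
  · refine differentiableAt_inv_exp_sub_smul (hd w h1 h2) (exp_ne_exp_of_ne h3 ?_)
    rw [abs_lt]
    constructor <;> linarith
  · have h1 := (tendsto_sub_mul_inv_exp_sub_exp w₀).smul
      ((hd w₀ ha.le hb.le).continuousAt.tendsto.mono_left nhdsWithin_le_nhds)
    simpa only [smul_smul] using h1

/-- The integrals of `G w / (e^w - e^{w₀})` along the two sides of a strip without poles agree. -/
theorem lineIntegral_eq_lineIntegral_kernel [CompleteSpace E] {a b : ℝ} {w₀ : ℂ} {G : ℂ → E}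
    (hab : a < b)
    (hw₀ : ∀ w : ℂ, a ≤ w.im → w.im ≤ b → 0 < |w.im - w₀.im| ∧ |w.im - w₀.im| < 2 * Real.pi)
    (hd : ∀ w : ℂ, a ≤ w.im → w.im ≤ b → DifferentiableAt ℂ G w) (hG : KernelGrowth a b G) :
    lineIntegral a (fun w => (Complex.exp w - Complex.exp w₀)⁻¹ • G w) =
      lineIntegral b (fun w => (Complex.exp w - Complex.exp w₀)⁻¹ • G w) :=
  lineIntegral_eq_lineIntegral hab (fun w h1 h2 => differentiableAt_inv_exp_sub_smul (hd w h1 h2)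
    (exp_ne_exp_of_im (hw₀ w h1 h2).1 (hw₀ w h1 h2).2)) (hG.decaysOnStrip w₀)

end Kernel

/-! ### Integrals over a symmetric pair of lines -/

section ContourMean

variable {E F : Type*} [NormedAddCommGroup E] [NormedSpace ℂ E]
  [NormedAddCommGroup F] [NormedSpace ℂ F]

/-- `(2πi)⁻¹ (∫_{Im w = -ν} f - ∫_{Im w = ν} f)`: in the coordinate `z = e^w`, this is the integral
`(2πi)⁻¹ ∫ f dz/z` along the positively oriented boundary of the sector `{|arg z| < ν}`. -/
def contourMean (ν : ℝ) (f : ℂ → E) : E :=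
  (2 * Real.pi * Complex.I : ℂ)⁻¹ • (lineIntegral (-ν) f - lineIntegral ν f)

/-- Integrability along both lines `{Im w = ± ν}`. -/
def LineIntegrable {V : Type*} [NormedAddCommGroup V] (ν : ℝ) (f : ℂ → V) : Prop :=
  Integrable (fun s : ℝ => f (s + ((-ν : ℝ) : ℂ) * Complex.I)) ∧
    Integrable (fun s : ℝ => f (s + ν * Complex.I))

theorem abs_im_ofReal_add_mul_I (s θ : ℝ) : |((s : ℂ) + θ * Complex.I).im| = |θ| := by simp

theorem lineIntegral_congr {θ : ℝ} {f g : ℂ → E} (h : ∀ w : ℂ, w.im = θ → f w = g w) :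
    lineIntegral θ f = lineIntegral θ g := by
  unfold lineIntegral
  congr 1
  funext s
  exact h _ (by simp)

theorem contourMean_congr {ν : ℝ} (hν : 0 ≤ ν) {f g : ℂ → E}
    (h : ∀ w : ℂ, |w.im| = ν → f w = g w) : contourMean ν f = contourMean ν g := by
  unfold contourMean
  rw [lineIntegral_congr fun w hw => h w (by rw [hw, abs_neg, abs_of_nonneg hν]),
    lineIntegral_congr (θ := ν) fun w hw => h w (by rw [hw, abs_of_nonneg hν])]

theorem continuous_comp_line {V : Type*} [NormedAddCommGroup V] {θ : ℝ} {f : ℂ → V}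
    (hf : ∀ w : ℂ, w.im = θ → ContinuousAt f w) :
    Continuous fun s : ℝ => f (s + θ * Complex.I) :=
  continuous_iff_continuousAt.2 fun s => ContinuousAt.comp
    (f := fun s : ℝ => (s : ℂ) + θ * Complex.I) (hf _ (by simp)) (by fun_prop)

theorem lineIntegrable_of_bound {V : Type*} [NormedAddCommGroup V] {ν C ε : ℝ} (hν : 0 ≤ ν)
    {f : ℂ → V}
    (hc : ∀ w : ℂ, |w.im| = ν → ContinuousAt f w) (hε : 0 < ε)
    (hb : ∀ w : ℂ, |w.im| = ν → ‖f w‖ ≤ C * Real.exp (-ε * |w.re|)) : LineIntegrable ν f := by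
  have key : ∀ θ : ℝ, |θ| = ν → Integrable (fun s : ℝ => f (s + θ * Complex.I)) := by
    intro θ hθ
    refine ((integrable_exp_neg_mul_abs hε).const_mul C).mono'
      (continuous_comp_line fun w hw => hc w (by rw [hw, hθ])).aestronglyMeasurable
      (Filter.Eventually.of_forall fun s => ?_)
    simpa using hb (s + θ * Complex.I) (by rw [abs_im_ofReal_add_mul_I, hθ])
  exact ⟨key _ (by rw [abs_neg, abs_of_nonneg hν]), key _ (abs_of_nonneg hν)⟩

theorem contourMean_add {ν : ℝ} {f g : ℂ → E} (hf : LineIntegrable ν f) (hg : LineIntegrable ν g) :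
    contourMean ν (fun w => f w + g w) = contourMean ν f + contourMean ν g := by
  unfold contourMean lineIntegral
  rw [integral_add hf.1 hg.1, integral_add hf.2 hg.2, ← smul_add]
  congr 1
  abel

theorem contourMean_sub {ν : ℝ} {f g : ℂ → E} (hf : LineIntegrable ν f) (hg : LineIntegrable ν g) :
    contourMean ν (fun w => f w - g w) = contourMean ν f - contourMean ν g := by
  unfold contourMean lineIntegral
  rw [integral_sub hf.1 hg.1, integral_sub hf.2 hg.2, ← smul_sub]
  congr 1
  abel

theorem contourMean_map [CompleteSpace E] [CompleteSpace F] {ν : ℝ} {f : ℂ → E}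
    (hf : LineIntegrable ν f) (T : E →L[ℂ] F) :
    contourMean ν (fun w => T (f w)) = T (contourMean ν f) := by
  unfold contourMean lineIntegral
  rw [T.integral_comp_comm hf.1, T.integral_comp_comm hf.2, map_smul, map_sub]

theorem contourMean_const_smul {ν : ℝ} (c : ℂ) (f : ℂ → E) :
    contourMean ν (fun w => c • f w) = c • contourMean ν f := by
  unfold contourMean lineIntegral
  rw [integral_smul, integral_smul, ← smul_sub, smul_comm]

theorem contourMean_eq_zero {ν : ℝ} {f : ℂ → E} (h : lineIntegral (-ν) f = lineIntegral ν f) :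
    contourMean ν f = 0 := by
  rw [contourMean, h, sub_self, smul_zero]

/-- Fubini's theorem for a line and a pair of lines. -/
theorem lineIntegral_contourMean_swap {θ ν C ε : ℝ} (hν : 0 ≤ ν) (hε : 0 < ε) {k : ℂ → ℂ → E}
    (hc : ∀ w w' : ℂ, w.im = θ → |w'.im| = ν → ContinuousAt (Function.uncurry k) (w, w'))
    (hb : ∀ w w' : ℂ, w.im = θ → |w'.im| = ν →
      ‖k w w'‖ ≤ C * (Real.exp (-ε * |w.re|) * Real.exp (-ε * |w'.re|))) :
    LineIntegrable ν (fun w' => lineIntegral θ fun w => k w w') ∧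
      lineIntegral θ (fun w => contourMean ν fun w' => k w w') =
        contourMean ν fun w' => lineIntegral θ fun w => k w w' := by
  have key : ∀ φ : ℝ, |φ| = ν → Integrable (Function.uncurry fun s u : ℝ =>
      k (s + θ * Complex.I) (u + φ * Complex.I)) (volume.prod volume) := by
    intro φ hφ
    have hcont : Continuous (Function.uncurry fun s u : ℝ =>
        k (s + θ * Complex.I) (u + φ * Complex.I)) :=
      continuous_iff_continuousAt.2 fun p => ContinuousAt.comp
        (g := Function.uncurry k)
        (f := fun p : ℝ × ℝ => ((p.1 : ℂ) + θ * Complex.I, (p.2 : ℂ) + φ * Complex.I))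
        (hc _ _ (by simp) (by rw [abs_im_ofReal_add_mul_I, hφ])) (by fun_prop)
    refine (((integrable_exp_neg_mul_abs hε).mul_prod
      (integrable_exp_neg_mul_abs hε)).const_mul C).mono'
      hcont.aestronglyMeasurable (Filter.Eventually.of_forall fun p => ?_)
    simpa [Function.uncurry_def] using hb (p.1 + θ * Complex.I) (p.2 + φ * Complex.I) (by simp)
      (by rw [abs_im_ofReal_add_mul_I, hφ])
  have h1 := key (-ν) (by rw [abs_neg, abs_of_nonneg hν])
  have h2 := key ν (abs_of_nonneg hν)
  refine ⟨⟨h1.integral_prod_right, h2.integral_prod_right⟩, ?_⟩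
  have h3 := integral_sub h1.integral_prod_left h2.integral_prod_left
  simp only [Function.uncurry_apply_pair] at h3
  unfold contourMean lineIntegral
  rw [integral_smul, h3, integral_integral_swap h1, integral_integral_swap h2]

/-- Fubini's theorem for two pairs of lines. -/
theorem contourMean_contourMean_swap {μ ν C ε : ℝ} (hμ : 0 ≤ μ) (hν : 0 ≤ ν) (hε : 0 < ε)
    {k : ℂ → ℂ → E}
    (hc : ∀ w w' : ℂ, |w.im| = μ → |w'.im| = ν → ContinuousAt (Function.uncurry k) (w, w'))
    (hb : ∀ w w' : ℂ, |w.im| = μ → |w'.im| = ν →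
      ‖k w w'‖ ≤ C * (Real.exp (-ε * |w.re|) * Real.exp (-ε * |w'.re|))) :
    contourMean μ (fun w => contourMean ν fun w' => k w w') =
      contourMean ν fun w' => contourMean μ fun w => k w w' := by
  have key : ∀ θ : ℝ, |θ| = μ → LineIntegrable ν (fun w' => lineIntegral θ fun w => k w w') ∧
      lineIntegral θ (fun w => contourMean ν fun w' => k w w') =
        contourMean ν fun w' => lineIntegral θ fun w => k w w' := fun θ hθ =>
    lineIntegral_contourMean_swap hν hε (fun w w' h1 h2 => hc w w' (by rw [h1, hθ]) h2)
      (fun w w' h1 h2 => hb w w' (by rw [h1, hθ]) h2)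
  obtain ⟨h1, h2⟩ := key (-μ) (by rw [abs_neg, abs_of_nonneg hμ])
  obtain ⟨h3, h4⟩ := key μ (abs_of_nonneg hμ)
  have h5 := contourMean_sub h1 h3
  rw [← h2, ← h4] at h5
  calc _ = (2 * Real.pi * Complex.I : ℂ)⁻¹ • contourMean ν (fun w' =>
        lineIntegral (-μ) (fun w => k w w') - lineIntegral μ fun w => k w w') := by
        rw [h5, contourMean]
    _ = _ := by rw [← contourMean_const_smul]; rfl

theorem LineIntegrable.sub {V : Type*} [NormedAddCommGroup V] {ν : ℝ} {f g : ℂ → V}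
    (hf : LineIntegrable ν f) (hg : LineIntegrable ν g) : LineIntegrable ν fun w => f w - g w :=
  ⟨hf.1.sub hg.1, hf.2.sub hg.2⟩

theorem LineIntegrable.const_smul {ν : ℝ} {f : ℂ → E} (hf : LineIntegrable ν f) (c : ℂ) :
    LineIntegrable ν fun w => c • f w :=
  ⟨hf.1.smul c, hf.2.smul c⟩

theorem LineIntegrable.congr {V : Type*} [NormedAddCommGroup V] {ν : ℝ} (hν : 0 ≤ ν) {f g : ℂ → V}
    (hf : LineIntegrable ν f)
    (h : ∀ w : ℂ, |w.im| = ν → f w = g w) : LineIntegrable ν g := by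
  refine ⟨hf.1.congr (.of_forall fun s => h _ ?_), hf.2.congr (.of_forall fun s => h _ ?_)⟩
  · rw [abs_im_ofReal_add_mul_I, abs_neg, abs_of_nonneg hν]
  · rw [abs_im_ofReal_add_mul_I, abs_of_nonneg hν]

theorem lineIntegrable_contourMean {μ ν C ε : ℝ} (hμ : 0 ≤ μ) (hν : 0 ≤ ν) (hε : 0 < ε)
    {k : ℂ → ℂ → E}
    (hc : ∀ w w' : ℂ, |w.im| = μ → |w'.im| = ν → ContinuousAt (Function.uncurry k) (w, w'))
    (hb : ∀ w w' : ℂ, |w.im| = μ → |w'.im| = ν →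
      ‖k w w'‖ ≤ C * (Real.exp (-ε * |w.re|) * Real.exp (-ε * |w'.re|))) :
    LineIntegrable μ fun w => contourMean ν fun w' => k w w' := by
  have key : ∀ θ : ℝ, |θ| = ν → LineIntegrable μ fun w => lineIntegral θ fun w' => k w w' :=
    fun θ hθ => (lineIntegral_contourMean_swap (k := fun w' w => k w w') hμ hε
      (fun w' w h1 h2 => ContinuousAt.comp (g := Function.uncurry k)
        (f := fun p : ℂ × ℂ => (p.2, p.1)) (hc w w' h2 (by rw [h1, hθ])) (by fun_prop))
      (fun w' w h1 h2 => (hb w w' h2 (by rw [h1, hθ])).trans_eq (by ring))).1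
  exact ((key (-ν) (by rw [abs_neg, abs_of_nonneg hν])).sub
    (key ν (abs_of_nonneg hν))).const_smul _

end ContourMean

/-! ### Functional calculus in the coordinate `z = e^w` -/

section FunctionalCalculus

variable {𝒜 : Type*} [NormedRing 𝒜] [NormedAlgebra ℂ 𝒜]

/-- `a w` behaves on `{ν₀ ≤ |Im w| ≤ ν₁}` like `e^w R(e^w, A)` for a sectorial operator `A`: it is
holomorphic, bounded, and satisfies the resolvent identity. -/
structure IsLogResolvent (ν₀ ν₁ M : ℝ) (a : ℂ → 𝒜) : Prop where
  differentiableAt : ∀ w : ℂ, ν₀ ≤ |w.im| → |w.im| ≤ ν₁ → DifferentiableAt ℂ a w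
  norm_le : ∀ w : ℂ, ν₀ ≤ |w.im| → |w.im| ≤ ν₁ → ‖a w‖ ≤ M
  resolvent_identity : ∀ w w' : ℂ, ν₀ ≤ |w.im| → |w.im| ≤ ν₁ → ν₀ ≤ |w'.im| → |w'.im| ≤ ν₁ →
    (Complex.exp w' - Complex.exp w) • (a w * a w') = Complex.exp w' • a w - Complex.exp w • a w'

/-- `f` is holomorphic and exponentially decaying on the closed strip `{|Im w| ≤ ν}`; in the
coordinate `z = e^w` these are the functions decaying polynomially at `0` and `∞` on a sector. -/
structure IsStripTest (ν : ℝ) (f : ℂ → ℂ) : Prop where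
  differentiableAt : ∀ w : ℂ, |w.im| ≤ ν → DifferentiableAt ℂ f w
  bound : ∃ C ε : ℝ, 0 < ε ∧ ∀ w : ℂ, |w.im| ≤ ν → ‖f w‖ ≤ C * Real.exp (-ε * |w.re|)

theorem IsStripTest.mono {ν ν' : ℝ} {f : ℂ → ℂ} (hf : IsStripTest ν' f) (h : ν ≤ ν') :
    IsStripTest ν f := by
  obtain ⟨C, ε, hε, hb⟩ := hf.bound
  exact ⟨fun w hw => hf.differentiableAt w (hw.trans h), C, ε, hε, fun w hw => hb w (hw.trans h)⟩

/-- The elementary functional calculus of `a`, in the coordinate `z = e^w`. -/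
def logCalc (ν : ℝ) (a : ℂ → 𝒜) (f : ℂ → ℂ) : 𝒜 :=
  contourMean ν fun w => f w • a w

variable {ν₀ ν₁ ν ν' M : ℝ} {a : ℂ → 𝒜} {f g : ℂ → ℂ}

theorem IsLogResolvent.nonneg (ha : IsLogResolvent ν₀ ν₁ M a) (h0 : 0 ≤ ν₀) (h : ν₀ ≤ ν₁) :
    0 ≤ M :=
  (norm_nonneg _).trans (ha.norm_le (ν₀ * Complex.I) (by simp [abs_of_nonneg h0])
    (by simpa [abs_of_nonneg h0] using h))

theorem lineIntegrable_test_smul (ha : IsLogResolvent ν₀ ν₁ M a) (h0 : 0 ≤ ν₀) (h1 : ν₀ ≤ ν)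
    (h2 : ν ≤ ν₁) (hf : IsStripTest ν f) : LineIntegrable ν fun w => f w • a w := by
  obtain ⟨C, ε, hε, hb⟩ := hf.bound
  have hM := ha.nonneg h0 (h1.trans h2)
  refine lineIntegrable_of_bound (C := C * M) (ε := ε) (h0.trans h1) (fun w hw => ?_) hε
    fun w hw => ?_
  · exact (hf.differentiableAt w hw.le).continuousAt.smul
      (ha.differentiableAt w (hw ▸ h1) (hw ▸ h2)).continuousAt
  · rw [norm_smul, mul_right_comm]
    exact mul_le_mul (hb w hw.le) (ha.norm_le w (hw ▸ h1) (hw ▸ h2)) (norm_nonneg _)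
      ((norm_nonneg _).trans (hb w hw.le))

/-- Moving the contour of `contourMean` through a region of holomorphy. -/
theorem contourMean_eq_contourMean {E : Type*} [NormedAddCommGroup E] [NormedSpace ℂ E]
    [CompleteSpace E] (h0 : 0 ≤ ν) (h1 : ν < ν') {f : ℂ → E} {C ε : ℝ}
    (hd : ∀ w : ℂ, ν ≤ |w.im| → |w.im| ≤ ν' → DifferentiableAt ℂ f w) (hε : 0 < ε)
    (hb : ∀ w : ℂ, ν ≤ |w.im| → |w.im| ≤ ν' → ‖f w‖ ≤ C * Real.exp (-ε * |w.re|)) :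
    contourMean ν f = contourMean ν' f := by
  have key : ∀ α β : ℝ, α < β → (∀ w : ℂ, α ≤ w.im → w.im ≤ β → ν ≤ |w.im| ∧ |w.im| ≤ ν') →
      lineIntegral α f = lineIntegral β f := fun α β hαβ h =>
    lineIntegral_eq_lineIntegral hαβ
      (fun w hw1 hw2 => hd w (h w hw1 hw2).1 (h w hw1 hw2).2)
      ⟨C, ε, 0, hε, fun w hw1 hw2 _ => hb w (h w hw1 hw2).1 (h w hw1 hw2).2⟩
  unfold contourMean
  rw [key ν ν' h1 fun w hw1 hw2 => by rw [abs_of_nonneg (by linarith)]; exact ⟨hw1, hw2⟩,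
    ← key (-ν') (-ν) (by linarith) fun w hw1 hw2 => by
      rw [abs_of_nonpos (by linarith)]; constructor <;> linarith]

/-- The functional calculus does not depend on the contour. -/
theorem logCalc_eq_logCalc [CompleteSpace 𝒜] (ha : IsLogResolvent ν₀ ν₁ M a) (h0 : 0 ≤ ν₀)
    (h1 : ν₀ ≤ ν) (h2 : ν < ν') (h3 : ν' ≤ ν₁) (hf : IsStripTest ν' f) :
    logCalc ν a f = logCalc ν' a f := by
  obtain ⟨C, ε, hε, hb⟩ := hf.bound
  have hM := ha.nonneg h0 (h1.trans (h2.le.trans h3))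
  refine contourMean_eq_contourMean (C := C * M) (h0.trans h1) h2 (fun w h4 h5 => ?_) hε
    fun w h4 h5 => ?_
  · exact (hf.differentiableAt w h5).smul (ha.differentiableAt w (h1.trans h4) (h5.trans h3))
  · rw [norm_smul, mul_right_comm]
    exact mul_le_mul (hb w h5) (ha.norm_le w (h1.trans h4) (h5.trans h3)) (norm_nonneg _)
      ((norm_nonneg _).trans (hb w h5))

/-- The growth of `f w e^w` for a test function `f`. -/
theorem IsStripTest.kernelGrowth {E : Type*} [NormedAddCommGroup E] [NormedSpace ℂ E]
    (hf : IsStripTest ν f) (c : ℂ) (v : E) :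
    KernelGrowth (-ν) ν fun w => (f w * Complex.exp w * c) • v := by
  obtain ⟨C, ε, hε, hb⟩ := hf.bound
  refine ⟨C * (‖c‖ * ‖v‖), ε, hε, fun w h1 h2 => ?_⟩
  have h3 := hb w (abs_le.2 ⟨h1, h2⟩)
  rw [norm_smul, norm_mul, norm_mul, Complex.norm_exp]
  calc ‖f w‖ * Real.exp w.re * ‖c‖ * ‖v‖
      ≤ C * Real.exp (-ε * |w.re|) * (1 + Real.exp w.re) * ‖c‖ * ‖v‖ := by
        gcongr
        · exact (norm_nonneg _).trans h3
        · linarith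
    _ = _ := by ring

/-- Cauchy's formula for test functions. -/
theorem IsStripTest.cauchy (hf : IsStripTest ν f) (hν : ν < Real.pi) {w₀ : ℂ}
    (hw₀ : |w₀.im| < ν) :
    contourMean ν (fun w => f w * (Complex.exp w / (Complex.exp w - Complex.exp w₀))) = f w₀ := by
  obtain ⟨h1, h2⟩ := abs_lt.1 hw₀
  have h := lineIntegral_sub_lineIntegral_kernel (a := -ν) (b := ν) (w₀ := w₀)
    (G := fun w => (f w * Complex.exp w * 1) • (1 : ℂ)) h1 h2 (by linarith) (by linarith)
    (fun w hw1 hw2 => by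
      have := hf.differentiableAt w (abs_le.2 ⟨hw1, hw2⟩)
      fun_prop) (hf.kernelGrowth 1 1)
  have hpi : (2 * Real.pi * Complex.I : ℂ) ≠ 0 := by
    simp [Real.pi_ne_zero]
  have hf' : (fun w => f w * (Complex.exp w / (Complex.exp w - Complex.exp w₀))) =
      fun w => (Complex.exp w - Complex.exp w₀)⁻¹ • (f w * Complex.exp w * 1) • (1 : ℂ) := by
    funext w
    simp only [smul_eq_mul, div_eq_mul_inv]
    ring
  rw [contourMean, hf', h, inv_smul_smul₀ hpi]
  have : Complex.exp (-w₀) * Complex.exp w₀ = 1 := by rw [← Complex.exp_add]; simp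
  simp only [smul_eq_mul]
  linear_combination f w₀ * this

/-- Cauchy's theorem for test functions and a pole outside of the strip. -/
theorem IsStripTest.contourMean_eq_zero {E : Type*} [NormedAddCommGroup E] [NormedSpace ℂ E]
    [CompleteSpace E] (hf : IsStripTest ν f) (hν0 : 0 < ν) {w₀ : ℂ}
    (hw₀ : ν < |w₀.im|) (hw₀' : |w₀.im| < Real.pi) (c : ℂ) (v : E) :
    contourMean ν (fun w => (Complex.exp w - Complex.exp w₀)⁻¹ •
      (f w * Complex.exp w * c) • v) = 0 := by
  refine OperatorSum.contourMean_eq_zero (lineIntegral_eq_lineIntegral_kernel (by linarith)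
    (fun w h1 h2 => ?_) (fun w hw1 hw2 => ?_) (hf.kernelGrowth c v))
  · have h3 := abs_le.2 ⟨h1, h2⟩
    have h4 := abs_sub_abs_le_abs_sub w₀.im w.im
    have h5 := abs_sub w.im w₀.im
    rw [abs_sub_comm] at h4
    constructor <;> linarith
  · have := hf.differentiableAt w (abs_le.2 ⟨hw1, hw2⟩)
    fun_prop

/-- The Cauchy kernels for two separated pairs of lines are bounded. -/
theorem norm_exp_div_exp_sub_exp_le {w w' : ℂ} (hν : ν < ν') (hw : |w.im| ≤ ν)
    (hw' : ν' ≤ |w'.im|) (hπ : |w'.im| < Real.pi) :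
    Complex.exp w - Complex.exp w' ≠ 0 ∧
    ‖Complex.exp w' / (Complex.exp w' - Complex.exp w)‖ ≤ 1 / Real.sin ((ν' - ν) / 2) ∧
    ‖Complex.exp w / (Complex.exp w - Complex.exp w')‖ ≤ 1 / Real.sin ((ν' - ν) / 2) := by
  have h1 := abs_sub_abs_le_abs_sub w'.im w.im
  have h2 := abs_sub w.im w'.im
  rw [abs_sub_comm] at h1
  have hsin : 0 < Real.sin ((ν' - ν) / 2) :=
    Real.sin_pos_of_pos_of_lt_pi (by linarith) (by linarith [abs_nonneg w.im])
  have h3 := norm_exp_sub_exp_ge (η := ν' - ν) (by linarith) (w := w) (w' := w')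
    (by linarith) (by linarith)
  have h4 : 0 < ‖Complex.exp w - Complex.exp w'‖ := lt_of_lt_of_le (by positivity) h3
  refine ⟨norm_pos_iff.1 h4, ?_, ?_⟩
  · rw [norm_div, Complex.norm_exp, norm_sub_rev, div_le_div_iff₀ h4 hsin]
    nlinarith [Real.exp_pos w.re]
  · rw [norm_div, Complex.norm_exp, div_le_div_iff₀ h4 hsin]
    nlinarith [Real.exp_pos w'.re]

/-- Multiplying `f(A)` by a resolvent outside of the contour. -/
theorem logCalc_mul_resolvent [CompleteSpace 𝒜] (ha : IsLogResolvent ν₀ ν₁ M a) (h0 : 0 < ν₀)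
    (h1 : ν₀ ≤ ν) (hπ : ν₁ < Real.pi) (hf : IsStripTest ν f) {w' : ℂ} (hw' : ν < |w'.im|)
    (hw'' : |w'.im| ≤ ν₁) :
    logCalc ν a f * a w' =
      logCalc ν a fun w => f w * (Complex.exp w' / (Complex.exp w' - Complex.exp w)) := by
  have hνν : ν ≤ ν₁ := hw'.le.trans hw''
  have hM := ha.nonneg h0.le (h1.trans hνν)
  have hint := lineIntegrable_test_smul ha h0.le h1 hνν hf
  obtain ⟨C, ε, hε, hb⟩ := hf.bound
  have hker := fun (w : ℂ) (hw : |w.im| = ν) =>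
    norm_exp_div_exp_sub_exp_le hw' hw.le le_rfl (hw''.trans_lt hπ)
  have hzero := hf.contourMean_eq_zero (h0.trans_le h1) hw' (hw''.trans_lt hπ) 1 (a w')
  have hstep : logCalc ν a f * a w' = contourMean ν fun w =>
      (f w * (Complex.exp w' / (Complex.exp w' - Complex.exp w))) • a w +
        (Complex.exp w - Complex.exp w')⁻¹ • (f w * Complex.exp w * 1) • a w' := by
    unfold logCalc
    have h6 := contourMean_map hint ((ContinuousLinearMap.mul ℂ 𝒜).flip (a w'))
    simp only [ContinuousLinearMap.flip_apply, ContinuousLinearMap.mul_apply'] at h6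
    rw [← h6]
    refine contourMean_congr (h0.le.trans h1) fun w hw => ?_
    have h7 := ha.resolvent_identity w w' (hw ▸ h1) (hw ▸ hνν) (h1.trans hw'.le) hw''
    have h8 := (hker w hw).1
    have h9 : Complex.exp w' - Complex.exp w ≠ 0 := by rw [← neg_sub]; exact neg_ne_zero.2 h8
    have h10 : a w * a w' = (Complex.exp w' - Complex.exp w)⁻¹ •
        (Complex.exp w' • a w - Complex.exp w • a w') := by
      rw [← h7, inv_smul_smul₀ h9]
    rw [smul_mul_assoc, h10, smul_sub, smul_sub]
    simp only [smul_smul]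
    rw [sub_eq_add_neg, ← neg_smul]
    congr 2
    · field_simp
    · field_simp
      ring
  rw [hstep, contourMean_add, hzero, add_zero, logCalc]
  · refine lineIntegrable_of_bound (C := C * (1 / Real.sin ((|w'.im| - ν) / 2)) * M) (ε := ε)
      (h0.le.trans h1) (fun w hw => ?_) hε fun w hw => ?_
    · have h9 : Complex.exp w' - Complex.exp w ≠ 0 := by
        rw [← neg_sub]; exact neg_ne_zero.2 (hker w hw).1
      have h10 := (hf.differentiableAt w hw.le).continuousAt
      have h11 := (ha.differentiableAt w (hw ▸ h1) (hw ▸ hνν)).continuousAt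
      exact (h10.mul (continuousAt_const.div (by fun_prop) h9)).smul h11
    · have h14 := hb w hw.le
      have h15 := ha.norm_le w (hw ▸ h1) (hw ▸ hνν)
      rw [norm_smul, norm_mul]
      calc ‖f w‖ * ‖Complex.exp w' / (Complex.exp w' - Complex.exp w)‖ * ‖a w‖
          ≤ (C * Real.exp (-ε * |w.re|)) * (1 / Real.sin ((|w'.im| - ν) / 2)) * M := by
            have := (norm_nonneg _).trans h14
            have := (norm_nonneg _).trans (hker w hw).2.1
            gcongr
            exact (hker w hw).2.1
        _ = _ := by ring
  · refine lineIntegrable_of_bound (C := C * (1 / Real.sin ((|w'.im| - ν) / 2)) * M) (ε := ε)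
      (h0.le.trans h1) (fun w hw => ?_) hε fun w hw => ?_
    · have h10 := (hf.differentiableAt w hw.le).continuousAt
      have h11 := (hker w hw).1
      fun_prop (disch := assumption)
    · have h14 := hb w hw.le
      have h15 := ha.norm_le w' (h1.trans hw'.le) hw''
      have h16 : (Complex.exp w - Complex.exp w')⁻¹ • (f w * Complex.exp w * 1) • a w' =
          (f w * (Complex.exp w / (Complex.exp w - Complex.exp w'))) • a w' := by
        rw [smul_smul]
        congr 1
        rw [div_eq_mul_inv]
        ring
      rw [h16, norm_smul, norm_mul]
      calc ‖f w‖ * ‖Complex.exp w / (Complex.exp w - Complex.exp w')‖ * ‖a w'‖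
          ≤ (C * Real.exp (-ε * |w.re|)) * (1 / Real.sin ((|w'.im| - ν) / 2)) * M := by
            have := (norm_nonneg _).trans h14
            have := (norm_nonneg _).trans (hker w hw).2.1
            gcongr
            exact (hker w hw).2.2
        _ = _ := by ring

/-- The functional calculus is multiplicative. -/
theorem logCalc_mul_logCalc [CompleteSpace 𝒜] (ha : IsLogResolvent ν₀ ν₁ M a) (h0 : 0 < ν₀)
    (h1 : ν₀ ≤ ν) (h2 : ν < ν') (h3 : ν' ≤ ν₁) (hπ : ν₁ < Real.pi) (hf : IsStripTest ν' f)
    (hg : IsStripTest ν' g) :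
    logCalc ν a f * logCalc ν a g = logCalc ν a fun w => f w * g w := by
  have hM := ha.nonneg h0.le (h1.trans (h2.le.trans h3))
  have hν : 0 ≤ ν := h0.le.trans h1
  have hν' : 0 ≤ ν' := hν.trans h2.le
  have hν1 : ν₀ ≤ ν' := h1.trans h2.le
  have hintg := lineIntegrable_test_smul ha h0.le hν1 h3 hg
  obtain ⟨C, ε, hε, hb⟩ := hf.bound
  obtain ⟨D, δ, hδ, hd⟩ := hg.bound
  have hC : 0 ≤ C := by simpa using (norm_nonneg _).trans (hb 0 (by simpa using hν'))
  have hD : 0 ≤ D := by simpa using (norm_nonneg _).trans (hd 0 (by simpa using hν'))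
  have hker := fun (w w' : ℂ) (hw : |w.im| = ν) (hw' : |w'.im| = ν') =>
    norm_exp_div_exp_sub_exp_le h2 hw.le hw'.ge (hw'.trans_lt (h3.trans_lt hπ))
  set κ := 1 / Real.sin ((ν' - ν) / 2) with hκ
  have hker' : ∀ w w' : ℂ, |w.im| = ν → |w'.im| = ν' → Complex.exp w' - Complex.exp w ≠ 0 := by
    intro w w' hw hw'
    rw [← neg_sub]
    exact neg_ne_zero.2 (hker w w' hw hw').1
  have hκ0 : 0 ≤ κ := (norm_nonneg _).trans
    (hker (ν * Complex.I) (ν' * Complex.I) (by simp [abs_of_nonneg hν])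
      (by simp [abs_of_nonneg hν'])).2.1
  rw [logCalc_eq_logCalc ha h0.le h1 h2 h3 hg]
  have e1 : logCalc ν a f * logCalc ν' a g = contourMean ν' fun w' => contourMean ν fun w =>
      (g w' * (Complex.exp w' / (Complex.exp w' - Complex.exp w)) * f w) • a w := by
    have h6 := contourMean_map hintg (ContinuousLinearMap.mul ℂ 𝒜 (logCalc ν a f))
    simp only [ContinuousLinearMap.mul_apply'] at h6
    rw [show logCalc ν' a g = contourMean ν' fun w => g w • a w from rfl, ← h6]
    refine contourMean_congr hν' fun w' hw' => ?_
    rw [mul_smul_comm, logCalc_mul_resolvent ha h0 h1 hπ (hf.mono h2.le) (hw' ▸ h2)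
      (hw' ▸ h3), logCalc, ← contourMean_const_smul]
    refine contourMean_congr hν fun w hw => ?_
    rw [smul_smul]
    congr 1
    ring
  rw [e1, contourMean_contourMean_swap (C := D * κ * C * M) (ε := min ε δ) hν' hν
    (lt_min hε hδ)]
  · refine contourMean_congr hν fun w hw => ?_
    have hintk : LineIntegrable ν' fun w' =>
        g w' * (Complex.exp w' / (Complex.exp w' - Complex.exp w)) := by
      refine lineIntegrable_of_bound (C := D * κ) (ε := δ) hν' (fun w' hw' => ?_) hδ
        fun w' hw' => ?_
      · have h10 := (hg.differentiableAt w' hw'.le).continuousAt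
        have h11 := hker' w w' hw hw'
        fun_prop (disch := assumption)
      · rw [norm_mul, mul_right_comm]
        exact mul_le_mul (hd w' hw'.le) (hker w w' hw hw').2.1 (norm_nonneg _) (by positivity)
    have h6 := contourMean_map hintk (ContinuousLinearMap.toSpanSingleton ℂ (f w • a w))
    simp only [ContinuousLinearMap.toSpanSingleton_apply] at h6
    rw [hg.cauchy (h3.trans_lt hπ) (hw ▸ h2)] at h6
    simp only [smul_smul] at h6
    rw [h6, mul_comm]
  · intro w' w hw' hw
    have h10 : ContinuousAt (fun p : ℂ × ℂ => g p.1) (w', w) := ContinuousAt.comp (f := Prod.fst)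
      (hg.differentiableAt w' hw'.le).continuousAt continuousAt_fst
    have h11 : ContinuousAt (fun p : ℂ × ℂ => f p.2) (w', w) := ContinuousAt.comp (f := Prod.snd)
      (hf.differentiableAt w (hw ▸ h2.le)).continuousAt continuousAt_snd
    have h12 : ContinuousAt (fun p : ℂ × ℂ => a p.2) (w', w) := ContinuousAt.comp (f := Prod.snd)
      (ha.differentiableAt w (hw ▸ h1) (hw ▸ h2.le.trans h3)).continuousAt continuousAt_snd
    have h13 : ContinuousAt (fun p : ℂ × ℂ => Complex.exp p.1 /
        (Complex.exp p.1 - Complex.exp p.2)) (w', w) :=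
      ContinuousAt.div (by fun_prop) (by fun_prop) (hker' w w' hw hw')
    exact ((h10.mul h13).mul h11).smul h12
  · intro w' w hw' hw
    have h14 : ‖g w'‖ ≤ D * Real.exp (-(min ε δ) * |w'.re|) := by
      refine (hd w' hw'.le).trans ?_
      gcongr
      exact min_le_right _ _
    have h15 : ‖f w‖ ≤ C * Real.exp (-(min ε δ) * |w.re|) := by
      refine (hb w (hw ▸ h2.le)).trans ?_
      gcongr
      exact min_le_left _ _
    rw [norm_smul, norm_mul, norm_mul]
    calc _ ≤ (D * Real.exp (-(min ε δ) * |w'.re|)) * κ * (C * Real.exp (-(min ε δ) * |w.re|)) *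
          M := by
          have h16 := (hker w w' hw hw').2.1
          have h17 := ha.norm_le w (hw ▸ h1) (hw ▸ h2.le.trans h3)
          gcongr
      _ = _ := by ring

end FunctionalCalculus

/-! ### The kernel `(z z')^{1/2} / (z - z')` -/

section Algebra

variable {𝒜 : Type*} [NormedRing 𝒜] [NormedAlgebra ℂ 𝒜]

/-- `e^{(w + w')/2} / (e^w - e^{w'})`, which is `(z z')^{1/2} / (z - z')` in the coordinates
`z = e^w`, `z' = e^{w'}`. -/
def sqrtKernel (w' w : ℂ) : ℂ :=
  Complex.exp ((w + w') / 2) * (Complex.exp w - Complex.exp w')⁻¹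

theorem norm_sqrtKernel_le {η : ℝ} {w w' : ℂ} (hη : 0 < η) (h1 : η ≤ |w.im - w'.im|)
    (h2 : |w.im - w'.im| ≤ 2 * Real.pi - η) :
    ‖sqrtKernel w' w‖ ≤ (Real.sin (η / 2))⁻¹ * Real.exp (-(1 / 2) * |w.re - w'.re|) := by
  have h3 := norm_exp_sub_exp_ge hη.le h1 h2
  have hsin : 0 < Real.sin (η / 2) :=
    Real.sin_pos_of_pos_of_lt_pi (by linarith) (by linarith [Real.pi_pos])
  have h4 : 0 < Real.sin (η / 2) * (Real.exp w.re + Real.exp w'.re) := by positivity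
  have h5 : Real.exp ((w.re + w'.re) / 2) ≤
      Real.exp (-(1 / 2) * |w.re - w'.re|) * (Real.exp w.re + Real.exp w'.re) := by
    rw [mul_add, ← Real.exp_add, ← Real.exp_add]
    rcases abs_cases (w.re - w'.re) with h | h
    · rw [h.1]
      have : (w.re + w'.re) / 2 = -(1 / 2) * (w.re - w'.re) + w.re := by ring
      rw [← this]
      linarith [Real.exp_pos (-(1 / 2) * (w.re - w'.re) + w'.re)]
    · rw [h.1]
      have : (w.re + w'.re) / 2 = -(1 / 2) * -(w.re - w'.re) + w'.re := by ring
      rw [← this]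
      linarith [Real.exp_pos (-(1 / 2) * -(w.re - w'.re) + w.re)]
  have h6 : ((w + w') / 2).re = (w.re + w'.re) / 2 := by simp
  rw [sqrtKernel, norm_mul, norm_inv, Complex.norm_exp, h6]
  calc _ ≤ (Real.exp (-(1 / 2) * |w.re - w'.re|) * (Real.exp w.re + Real.exp w'.re)) *
        (Real.sin (η / 2) * (Real.exp w.re + Real.exp w'.re))⁻¹ := by gcongr
    _ = _ := by
      have : 0 < Real.exp w.re + Real.exp w'.re := by positivity
      field_simp

theorem exp_neg_half_abs_sub_le (s u : ℝ) :
    Real.exp (-(1 / 2) * |s - u|) ≤ Real.exp ((1 / 2) * |s|) * Real.exp (-(1 / 2) * |u|) := by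
  rw [← Real.exp_add]
  gcongr
  have := abs_sub_abs_le_abs_sub u s
  rw [abs_sub_comm] at this
  linarith

/-- One-sided decay and boundedness in the form used for Cauchy kernels. -/
theorem le_exp_neg_abs_mul {K M s v : ℝ} (hM : 0 ≤ M) (h1 : v ≤ M) (h2 : v ≤ K * Real.exp s) :
    v ≤ max K M * (Real.exp (-1 * |s|) * (1 + Real.exp s)) := by
  have hmax : 0 ≤ max K M := hM.trans (le_max_right _ _)
  rcases abs_cases s with h | h
  · have h3 : Real.exp (-1 * |s|) * (1 + Real.exp s) = 1 + Real.exp (-s) := by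
      rw [h.1, mul_add, ← Real.exp_add, add_comm]
      simp
    rw [h3]
    nlinarith [le_max_right K M, mul_nonneg hmax (Real.exp_pos (-s)).le]
  · rw [h.1, neg_one_mul, neg_neg]
    nlinarith [mul_le_mul_of_nonneg_right (le_max_left K M) (Real.exp_pos s).le,
      mul_nonneg hmax (mul_pos (Real.exp_pos s) (Real.exp_pos s)).le]

theorem le_exp_neg_abs {K M s v : ℝ} (h1 : v ≤ K * Real.exp s) (h2 : v ≤ M * Real.exp (-s)) :
    v ≤ max K M * Real.exp (-1 * |s|) := by
  rcases abs_cases s with h | h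
  · rw [h.1, neg_one_mul]
    exact h2.trans (mul_le_mul_of_nonneg_right (le_max_right _ _) (Real.exp_pos _).le)
  · rw [h.1, neg_one_mul, neg_neg]
    exact h1.trans (mul_le_mul_of_nonneg_right (le_max_left _ _) (Real.exp_pos _).le)

theorem sin_mul_le_norm_exp_sub_exp {ν ρ : ℝ} (hνρ : ν < ρ) (hρ : ρ < Real.pi) {w : ℂ}
    (hw : |w.im| ≤ ν) : Real.sin ((ρ - ν) / 2) *
      (Real.exp w.re + Real.exp ((ρ : ℂ) * Complex.I).re) ≤
      ‖Complex.exp w - Complex.exp (ρ * Complex.I)‖ := by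
  have him : ((ρ : ℂ) * Complex.I).im = ρ := by simp
  obtain ⟨h1, h2⟩ := abs_le.1 hw
  refine norm_exp_sub_exp_ge (by linarith) ?_ ?_ <;> rw [him, abs_sub_comm, abs_of_nonneg] <;>
    linarith

theorem exp_sub_exp_ne_zero {ν ρ : ℝ} (hνρ : ν < ρ) (hρ : ρ < Real.pi) {w : ℂ}
    (hw : |w.im| ≤ ν) : Complex.exp w - Complex.exp (ρ * Complex.I) ≠ 0 := by
  have h1 := sin_mul_le_norm_exp_sub_exp hνρ hρ hw
  have h2 : 0 < Real.sin ((ρ - ν) / 2) :=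
    Real.sin_pos_of_pos_of_lt_pi (by linarith) (by linarith [(abs_nonneg w.im).trans hw])
  exact norm_pos_iff.1 (lt_of_lt_of_le (by positivity) h1)

/-- Integrability of `G w / (e^w - e^{iρ})` for `G` bounded and `O(e^w)` at `-∞`. -/
theorem lineIntegrable_kernel {E : Type*} [NormedAddCommGroup E] [NormedSpace ℂ E] {ν ρ K M : ℝ}
    (hν : 0 ≤ ν) (hνρ : ν < ρ) (hρ : ρ < Real.pi) (hM : 0 ≤ M) {G : ℂ → E}
    (hc : ∀ w : ℂ, |w.im| = ν → ContinuousAt G w) (h1 : ∀ w : ℂ, |w.im| = ν → ‖G w‖ ≤ M)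
    (h2 : ∀ w : ℂ, |w.im| = ν → ‖G w‖ ≤ K * Real.exp w.re) :
    LineIntegrable ν fun w => (Complex.exp w - Complex.exp (ρ * Complex.I))⁻¹ • G w := by
  have hb := fun (w : ℂ) (hw : |w.im| = ν) => norm_inv_smul_le_of_kernel
    (Real.sin_pos_of_pos_of_lt_pi (x := (ρ - ν) / 2) (by linarith) (by linarith))
    (le_exp_neg_abs_mul hM (h1 w hw) (h2 w hw)) (sin_mul_le_norm_exp_sub_exp hνρ hρ hw.le)
  exact lineIntegrable_of_bound hν (fun w hw => ContinuousAt.smul (ContinuousAt.inv₀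
    (by fun_prop) (exp_sub_exp_ne_zero hνρ hρ hw.le)) (hc w hw)) one_pos hb

/-- Cauchy's theorem inside of the contour for `G w / (e^w - e^{iρ})`. -/
theorem contourMean_kernel_eq_zero {E : Type*} [NormedAddCommGroup E] [NormedSpace ℂ E]
    [CompleteSpace E] {ν ρ K M : ℝ} (hν : 0 < ν) (hνρ : ν < ρ) (hρ : ρ < Real.pi) (hM : 0 ≤ M)
    {G : ℂ → E} (hd : ∀ w : ℂ, |w.im| ≤ ν → DifferentiableAt ℂ G w)
    (h1 : ∀ w : ℂ, |w.im| ≤ ν → ‖G w‖ ≤ M)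
    (h2 : ∀ w : ℂ, |w.im| ≤ ν → ‖G w‖ ≤ K * Real.exp w.re) :
    contourMean ν (fun w => (Complex.exp w - Complex.exp (ρ * Complex.I))⁻¹ • G w) = 0 := by
  refine contourMean_eq_zero (lineIntegral_eq_lineIntegral_kernel (by linarith)
    (fun w h3 h4 => ?_) (fun w h3 h4 => hd w (abs_le.2 ⟨h3, h4⟩)) ⟨_, 1, one_pos, fun w h3 h4 =>
      le_exp_neg_abs_mul hM (h1 w (abs_le.2 ⟨h3, h4⟩)) (h2 w (abs_le.2 ⟨h3, h4⟩))⟩)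
  have him : ((ρ : ℂ) * Complex.I).im = ρ := by simp
  rw [him, abs_sub_comm, abs_of_nonneg (by linarith)]
  constructor <;> linarith

variable {ν ρ M : ℝ} {a b : ℂ → 𝒜} {P Q : 𝒜}

theorem isStripTest_sqrtKernel {ν' : ℝ} {w' : ℂ} (h1 : ν' < |w'.im|) (h2 : |w'.im| < Real.pi) :
    IsStripTest ν' (sqrtKernel w') := by
  have key : ∀ w : ℂ, |w.im| ≤ ν' → |w'.im| - ν' ≤ |w.im - w'.im| ∧
      |w.im - w'.im| ≤ 2 * Real.pi - (|w'.im| - ν') := by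
    intro w hw
    have h4 := abs_sub_abs_le_abs_sub w'.im w.im
    have h5 := abs_sub w.im w'.im
    rw [abs_sub_comm] at h4
    constructor <;> linarith
  refine ⟨fun w hw => ?_, (Real.sin ((|w'.im| - ν') / 2))⁻¹ * Real.exp ((1 / 2) * |w'.re|), 1 / 2,
    by norm_num, fun w hw => ?_⟩
  · have h3 : Complex.exp w - Complex.exp w' ≠ 0 :=
      sub_ne_zero.2 (exp_ne_exp_of_im (by linarith [(key w hw).1]) (by linarith [(key w hw).2]))
    unfold sqrtKernel
    fun_prop (disch := assumption)
  · refine (norm_sqrtKernel_le (by linarith) (key w hw).1 (key w hw).2).trans ?_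
    have hsin : 0 ≤ Real.sin ((|w'.im| - ν') / 2) :=
      Real.sin_nonneg_of_nonneg_of_le_pi (by linarith) (by linarith [abs_nonneg w.im])
    rw [mul_assoc]
    refine mul_le_mul_of_nonneg_left ?_ (inv_nonneg.2 hsin)
    rw [abs_sub_comm]
    exact exp_neg_half_abs_sub_le _ _

/-- The two integrals of `(z z')^{1/2} / (z - z')` against `(z' + B)⁻¹` and `R(z, A)`: Fubini's
theorem and Cauchy's formula in `z'` reduce the double integral to a single one. -/
theorem contourMean_mul_logCalc_sqrtKernel [CompleteSpace 𝒜] (hν : 0 < ν) (hνρ : ν < ρ)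
    (hρ : ρ < Real.pi) (ha : IsLogResolvent ν ρ M a) {N K : ℝ}
    (hbd : ∀ w : ℂ, |w.im| ≤ ρ → DifferentiableAt ℂ b w) (hbn : ∀ w : ℂ, |w.im| ≤ ρ → ‖b w‖ ≤ N)
    (hQ : ∀ w : ℂ, |w.im| = ν → ‖a w * Q‖ ≤ K * Real.exp w.re)
    (hP : P = Complex.exp (-(ρ * Complex.I)) • a (ρ * Complex.I)) :
    LineIntegrable ρ (fun w' => b w' * (logCalc ν a (sqrtKernel w') * (P * Q))) ∧
    contourMean ρ (fun w' => b w' * (logCalc ν a (sqrtKernel w') * (P * Q))) =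
      contourMean ν fun w => (Complex.exp w - Complex.exp (ρ * Complex.I))⁻¹ •
        (b w * (a w * Q)) := by
  have hρ0 : 0 < ρ := hν.trans hνρ
  have hN : 0 ≤ N := (norm_nonneg _).trans (hbn 0 (by simpa using hρ0.le))
  have hM := ha.nonneg hν.le hνρ.le
  have himρ : ((ρ : ℂ) * Complex.I).im = ρ := by simp
  have hreρ : ((ρ : ℂ) * Complex.I).re = 0 := by simp
  have hsin : 0 < Real.sin ((ρ - ν) / 2) :=
    Real.sin_pos_of_pos_of_lt_pi (by linarith) (by linarith)
  have hsep : ∀ w w' : ℂ, |w.im| = ν → |w'.im| = ρ → ρ - ν ≤ |w.im - w'.im| ∧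
      |w.im - w'.im| ≤ 2 * Real.pi - (ρ - ν) := by
    intro w w' hw hw'
    have h4 := abs_sub_abs_le_abs_sub w'.im w.im
    have h5 := abs_sub w.im w'.im
    rw [abs_sub_comm] at h4
    constructor <;> linarith
  have hne : ∀ w w' : ℂ, |w.im| = ν → |w'.im| = ρ → Complex.exp w - Complex.exp w' ≠ 0 :=
    fun w w' hw hw' => sub_ne_zero.2 (exp_ne_exp_of_im (by linarith [(hsep w w' hw hw').1])
      (by linarith [(hsep w w' hw hw').2]))
  have hρabs : |((ρ : ℂ) * Complex.I).im| = ρ := by rw [himρ, abs_of_pos hρ0]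
  -- `f(A) R(μ, A) Q` as an integral over the inner contour.
  set k : ℂ → ℂ → 𝒜 := fun w' w => -(sqrtKernel w' w *
    (Complex.exp w - Complex.exp (ρ * Complex.I))⁻¹) • (b w' * (a w * Q)) with hk
  have hinner : ∀ w' : ℂ, |w'.im| = ρ →
      b w' * (logCalc ν a (sqrtKernel w') * (P * Q)) = contourMean ν fun w => k w' w := by
    intro w' hw'
    have htest : IsStripTest ν (sqrtKernel w') :=
      isStripTest_sqrtKernel (hw' ▸ hνρ) (hw' ▸ hρ)
    have h1 := logCalc_mul_resolvent ha hν le_rfl hρ htest (w' := ρ * Complex.I)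
      (by rw [hρabs]; exact hνρ) hρabs.le
    have h2 : LineIntegrable ν fun w => (sqrtKernel w' w * (Complex.exp (ρ * Complex.I) /
        (Complex.exp (ρ * Complex.I) - Complex.exp w))) • a w := by
      obtain ⟨C, ε, hε, hC⟩ := htest.bound
      have hker := fun (w : ℂ) (hw : |w.im| = ν) => norm_exp_div_exp_sub_exp_le (ν' := ρ)
        (w' := ρ * Complex.I) hνρ hw.le hρabs.ge (by rw [hρabs]; exact hρ)
      refine lineIntegrable_of_bound (C := C * (1 / Real.sin ((ρ - ν) / 2)) * M) (ε := ε) hν.le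
        (fun w hw => ?_) hε fun w hw => ?_
      · have h9 : Complex.exp (ρ * Complex.I) - Complex.exp w ≠ 0 := by
          rw [← neg_sub]; exact neg_ne_zero.2 (hker w hw).1
        have h10 := (htest.differentiableAt w hw.le).continuousAt
        have h11 := (ha.differentiableAt w hw.ge (hw ▸ hνρ.le)).continuousAt
        exact (h10.mul (continuousAt_const.div (by fun_prop) h9)).smul h11
      · have h14 := hC w hw.le
        have h15 := ha.norm_le w hw.ge (hw ▸ hνρ.le)
        rw [norm_smul, norm_mul]
        calc _ ≤ (C * Real.exp (-ε * |w.re|)) * (1 / Real.sin ((ρ - ν) / 2)) * M := by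
              have := (norm_nonneg _).trans h14
              have := (norm_nonneg _).trans (hker w hw).2.1
              gcongr
              exact (hker w hw).2.1
          _ = _ := by ring
    have h3 : logCalc ν a (sqrtKernel w') * (P * Q) = Complex.exp (-(ρ * Complex.I)) •
        (logCalc ν a (sqrtKernel w') * a (ρ * Complex.I)) * Q := by
      rw [hP, ← mul_assoc, mul_smul_comm]
    have h4 := contourMean_map h2 ((ContinuousLinearMap.mul ℂ 𝒜 (b w')).comp
      ((ContinuousLinearMap.mul ℂ 𝒜).flip Q))
    simp only [ContinuousLinearMap.comp_apply, ContinuousLinearMap.flip_apply,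
      ContinuousLinearMap.mul_apply'] at h4
    rw [h3, smul_mul_assoc, mul_smul_comm, h1, logCalc, ← h4, ← contourMean_const_smul]
    refine contourMean_congr hν.le fun w hw => ?_
    have h5 := hne w (ρ * Complex.I) hw hρabs
    have h6 : Complex.exp (-(ρ * Complex.I)) * Complex.exp (ρ * Complex.I) = 1 := by
      rw [← Complex.exp_add]; simp
    rw [smul_mul_assoc, mul_smul_comm, smul_smul]
    congr 1
    rw [← neg_sub, div_neg, div_eq_mul_inv]
    linear_combination -(sqrtKernel w' w * (Complex.exp w - Complex.exp (ρ * Complex.I))⁻¹) * h6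
  have hcont : ∀ w' w : ℂ, |w'.im| = ρ → |w.im| = ν →
      ContinuousAt (Function.uncurry k) (w', w) := by
    intro w' w hw' hw
    have h10 : ContinuousAt (fun p : ℂ × ℂ => b p.1) (w', w) := ContinuousAt.comp (f := Prod.fst)
      (hbd w' hw'.le).continuousAt continuousAt_fst
    have h12 : ContinuousAt (fun p : ℂ × ℂ => a p.2) (w', w) := ContinuousAt.comp (f := Prod.snd)
      (ha.differentiableAt w hw.ge (hw ▸ hνρ.le)).continuousAt continuousAt_snd
    have h13 : ContinuousAt (fun p : ℂ × ℂ => sqrtKernel p.1 p.2) (w', w) := by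
      have := hne w w' hw hw'
      unfold sqrtKernel
      fun_prop (disch := assumption)
    have h14 : ContinuousAt (fun p : ℂ × ℂ =>
        (Complex.exp p.2 - Complex.exp (ρ * Complex.I))⁻¹) (w', w) := by
      have := hne w (ρ * Complex.I) hw hρabs
      fun_prop (disch := assumption)
    exact (h13.mul h14).neg.smul (h10.mul (h12.mul continuousAt_const))
  have hbound : ∀ w' w : ℂ, |w'.im| = ρ → |w.im| = ν → ‖k w' w‖ ≤
      ((Real.sin ((ρ - ν) / 2))⁻¹ * N * (|max K (M * ‖Q‖)| * (1 + Real.exp (-(0 : ℝ))) /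
        Real.sin ((ρ - ν) / 2))) *
      (Real.exp (-(1 / 2) * |w'.re|) * Real.exp (-(1 / 2) * |w.re|)) := by
    intro w' w hw' hw
    have h1 := norm_sqrtKernel_le (by linarith : 0 < ρ - ν) (hsep w w' hw hw').1
      (hsep w w' hw hw').2
    have h2 : ‖a w * Q‖ ≤ M * ‖Q‖ := (norm_mul_le _ _).trans
      (mul_le_mul_of_nonneg_right (ha.norm_le w hw.ge (hw ▸ hνρ.le)) (norm_nonneg _))
    have h3 := norm_inv_smul_le_of_kernel (w₀ := ρ * Complex.I) hsin
      (le_exp_neg_abs_mul (by positivity) h2 (hQ w hw))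
      (norm_exp_sub_exp_ge (by linarith) (hsep w (ρ * Complex.I) hw hρabs).1
        (hsep w (ρ * Complex.I) hw hρabs).2)
    rw [hreρ, norm_smul] at h3
    have h4 := hbn w' hw'.le
    have h5 := h1.trans (mul_le_mul_of_nonneg_left (exp_neg_half_abs_sub_le w.re w'.re)
      (inv_nonneg.2 hsin.le))
    have h6 : Real.exp ((1 / 2) * |w.re|) * Real.exp (-1 * |w.re|) =
        Real.exp (-(1 / 2) * |w.re|) := by
      rw [← Real.exp_add]; ring_nf
    rw [hk, norm_smul, norm_neg, norm_mul]
    calc _ ≤ ‖sqrtKernel w' w‖ * ‖(Complex.exp w - Complex.exp (ρ * Complex.I))⁻¹‖ *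
          (‖b w'‖ * ‖a w * Q‖) := by gcongr; exact norm_mul_le _ _
      _ = ‖sqrtKernel w' w‖ * ‖b w'‖ *
          (‖(Complex.exp w - Complex.exp (ρ * Complex.I))⁻¹‖ * ‖a w * Q‖) := by ring
      _ ≤ ((Real.sin ((ρ - ν) / 2))⁻¹ * (Real.exp ((1 / 2) * |w.re|) *
          Real.exp (-(1 / 2) * |w'.re|))) * N * (|max K (M * ‖Q‖)| *
          (1 + Real.exp (-(0 : ℝ))) / Real.sin ((ρ - ν) / 2) * Real.exp (-1 * |w.re|)) := by
          gcongr
      _ = _ := by rw [← h6]; ring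
  refine ⟨(lineIntegrable_contourMean hρ0.le hν.le (by norm_num) hcont hbound).congr hρ0.le
    fun w' hw' => (hinner w' hw').symm, ?_⟩
  rw [contourMean_congr hρ0.le hinner,
    contourMean_contourMean_swap hρ0.le hν.le (by norm_num) hcont hbound]
  refine contourMean_congr hν.le fun w hw => ?_
  -- Cauchy's formula for `w' ↦ (z z')^{1/2} / (z - z') b(w')`.
  have hres := lineIntegral_sub_lineIntegral_kernel (a := -ρ) (b := ρ) (w₀ := w)
    (G := fun w' => Complex.exp ((w + w') / 2) • b w') (by linarith [(abs_le.1 hw.le).1])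
    (by linarith [(abs_le.1 hw.le).2]) (by linarith [(abs_le.1 hw.le).2])
    (by linarith [(abs_le.1 hw.le).1])
    (fun w' h1 h2 => (by fun_prop : DifferentiableAt ℂ
      (fun w' => Complex.exp ((w + w') / 2)) w').smul (hbd w' (abs_le.2 ⟨h1, h2⟩)))
    ⟨N * Real.exp (w.re / 2), 1 / 2, by norm_num, fun w' h1 h2 => ?_⟩
  · have hpi : (2 * Real.pi * Complex.I : ℂ) ≠ 0 := by simp [Real.pi_ne_zero]
    have h1 : LineIntegrable ρ fun w' => (Complex.exp w' - Complex.exp w)⁻¹ •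
        Complex.exp ((w + w') / 2) • b w' := by
      refine lineIntegrable_of_bound (C := (Real.sin ((ρ - ν) / 2))⁻¹ *
        Real.exp ((1 / 2) * |w.re|) * N) (ε := 1 / 2) hρ0.le (fun w' hw' => ?_) (by norm_num)
        fun w' hw' => ?_
      · have h2 := (hbd w' hw'.le).continuousAt
        have h3 : Complex.exp w' - Complex.exp w ≠ 0 := by
          rw [← neg_sub]; exact neg_ne_zero.2 (hne w w' hw hw')
        fun_prop (disch := assumption)
      · have h2 := norm_sqrtKernel_le (by linarith : 0 < ρ - ν) (hsep w w' hw hw').1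
          (hsep w w' hw hw').2
        have h3 := h2.trans (mul_le_mul_of_nonneg_left (exp_neg_half_abs_sub_le w.re w'.re)
          (inv_nonneg.2 hsin.le))
        have h4 : ‖(Complex.exp w' - Complex.exp w)⁻¹‖ * ‖Complex.exp ((w + w') / 2)‖ =
            ‖sqrtKernel w' w‖ := by
          rw [sqrtKernel, norm_mul, norm_inv, norm_inv, norm_sub_rev, mul_comm]
        rw [norm_smul, norm_smul, ← mul_assoc, h4]
        calc _ ≤ ((Real.sin ((ρ - ν) / 2))⁻¹ * (Real.exp ((1 / 2) * |w.re|) *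
              Real.exp (-(1 / 2) * |w'.re|))) * N := by
              gcongr
              exact hbn w' hw'.le
          _ = _ := by ring
    have h2 : contourMean ρ (fun w' => (Complex.exp w' - Complex.exp w)⁻¹ •
        Complex.exp ((w + w') / 2) • b w') = b w := by
      rw [contourMean, hres, inv_smul_smul₀ hpi, smul_smul, ← Complex.exp_add]
      simp
    have h3 := contourMean_map h1 (((ContinuousLinearMap.mul ℂ 𝒜).flip (a w * Q)))
    simp only [ContinuousLinearMap.flip_apply, ContinuousLinearMap.mul_apply'] at h3
    rw [h2] at h3
    rw [← h3, ← contourMean_const_smul]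
    refine contourMean_congr hρ0.le fun w' hw' => ?_
    rw [hk]
    simp only [smul_mul_assoc, smul_smul]
    congr 1
    rw [sqrtKernel, ← neg_sub (Complex.exp w') (Complex.exp w), inv_neg]
    ring
  · have h3 := hbn w' (abs_le.2 ⟨h1, h2⟩)
    have h4 : ((w + w') / 2).re = w.re / 2 + w'.re / 2 := by simp; ring
    rw [norm_smul, Complex.norm_exp, h4, Real.exp_add]
    have h5 : Real.exp (w'.re / 2) ≤ Real.exp (-(1 / 2) * |w'.re|) * (1 + Real.exp w'.re) := by
      rw [mul_add, ← Real.exp_add, mul_one]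
      rcases abs_cases w'.re with h | h
      · rw [h.1, show -(1 / 2) * w'.re + w'.re = w'.re / 2 by ring]
        linarith [Real.exp_pos (-(1 / 2) * w'.re)]
      · rw [h.1, show -(1 / 2) * -w'.re = w'.re / 2 by ring]
        linarith [Real.exp_pos (w'.re / 2 + w'.re)]
    calc _ ≤ Real.exp (w.re / 2) * (Real.exp (-(1 / 2) * |w'.re|) * (1 + Real.exp w'.re)) * N := by
          gcongr
      _ = _ := by ring

theorem lineIntegrable_kernel_mul (hν : 0 < ν) (hνρ : ν < ρ) (hρ : ρ < Real.pi)
    (ha : IsLogResolvent ν ρ M a) {N K : ℝ} (hbd : ∀ w : ℂ, |w.im| ≤ ρ → DifferentiableAt ℂ b w)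
    (hbn : ∀ w : ℂ, |w.im| ≤ ρ → ‖b w‖ ≤ N)
    (hQ : ∀ w : ℂ, ν ≤ |w.im| → |w.im| ≤ ρ → ‖a w * Q‖ ≤ K * Real.exp w.re) :
    LineIntegrable ν fun w => (Complex.exp w - Complex.exp (ρ * Complex.I))⁻¹ •
      (b w * (a w * Q)) := by
  have hN : 0 ≤ N := (norm_nonneg _).trans (hbn 0 (by simpa using (hν.trans hνρ).le))
  have hM := ha.nonneg hν.le hνρ.le
  refine lineIntegrable_kernel (M := N * (M * ‖Q‖)) (K := N * K) hν.le hνρ hρ (by positivity)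
    (fun w hw => ?_) (fun w hw => ?_) fun w hw => ?_
  · exact (hbd w (hw ▸ hνρ.le)).continuousAt.mul
      ((ha.differentiableAt w hw.ge (hw ▸ hνρ.le)).continuousAt.mul continuousAt_const)
  · exact (norm_mul_le _ _).trans (mul_le_mul (hbn w (hw ▸ hνρ.le)) ((norm_mul_le _ _).trans
      (mul_le_mul_of_nonneg_right (ha.norm_le w hw.ge (hw ▸ hνρ.le)) (norm_nonneg _)))
      (norm_nonneg _) hN)
  · rw [mul_assoc]
    exact (norm_mul_le _ _).trans (mul_le_mul (hbn w (hw ▸ hνρ.le)) (hQ w hw.ge (hw ▸ hνρ.le))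
      (norm_nonneg _) hN)

/-- Here `P = R(μ, A)` with `μ = e^{iρ}`, and `J = P Q`. The resolvent identity gives
`(a - 1) J = (a Q - μ J) / (μ - z)`, where the second summand does not contribute by Cauchy's
theorem inside of the sector. -/
theorem contourMean_kernel_eq_neg [CompleteSpace 𝒜] (hν : 0 < ν) (hνρ : ν < ρ)
    (hρ : ρ < Real.pi) (ha : IsLogResolvent ν ρ M a) {N K : ℝ}
    (hbd : ∀ w : ℂ, |w.im| ≤ ρ → DifferentiableAt ℂ b w) (hbn : ∀ w : ℂ, |w.im| ≤ ρ → ‖b w‖ ≤ N)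
    (hQ : ∀ w : ℂ, ν ≤ |w.im| → |w.im| ≤ ρ → ‖a w * Q‖ ≤ K * Real.exp w.re)
    (hP : P = Complex.exp (-(ρ * Complex.I)) • a (ρ * Complex.I))
    (haJ : ∀ w : ℂ, ν ≤ |w.im| → |w.im| ≤ ρ → ‖a w * (P * Q)‖ ≤ K * Real.exp w.re)
    (haJ' : ∀ w : ℂ, ν ≤ |w.im| → |w.im| ≤ ρ → ‖(a w - 1) * (P * Q)‖ ≤ K * Real.exp (-w.re))
    (hbJ : ∀ w : ℂ, |w.im| ≤ ρ → ‖b w * (P * Q)‖ ≤ K * Real.exp w.re) :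
    contourMean ν (fun w => (Complex.exp w - Complex.exp (ρ * Complex.I))⁻¹ •
      (b w * (a w * Q))) = -contourMean ρ fun w => b w * ((a w - 1) * (P * Q)) := by
  have hρ0 : 0 < ρ := hν.trans hνρ
  have hN : 0 ≤ N := (norm_nonneg _).trans (hbn 0 (by simpa using hρ0.le))
  have hρabs : |((ρ : ℂ) * Complex.I).im| = ρ := by simp [abs_of_pos hρ0]
  have hshift : contourMean ν (fun w => b w * ((a w - 1) * (P * Q))) =
      contourMean ρ fun w => b w * ((a w - 1) * (P * Q)) := by
    refine contourMean_eq_contourMean (C := max (N * K + K) (N * K)) (ε := 1) hν.le hνρ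
      (fun w h1 h2 => ?_) one_pos fun w h1 h2 => ?_
    · have h3 := ha.differentiableAt w h1 h2
      have h4 := hbd w h2
      fun_prop
    · refine le_exp_neg_abs ?_ ?_
      · have h3 : b w * ((a w - 1) * (P * Q)) = b w * (a w * (P * Q)) - b w * (P * Q) := by
          rw [sub_mul, one_mul, mul_sub]
        rw [h3, add_mul, mul_assoc]
        refine (norm_sub_le _ _).trans (add_le_add ((norm_mul_le _ _).trans ?_) (hbJ w h2))
        exact mul_le_mul (hbn w h2) (haJ w h1 h2) (norm_nonneg _) hN
      · rw [mul_assoc]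
        exact (norm_mul_le _ _).trans
          (mul_le_mul (hbn w h2) (haJ' w h1 h2) (norm_nonneg _) hN)
  have hbJ' : ∀ w : ℂ, |w.im| ≤ ρ → ‖b w * (P * Q)‖ ≤ N * ‖P * Q‖ := fun w hw =>
    (norm_mul_le _ _).trans (mul_le_mul_of_nonneg_right (hbn w hw) (norm_nonneg _))
  have hdJ : ∀ w : ℂ, |w.im| ≤ ν → DifferentiableAt ℂ (fun w => b w * (P * Q)) w := fun w hw =>
    (hbd w (hw.trans hνρ.le)).mul_const _
  have hint1 := lineIntegrable_kernel_mul hν hνρ hρ ha hbd hbn hQ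
  have hint2 := lineIntegrable_kernel (G := fun w => b w * (P * Q)) hν.le hνρ hρ (by positivity)
    (fun w hw => (hdJ w hw.le).continuousAt) (fun w hw => hbJ' w (hw ▸ hνρ.le))
    (fun w hw => hbJ w (hw ▸ hνρ.le))
  have hzero := contourMean_kernel_eq_zero (G := fun w => b w * (P * Q)) hν hνρ hρ
    (by positivity) hdJ (fun w hw => hbJ' w (hw.trans hνρ.le))
    (fun w hw => hbJ w (hw.trans hνρ.le))
  have hsplit : contourMean ν (fun w => b w * ((a w - 1) * (P * Q))) = contourMean ν fun w =>
      Complex.exp (ρ * Complex.I) • ((Complex.exp w - Complex.exp (ρ * Complex.I))⁻¹ •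
        (b w * (P * Q))) -
      (Complex.exp w - Complex.exp (ρ * Complex.I))⁻¹ • (b w * (a w * Q)) := by
    refine contourMean_congr hν.le fun w hw => ?_
    have h1 := ha.resolvent_identity w (ρ * Complex.I) hw.ge (hw ▸ hνρ.le)
      (by rw [hρabs]; exact hνρ.le) hρabs.le
    have h2 := exp_sub_exp_ne_zero hνρ hρ hw.le
    have h3 : (Complex.exp w - Complex.exp (ρ * Complex.I)) • ((a w - 1) * P) =
        Complex.exp (ρ * Complex.I) • P - a w := by
      have h4 : Complex.exp (-(ρ * Complex.I)) * Complex.exp (ρ * Complex.I) = 1 := by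
        rw [← Complex.exp_add]; simp
      have h5 : (Complex.exp (ρ * Complex.I) - Complex.exp w) • (a w * P) =
          a w - Complex.exp w • P := by
        rw [hP, mul_smul_comm, smul_comm, h1, smul_sub, smul_smul, h4, one_smul, smul_comm]
      rw [sub_mul, one_mul, smul_sub, ← neg_sub (Complex.exp (ρ * Complex.I)) (Complex.exp w),
        neg_smul, neg_smul, h5, sub_smul]
      abel
    have h6 : (a w - 1) * P = (Complex.exp w - Complex.exp (ρ * Complex.I))⁻¹ •
        (Complex.exp (ρ * Complex.I) • P - a w) := by
      rw [← h3, inv_smul_smul₀ h2]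
    rw [← mul_assoc (a w - 1), h6, smul_mul_assoc, mul_smul_comm, sub_mul, mul_sub,
      smul_mul_assoc, mul_smul_comm, smul_sub, smul_comm]
  rw [← hshift, hsplit, contourMean_sub (hint2.const_smul _) hint1, contourMean_const_smul, hzero,
    smul_zero, zero_sub, neg_neg]

end Algebra

/-! ### Resolvents and graphs -/

section Graph

variable {X : Type*} [NormedAddCommGroup X] [NormedSpace ℂ X]

/-- `R` is the resolvent of `A` at `z`, expressed through the graph of `A`. -/
def IsResolvent (A : X →ₗ.[ℂ] X) (z : ℂ) (R : X →L[ℂ] X) : Prop :=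
  (∀ x : X, (R x, z • R x - x) ∈ A.graph) ∧ ∀ x y : X, (x, y) ∈ A.graph → R y = z • R x - x

theorem IsBoundedInverse.unique {T : X →ₗ.[ℂ] X} {R R' : X →L[ℂ] X} (h : IsBoundedInverse T R)
    (h' : IsBoundedInverse T R') : R = R' := by
  ext x
  obtain ⟨hx, hx'⟩ := h.1 x
  have := h'.2 ⟨R x, hx⟩
  rw [hx'] at this
  exact this.symm

theorem IsBoundedInverse.boundedInverse_eq {T : X →ₗ.[ℂ] X} {R : X →L[ℂ] X}
    (h : IsBoundedInverse T R) : boundedInverse T = R := by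
  have hex : ∃ R : X →L[ℂ] X, IsBoundedInverse T R := ⟨R, h⟩
  rw [boundedInverse, dif_pos hex]
  exact hex.choose_spec.unique h

theorem IsBoundedInverse.injective {T : X →ₗ.[ℂ] X} {R : X →L[ℂ] X}
    (h : IsBoundedInverse T R) : Function.Injective R := by
  intro x y hxy
  obtain ⟨hx, hx'⟩ := h.1 x
  obtain ⟨hy, hy'⟩ := h.1 y
  rw [← hx', ← hy']
  congr 1
  exact Subtype.ext hxy

theorem isBoundedInverse_shift_iff {T : X →ₗ.[ℂ] X} {z : ℂ} {R : X →L[ℂ] X} :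
    IsBoundedInverse (shift z T) R ↔ IsResolvent T (-z) (-R) := by
  constructor
  · rintro ⟨h1, h2⟩
    refine ⟨fun x => ?_, fun x y hxy => ?_⟩
    · obtain ⟨hx, hx'⟩ := h1 x
      have hx'' : z • R x + T ⟨R x, hx⟩ = x := hx'
      have h3 : T ⟨R x, hx⟩ = x - z • R x := eq_sub_of_add_eq' hx''
      have h4 := T.graph.neg_mem (T.mem_graph ⟨R x, hx⟩)
      rw [h3] at h4
      convert h4 using 1
      simp
    · obtain ⟨x', rfl, rfl⟩ := (LinearPMap.mem_graph_iff T).1 hxy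
      have h3 : R (z • (x' : X) + T x') = x' := h2 x'
      rw [map_add, map_smul] at h3
      have h4 : z • R (x' : X) = x' - R (T x') := eq_sub_of_add_eq h3
      simp only [neg_apply, smul_neg, neg_smul, neg_neg, h4]
      abel
  · rintro ⟨h1, h2⟩
    refine ⟨fun x => ?_, fun x => ?_⟩
    · have h3 := T.graph.neg_mem (h1 x)
      have h4 : (R x, x - z • R x) ∈ T.graph := by
        convert h3 using 1
        simp
      obtain ⟨x', hx', hx''⟩ := (LinearPMap.mem_graph_iff T).1 h4
      simp only at hx' hx''
      refine ⟨show R x ∈ T.domain from hx' ▸ x'.2, ?_⟩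
      change z • R x + T ⟨R x, _⟩ = x
      have h5 : (⟨R x, hx' ▸ x'.2⟩ : T.domain) = x' := Subtype.ext hx'.symm
      rw [h5, hx'']
      simp
    · have h3 := h2 x (T x) (T.mem_graph x)
      change R (z • (x : X) + T x) = x
      simp only [neg_apply, smul_neg, neg_smul, neg_neg] at h3
      rw [map_add, map_smul, neg_eq_iff_eq_neg.1 h3]
      simp

theorem neg_mem_graph_iff {A : X →ₗ.[ℂ] X} {x y : X} : (x, y) ∈ (-A).graph ↔ (x, -y) ∈ A.graph := by
  simp only [LinearPMap.mem_graph_iff]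
  constructor
  · rintro ⟨x', h1, h2⟩
    exact ⟨x', h1, by rw [← h2]; simp⟩
  · rintro ⟨x', h1, h2⟩
    exact ⟨x', h1, by rw [LinearPMap.neg_apply, h2, neg_neg]⟩

theorem isBoundedInverse_shift_neg_iff {A : X →ₗ.[ℂ] X} {z : ℂ} {R : X →L[ℂ] X} :
    IsBoundedInverse (shift z (-A)) R ↔ IsResolvent A z R := by
  rw [isBoundedInverse_shift_iff, IsResolvent, IsResolvent]
  constructor
  · rintro ⟨h1, h2⟩
    refine ⟨fun x => ?_, fun x y hxy => ?_⟩
    · have h3 := neg_mem_graph_iff.1 (h1 x)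
      have h4 := A.graph.neg_mem h3
      convert h4 using 1
      simp
    · have h3 := h2 x (-y) (neg_mem_graph_iff.2 (by rwa [neg_neg]))
      simpa using h3
  · rintro ⟨h1, h2⟩
    refine ⟨fun x => neg_mem_graph_iff.2 ?_, fun x y hxy => ?_⟩
    · have h4 := A.graph.neg_mem (h1 x)
      convert h4 using 1
      simp
    · have h3 := h2 x (-y) (neg_mem_graph_iff.1 hxy)
      simpa using h3

theorem IsResolvent.resolvent_eq {A : X →ₗ.[ℂ] X} {z : ℂ} {R : X →L[ℂ] X}
    (h : IsResolvent A z R) : resolvent z A = R :=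
  (isBoundedInverse_shift_neg_iff.2 h).boundedInverse_eq

theorem IsResolvent.boundedInverse_shift_eq {A : X →ₗ.[ℂ] X} {z : ℂ} {R : X →L[ℂ] X}
    (h : IsResolvent A (-z) R) : boundedInverse (shift z A) = -R :=
  (isBoundedInverse_shift_iff.2 (by rwa [neg_neg])).boundedInverse_eq

theorem isResolvent_resolvent {A : X →ₗ.[ℂ] X} {z : ℂ} (h : z ∈ resolventSet A) :
    IsResolvent A z (resolvent z A) := by
  obtain ⟨R, hR⟩ := h
  have h1 := isBoundedInverse_shift_neg_iff.1 hR
  rwa [h1.resolvent_eq]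

/-- The resolvent identity. -/
theorem IsResolvent.sub_eq {A : X →ₗ.[ℂ] X} {z w : ℂ} {R S : X →L[ℂ] X}
    (hR : IsResolvent A z R) (hS : IsResolvent A w S) : R - S = (w - z) • (R * S) := by
  ext x
  have h := hR.2 _ _ (hS.1 x)
  rw [map_sub, map_smul] at h
  simp only [sub_apply, smul_apply, sub_smul]
  have h' : R x = w • R (S x) - (z • R (S x) - S x) := by rw [← h]; abel
  rw [h']
  abel

theorem IsResolvent.commute {A : X →ₗ.[ℂ] X} {z w : ℂ} {R S : X →L[ℂ] X}
    (hR : IsResolvent A z R) (hS : IsResolvent A w S) : Commute R S := by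
  by_cases h : w = z
  · subst h
    rw [hR.resolvent_eq.symm, hS.resolvent_eq.symm]
  · have h1 := hR.sub_eq hS
    have h2 := hS.sub_eq hR
    rw [← neg_sub, h1, ← neg_smul, neg_sub] at h2
    exact smul_right_injective _ (sub_ne_zero.2 (Ne.symm h)) h2

/-- Resolvents of `t A` for a scalar `t ≠ 0`. -/
theorem IsResolvent.smul {A : X →ₗ.[ℂ] X} {z t : ℂ} {R : X →L[ℂ] X} (ht : t ≠ 0)
    (h : IsResolvent A (z / t) R) : IsResolvent (t • A) z (t⁻¹ • R) := by
  have hgr : ∀ x y : X, (x, y) ∈ (t • A).graph ↔ ∃ y', (x, y') ∈ A.graph ∧ y = t • y' := by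
    intro x y
    simp only [LinearPMap.mem_graph_iff]
    constructor
    · rintro ⟨x', h1, h2⟩
      exact ⟨A x', ⟨x', h1, rfl⟩, by rw [← h2]; rfl⟩
    · rintro ⟨y', ⟨x', h1, h2⟩, h3⟩
      exact ⟨x', h1, by rw [h3, ← h2]; rfl⟩
  refine ⟨fun x => (hgr _ _).2 ⟨t⁻¹ • ((z / t) • R x - x), ?_, ?_⟩, fun x y hxy => ?_⟩
  · exact A.graph.smul_mem t⁻¹ (h.1 x)
  · rw [smul_inv_smul₀ ht, smul_apply, smul_smul, div_eq_mul_inv]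
  · obtain ⟨y', h1, rfl⟩ := (hgr _ _).1 hxy
    have h2 := h.2 x y' h1
    simp only [smul_apply, map_smul]
    rw [smul_inv_smul₀ ht, h2, smul_smul, div_eq_mul_inv]

/-- The resolvents of `A⁻¹`. -/
theorem IsResolvent.inverse {A : X →ₗ.[ℂ] X} {z : ℂ} {R : X →L[ℂ] X} (hz : z ≠ 0)
    (hA : LinearMap.ker A.toFun = ⊥) (h : IsResolvent A z⁻¹ R) :
    IsResolvent A.inverse z (z⁻¹ • (1 - z⁻¹ • R)) := by
  have hgr : ∀ x y : X, (x, y) ∈ A.inverse.graph ↔ (y, x) ∈ A.graph := by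
    intro x y
    rw [LinearPMap.inverse_graph hA]
    simp
  refine ⟨fun x => (hgr _ _).2 ?_, fun x y hxy => ?_⟩
  · have h1 := A.graph.smul_mem (-z⁻¹) (h.1 x)
    convert h1 using 1
    simp only [smul_apply, sub_apply,
      one_apply_eq_self, Prod.smul_mk]
    rw [smul_inv_smul₀ hz]
    congr 1
    · module
    · module
  · have h1 := h.2 y x ((hgr _ _).1 hxy)
    simp only [smul_apply, sub_apply,
      one_apply_eq_self]
    rw [h1, smul_inv_smul₀ hz]
    simp only [smul_sub, smul_smul]
    module

end Graph

/-! ### Sectorial operators in the coordinate `z = e^w` -/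

section Sectorial

variable {X : Type*} [NormedAddCommGroup X] [NormedSpace ℂ X]

theorem continuousAt_abs_arg {z₀ : ℂ} (hz₀ : z₀ ≠ 0) :
    ContinuousAt (fun z : ℂ => |z.arg|) z₀ := by
  have h : (fun z : ℂ => |z.arg|) =ᶠ[nhds z₀] fun z => Real.arccos (z.re / ‖z‖) := by
    filter_upwards [isOpen_ne.mem_nhds hz₀] with z hz
    refine (Real.arccos_eq_of_eq_cos (abs_nonneg _) (Complex.abs_arg_le_pi _) ?_).symm
    rw [Real.cos_abs, Complex.cos_arg hz]
  rw [continuousAt_congr h]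
  exact Real.continuous_arccos.continuousAt.comp
    (Complex.continuous_re.continuousAt.div continuous_norm.continuousAt (norm_ne_zero_iff.2 hz₀))

/-- The strips `{θ ≤ |Im w| ≤ 2π - θ}` are mapped into the complement of the sector of angle `θ`. -/
theorem le_abs_arg_exp {θ : ℝ} (hθ : 0 < θ) {w : ℂ} (h1 : θ ≤ |w.im|)
    (h2 : |w.im| ≤ 2 * Real.pi - θ) : θ ≤ |(Complex.exp w).arg| := by
  have key : ∀ w : ℂ, -Real.pi < w.im → w.im ≤ Real.pi → (Complex.exp w).arg = w.im := by
    intro w h3 h4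
    rw [← Complex.log_im, Complex.log_exp h3 h4]
  have hper : ∀ (w : ℂ) (n : ℤ), Complex.exp (w + n * (2 * Real.pi * Complex.I)) =
      Complex.exp w := fun w n => by
    rw [Complex.exp_add, Complex.exp_int_mul_two_pi_mul_I, mul_one]
  rcases lt_or_ge Real.pi w.im with h | h
  · rw [abs_of_pos (Real.pi_pos.trans h)] at h2
    have h3 := key (w + (-1 : ℤ) * (2 * Real.pi * Complex.I)) (by simp; linarith)
      (by simp; linarith)
    rw [hper] at h3
    rw [h3]
    refine le_trans ?_ (neg_le_abs _)
    simp
    linarith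
  · rcases lt_or_ge (-Real.pi) w.im with h' | h'
    · rwa [key w h' h]
    · rw [abs_of_nonpos (by linarith [Real.pi_pos])] at h2
      rcases eq_or_lt_of_le h' with h'' | h''
      · have h3 := key (w + (1 : ℤ) * (2 * Real.pi * Complex.I)) (by simp; linarith [Real.pi_pos])
          (by simp; linarith)
        rw [hper] at h3
        rw [h3]
        refine le_trans ?_ (le_abs_self _)
        simp
        linarith
      · have h3 := key (w + (1 : ℤ) * (2 * Real.pi * Complex.I)) (by simp; linarith [Real.pi_pos])
          (by simp; linarith)
        rw [hper] at h3
        rw [h3]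
        refine le_trans ?_ (le_abs_self _)
        simp
        linarith

theorem IsSectorial.isResolvent {A : X →ₗ.[ℂ] X} {ω : ℝ} (hA : IsSectorial A ω) {z : ℂ}
    (hz : ω < |z.arg|) : IsResolvent A z (resolvent z A) :=
  isResolvent_resolvent (hA.mem_resolventSet z hz)

open Filter Topology in
theorem IsSectorial.differentiableAt_resolvent {A : X →ₗ.[ℂ] X} {ω : ℝ} (hA : IsSectorial A ω)
    {z₀ : ℂ} (hz₀ : ω < |z₀.arg|) : DifferentiableAt ℂ (fun z => resolvent z A) z₀ := by
  have hne : z₀ ≠ 0 := by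
    rintro rfl
    simp only [Complex.arg_zero, abs_zero] at hz₀
    exact hz₀.not_ge hA.nonneg
  obtain ⟨ω', h1, h2⟩ := exists_between hz₀
  obtain ⟨M, hM⟩ := hA.bound ω' h1 (h2.trans_le (Complex.abs_arg_le_pi _))
  have hM0 : 0 ≤ M := (norm_nonneg _).trans (hM z₀ h2.le)
  have hpos : 0 < ‖z₀‖ := norm_pos_iff.2 hne
  have hev : ∀ᶠ z in 𝓝 z₀, IsResolvent A z (resolvent z A) ∧ ‖resolvent z A‖ ≤ 2 * M / ‖z₀‖ := by
    filter_upwards [(continuousAt_abs_arg hne).eventually_const_le h2,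
      continuous_norm.continuousAt.eventually_const_le (half_lt_self hpos)] with z h3 h4
    refine ⟨hA.isResolvent (h1.trans_le h3), ?_⟩
    have h5 := hM z h3
    rw [norm_smul] at h5
    rw [le_div_iff₀ hpos]
    nlinarith [norm_nonneg (resolvent z A)]
  have hz₀' := hA.isResolvent hz₀
  have hcont : Tendsto (fun z => resolvent z A) (𝓝 z₀) (𝓝 (resolvent z₀ A)) := by
    rw [tendsto_iff_norm_sub_tendsto_zero]
    have hlim : Tendsto (fun z : ℂ => ‖z₀ - z‖ * (2 * M / ‖z₀‖ * ‖resolvent z₀ A‖)) (𝓝 z₀)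
        (𝓝 0) := by
      have : ContinuousAt (fun z : ℂ => ‖z₀ - z‖ * (2 * M / ‖z₀‖ * ‖resolvent z₀ A‖)) z₀ := by
        fun_prop
      simpa using this.tendsto
    refine squeeze_zero' (Eventually.of_forall fun _ => norm_nonneg _) ?_ hlim
    filter_upwards [hev] with z hz
    rw [hz.1.sub_eq hz₀', norm_smul]
    refine mul_le_mul_of_nonneg_left ((norm_mul_le _ _).trans ?_) (norm_nonneg _)
    exact mul_le_mul_of_nonneg_right hz.2 (norm_nonneg _)
  refine HasDerivAt.differentiableAt (f' := -(resolvent z₀ A * resolvent z₀ A)) ?_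
  rw [hasDerivAt_iff_tendsto_slope]
  have h6 : Tendsto (fun z => -(resolvent z A * resolvent z₀ A)) (𝓝[≠] z₀)
      (𝓝 (-(resolvent z₀ A * resolvent z₀ A))) :=
    ((hcont.mul_const _).neg).mono_left nhdsWithin_le_nhds
  refine h6.congr' ?_
  filter_upwards [nhdsWithin_le_nhds hev, self_mem_nhdsWithin] with z hz hz'
  rw [slope_def_module, hz.1.sub_eq hz₀', smul_smul, ← neg_sub z z₀, mul_neg,
    inv_mul_cancel₀ (sub_ne_zero.2 hz'), neg_one_smul]

/-- A sectorial operator with dense range is injective: `λ R(λ, A) → 0` strongly on the range as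
`λ → 0`, whereas `λ R(λ, A) x = x` if `A x = 0`. -/
theorem IsSectorial.ker_eq_bot {A : X →ₗ.[ℂ] X} {ω : ℝ} (hA : IsSectorial A ω)
    (hd : Dense (Set.range A)) : LinearMap.ker A.toFun = ⊥ := by
  rw [LinearMap.ker_eq_bot']
  intro x hx
  obtain ⟨ω', h1, h2⟩ := exists_between hA.lt_pi
  obtain ⟨M, hM⟩ := hA.bound ω' h1 h2
  have harg : ∀ t : ℝ, 0 < t → |(((-t : ℝ) : ℂ)).arg| = Real.pi := by
    intro t ht
    rw [Complex.arg_ofReal_of_neg (by linarith), abs_of_pos Real.pi_pos]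
  have hM0 : 0 ≤ M := (norm_nonneg _).trans
    (hM ((-1 : ℝ) : ℂ) (by rw [harg 1 one_pos]; exact h2.le))
  have hgx : ((x : X), (0 : X)) ∈ A.graph := by
    have := A.mem_graph x
    rwa [show A x = 0 from hx] at this
  have key : ∀ y ∈ Set.range A, ‖(x : X)‖ ≤ M * ‖(x : X) - y‖ := by
    rintro _ ⟨v, rfl⟩
    have h3 : ∀ t : ℝ, 0 < t → ‖(x : X)‖ ≤ M * ‖(x : X) - A v‖ + t * ((M + 1) * ‖(v : X)‖) := by
      intro t ht
      set z : ℂ := ((-t : ℝ) : ℂ) with hz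
      have h4 := hA.isResolvent (z := z) (by rw [harg t ht]; exact hA.lt_pi)
      have h5 := hM z (by rw [harg t ht]; exact h2.le)
      have h6 := h4.2 _ _ hgx
      rw [map_zero, eq_comm, sub_eq_zero] at h6
      have h7 := h4.2 _ _ (A.mem_graph v)
      have h8 : (x : X) = (z • resolvent z A) ((x : X) - A v) +
          z • ((z • resolvent z A) (v : X) - v) := by
        rw [map_sub]
        simp only [smul_apply]
        rw [h6, h7]
        abel
      have hzn : ‖z‖ = t := by rw [hz, Complex.norm_real, Real.norm_eq_abs, abs_neg, abs_of_pos ht]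
      calc ‖(x : X)‖ ≤ ‖(z • resolvent z A) ((x : X) - A v)‖ +
            ‖z • ((z • resolvent z A) (v : X) - v)‖ := by
            conv_lhs => rw [h8]
            exact norm_add_le _ _
        _ ≤ M * ‖(x : X) - A v‖ + t * ((M + 1) * ‖(v : X)‖) := by
            rw [norm_smul z, hzn]
            gcongr
            · exact (z • resolvent z A).le_of_opNorm_le h5 _
            · refine (norm_sub_le _ _).trans ?_
              have := (z • resolvent z A).le_of_opNorm_le h5 v
              linarith
    refine le_of_forall_pos_le_add fun ε hε => ?_
    have hpos : 0 < (M + 1) * ‖(v : X)‖ + 1 := by positivity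
    have h9 := h3 (ε / ((M + 1) * ‖(v : X)‖ + 1)) (by positivity)
    refine h9.trans (add_le_add le_rfl ?_)
    rw [div_mul_eq_mul_div, div_le_iff₀ hpos]
    nlinarith
  have hx0 : ‖(x : X)‖ ≤ 0 := by
    have hcl : IsClosed {y : X | ‖(x : X)‖ ≤ M * ‖(x : X) - y‖} :=
      isClosed_le continuous_const (by fun_prop)
    have h10 : (x : X) ∈ {y : X | ‖(x : X)‖ ≤ M * ‖(x : X) - y‖} :=
      closure_minimal (fun y hy => key y hy) hcl (hd x)
    have h11 : ‖(x : X)‖ ≤ M * ‖(x : X) - x‖ := h10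
    simpa using h11
  exact Subtype.ext (norm_le_zero_iff.1 hx0)

/-- `e^w R(e^w, A)`. -/
def logRes (A : X →ₗ.[ℂ] X) (w : ℂ) : X →L[ℂ] X :=
  Complex.exp w • resolvent (Complex.exp w) A

theorem IsSectorial.isResolvent_exp {A : X →ₗ.[ℂ] X} {ω θ : ℝ} (hA : IsSectorial A ω)
    (hθ : ω < θ) {w : ℂ} (h1 : θ ≤ |w.im|) (h2 : |w.im| ≤ 2 * Real.pi - θ) :
    IsResolvent A (Complex.exp w) (resolvent (Complex.exp w) A) :=
  hA.isResolvent (hθ.trans_le (le_abs_arg_exp (hA.nonneg.trans_lt hθ) h1 h2))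

theorem IsSectorial.differentiableAt_logRes {A : X →ₗ.[ℂ] X} {ω θ : ℝ} (hA : IsSectorial A ω)
    (hθ : ω < θ) {w : ℂ} (h1 : θ ≤ |w.im|) (h2 : |w.im| ≤ 2 * Real.pi - θ) :
    DifferentiableAt ℂ (logRes A) w := by
  have h3 := hA.differentiableAt_resolvent
    (hθ.trans_le (le_abs_arg_exp (hA.nonneg.trans_lt hθ) h1 h2))
  exact Complex.differentiableAt_exp.smul (h3.comp w Complex.differentiableAt_exp)

theorem IsSectorial.exists_norm_logRes_le {A : X →ₗ.[ℂ] X} {ω θ : ℝ} (hA : IsSectorial A ω)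
    (hθ : ω < θ) (hθ' : θ < Real.pi) : ∃ M : ℝ, 0 ≤ M ∧
      ∀ w : ℂ, θ ≤ |w.im| → |w.im| ≤ 2 * Real.pi - θ → ‖logRes A w‖ ≤ M := by
  obtain ⟨M, hM⟩ := hA.bound θ hθ hθ'
  refine ⟨|M|, abs_nonneg M, fun w h1 h2 => (hM _ ?_).trans (le_abs_self M)⟩
  exact le_abs_arg_exp (hA.nonneg.trans_lt hθ) h1 h2

theorem logRes_apply_of_mem_graph {A : X →ₗ.[ℂ] X} {w : ℂ}
    (h : IsResolvent A (Complex.exp w) (resolvent (Complex.exp w) A)) {x y : X}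
    (hxy : (x, y) ∈ A.graph) : logRes A w y = Complex.exp w • (logRes A w x - x) := by
  rw [logRes, smul_apply, smul_apply, h.2 x y hxy]

theorem logRes_resolvent_identity {A : X →ₗ.[ℂ] X} {w w' : ℂ}
    (h : IsResolvent A (Complex.exp w) (resolvent (Complex.exp w) A))
    (h' : IsResolvent A (Complex.exp w') (resolvent (Complex.exp w') A)) :
    (Complex.exp w' - Complex.exp w) • (logRes A w * logRes A w') =
      Complex.exp w' • logRes A w - Complex.exp w • logRes A w' := by
  have h1 := h.sub_eq h'
  simp only [logRes, smul_mul_smul_comm]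
  rw [smul_comm, ← h1, smul_sub, smul_smul, smul_smul, mul_comm (Complex.exp w')]

theorem IsSectorial.exists_isLogResolvent {A : X →ₗ.[ℂ] X} {ω θ θ' : ℝ} (hA : IsSectorial A ω)
    (hθ : ω < θ) (hθ' : θ ≤ θ') (hπ : θ' < Real.pi) :
    ∃ M : ℝ, IsLogResolvent θ θ' M (logRes A) := by
  obtain ⟨M, _, hM⟩ := hA.exists_norm_logRes_le hθ (hθ'.trans_lt hπ)
  have key : ∀ w : ℂ, |w.im| ≤ θ' → |w.im| ≤ 2 * Real.pi - θ := fun w hw => by linarith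
  exact ⟨M, fun w h1 h2 => hA.differentiableAt_logRes hθ h1 (key w h2),
    fun w h1 h2 => hM w h1 (key w h2), fun w w' h1 h2 h3 h4 =>
      logRes_resolvent_identity (hA.isResolvent_exp hθ h1 (key w h2))
        (hA.isResolvent_exp hθ h3 (key w' h4))⟩

end Sectorial

/-! ### Integrals over rays and the function `φ` -/

section ChangeOfVariables

variable {E : Type*} [NormedAddCommGroup E] [NormedSpace ℂ E]

theorem image_exp_univ : Real.exp '' univ = Ioi (0 : ℝ) := by
  rw [image_univ, Real.range_exp]

theorem integral_Ioi_eq_integral_exp (g : ℝ → E) :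
    ∫ r in Ioi (0 : ℝ), g r = ∫ s : ℝ, Real.exp s • g (Real.exp s) := by
  rw [← image_exp_univ]
  simpa [abs_of_pos (Real.exp_pos _)] using integral_image_eq_integral_abs_deriv_smul
    MeasurableSet.univ (fun x _ => (Real.hasDerivAt_exp x).hasDerivWithinAt)
    (fun x _ y _ hxy => Real.exp_injective hxy) g

theorem integrableOn_Ioi_iff_integrable_exp (g : ℝ → E) :
    IntegrableOn g (Ioi 0) ↔ Integrable fun s : ℝ => Real.exp s • g (Real.exp s) := by
  rw [← image_exp_univ]
  simpa [abs_of_pos (Real.exp_pos _)] using integrableOn_image_iff_integrableOn_abs_deriv_smul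
    MeasurableSet.univ (fun x _ => (Real.hasDerivAt_exp x).hasDerivWithinAt)
    (fun x _ y _ hxy => Real.exp_injective hxy) g

theorem ofReal_exp_mul_exp_mul_I (s θ : ℝ) :
    ((Real.exp s : ℝ) : ℂ) * Complex.exp (θ * Complex.I) = Complex.exp (s + θ * Complex.I) := by
  rw [Complex.ofReal_exp, Complex.exp_add]

/-- Integrals along rays are integrals along horizontal lines in the coordinate `z = e^w`. -/
theorem rayIntegral_eq_lineIntegral (θ : ℝ) (f : ℂ → E) :
    rayIntegral θ f = lineIntegral θ fun w => Complex.exp w • f (Complex.exp w) := by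
  rw [rayIntegral, integral_Ioi_eq_integral_exp, lineIntegral]
  congr 1
  funext s
  rw [ofReal_exp_mul_exp_mul_I, ← Complex.coe_smul, smul_smul, ofReal_exp_mul_exp_mul_I]

theorem smul_sectorIntegral_eq_contourMean (ν : ℝ) (f : ℂ → E) :
    (2 * Real.pi * Complex.I : ℂ)⁻¹ • sectorIntegral ν f =
      contourMean ν fun w => Complex.exp w • f (Complex.exp w) := by
  rw [sectorIntegral, contourMean, rayIntegral_eq_lineIntegral, rayIntegral_eq_lineIntegral]

theorem contourMean_comp_add_ofReal (ν u : ℝ) (f : ℂ → E) :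
    contourMean ν (fun w => f (w + u)) = contourMean ν f := by
  have key : ∀ θ : ℝ, lineIntegral θ (fun w => f (w + u)) = lineIntegral θ f := by
    intro θ
    unfold lineIntegral
    rw [← integral_add_right_eq_self (fun s : ℝ => f (s + θ * Complex.I)) u]
    congr 1
    funext s
    have h : (s : ℂ) + θ * Complex.I + u = ((s + u : ℝ) : ℂ) + θ * Complex.I := by
      push_cast
      ring
    exact congrArg f h
  rw [contourMean, contourMean, key, key]

end ChangeOfVariables

section Phi

/-- A ray of angle smaller than `θ` does not meet the horizontal half-line to the left of
`e^{iθ}`. -/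
theorem not_mul_cos_le_of_mul_sin_eq {r τ θ : ℝ} (hθ : θ < Real.pi) (hτ : |τ| < θ)
    (h1 : r * Real.sin τ = Real.sin θ) (h2 : r * Real.cos τ ≤ Real.cos θ) (hr : 0 < r) : False := by
  obtain ⟨h3, h4⟩ := abs_lt.1 hτ
  have hsθ : 0 < Real.sin θ := Real.sin_pos_of_pos_of_lt_pi ((abs_nonneg τ).trans_lt hτ) hθ
  have hsτ : 0 < Real.sin τ := by
    by_contra h
    nlinarith [mul_nonpos_of_nonneg_of_nonpos hr.le (not_lt.1 h)]
  have hτ0 : 0 < τ := by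
    by_contra h
    linarith [Real.sin_nonpos_of_nonpos_of_neg_pi_le (not_lt.1 h) (by linarith)]
  have h5 : 0 < Real.sin (θ - τ) := Real.sin_pos_of_pos_of_lt_pi (by linarith) (by linarith)
  rw [Real.sin_sub] at h5
  have h6 := mul_pos hr h5
  have h7 : r * (Real.sin θ * Real.cos τ - Real.cos θ * Real.sin τ) =
      Real.sin θ * (r * Real.cos τ) - Real.cos θ * (r * Real.sin τ) := by ring
  rw [h7, h1] at h6
  linarith [mul_le_mul_of_nonneg_left h2 hsθ.le]

theorem neg_exp_add_exp_mem_slitPlane {θ : ℝ} (hθ : |θ| < Real.pi) {w : ℂ} (hw : |w.im| < |θ|) :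
    -Complex.exp (θ * Complex.I) + Complex.exp w ∈ Complex.slitPlane := by
  rw [Complex.mem_slitPlane_iff]
  by_contra! h
  obtain ⟨h1, h2⟩ := h
  simp only [Complex.add_re, Complex.neg_re, Complex.exp_ofReal_mul_I_re] at h1
  rw [Complex.exp_re] at h1
  simp only [Complex.add_im, Complex.neg_im, Complex.exp_ofReal_mul_I_im] at h2
  rw [Complex.exp_im] at h2
  rcases abs_cases θ with h | h
  · rw [h.1] at hw hθ
    exact not_mul_cos_le_of_mul_sin_eq hθ hw (by linarith) (by linarith) (Real.exp_pos w.re)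
  · rw [h.1] at hw hθ
    refine not_mul_cos_le_of_mul_sin_eq (τ := -w.im) hθ (by rwa [abs_neg]) ?_ ?_ (Real.exp_pos w.re)
    · rw [Real.sin_neg, Real.sin_neg]; linarith
    · rw [Real.cos_neg, Real.cos_neg]; linarith

/-- `φ_θ(tz)² = e^{-iθ/2} (z z')^{1/2} / (z - z')` with `z' = e^{iθ} / t`, in the coordinates
`z = e^w` and `t = e^{-u}`. -/
theorem phi_mul_phi {θ : ℝ} (hθ : |θ| < Real.pi) (u : ℝ) {w : ℂ} (hw : |w.im| < |θ|) :
    phi θ (Complex.exp (w - u)) * phi θ (Complex.exp (w - u)) =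
      Complex.exp (-(θ / 2 * Complex.I)) * sqrtKernel (u + θ * Complex.I) w := by
  have him : (w - u).im = w.im := by simp
  have hslit := neg_exp_add_exp_mem_slitPlane hθ (w := w - u) (by rwa [him])
  have hne := Complex.slitPlane_ne_zero hslit
  obtain ⟨h1, h2⟩ := abs_lt.1 (hw.trans hθ)
  have h3 : Complex.exp (w - u) ^ (1 / 4 : ℂ) * Complex.exp (w - u) ^ (1 / 4 : ℂ) =
      Complex.exp ((w - u) / 2) := by
    rw [Complex.cpow_def_of_ne_zero (Complex.exp_ne_zero _), Complex.log_exp (by rw [him]; exact h1)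
      (by rw [him]; exact h2.le), ← Complex.exp_add]
    congr 1
    ring
  have h4 : (-Complex.exp (θ * Complex.I) + Complex.exp (w - u)) ^ (1 / 2 : ℂ) *
      (-Complex.exp (θ * Complex.I) + Complex.exp (w - u)) ^ (1 / 2 : ℂ) =
      -Complex.exp (θ * Complex.I) + Complex.exp (w - u) := by
    rw [← Complex.cpow_add _ _ hne]
    norm_num
  rw [phi, div_mul_div_comm, h3, h4, sqrtKernel, ← mul_assoc, ← Complex.exp_add, div_eq_mul_inv]
  have h5 : Complex.exp w - Complex.exp (u + θ * Complex.I) =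
      Complex.exp u * (-Complex.exp (θ * Complex.I) + Complex.exp (w - u)) := by
    rw [mul_add, mul_neg, ← Complex.exp_add, ← Complex.exp_add]
    ring_nf
  rw [h5, mul_inv, ← mul_assoc, ← Complex.exp_neg, ← Complex.exp_add]
  congr 2
  ring

theorem isStripTest_phi {θ ν' : ℝ} (hθ : |θ| < Real.pi) (hν' : ν' < |θ|) (u : ℝ) :
    IsStripTest ν' fun w => phi θ (Complex.exp (w - u)) := by
  refine ⟨fun w hw => ?_, ?_⟩
  · have him : (w - u).im = w.im := by simp
    have hslit := neg_exp_add_exp_mem_slitPlane hθ (w := w - u) (by rw [him]; linarith)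
    have hne := Complex.slitPlane_ne_zero hslit
    have hw' : |w.im| < Real.pi := by linarith
    obtain ⟨h1, h2⟩ := abs_lt.1 hw'
    have h3 : Complex.exp (w - u) ∈ Complex.slitPlane := by
      refine Complex.mem_slitPlane_iff_arg.2 ⟨?_, Complex.exp_ne_zero _⟩
      rw [← Complex.log_im, Complex.log_exp (by rw [him]; exact h1) (by rw [him]; exact h2.le), him]
      exact h2.ne
    unfold phi
    refine DifferentiableAt.div (DifferentiableAt.cpow (by fun_prop) (by fun_prop) h3)
      (DifferentiableAt.cpow (by fun_prop) (by fun_prop) hslit) ?_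
    rw [Complex.cpow_def_of_ne_zero hne]
    exact Complex.exp_ne_zero _
  · obtain ⟨C, ε, hε, hC⟩ := (isStripTest_sqrtKernel (ν' := ν') (w' := u + θ * Complex.I)
      (by simpa using hν') (by simpa using hθ)).bound
    refine ⟨Real.sqrt C, ε / 2, half_pos hε, fun w hw => ?_⟩
    have h1 := hC w hw
    have h2 := congrArg norm (phi_mul_phi hθ u (hw.trans_lt hν'))
    have h3 : ‖Complex.exp (-(θ / 2 * Complex.I))‖ = 1 := by
      rw [Complex.norm_exp]
      simp
    rw [norm_mul, norm_mul, h3, one_mul] at h2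
    have h4 : 0 ≤ C := by
      by_contra h
      nlinarith [norm_nonneg (sqrtKernel (u + θ * Complex.I) w), Real.exp_pos (-ε * |w.re|)]
    refine abs_le_of_sq_le_sq' ?_ (by positivity) |>.2
    rw [mul_pow, Real.sq_sqrt h4, pow_two, h2, pow_two, ← Real.exp_add]
    refine h1.trans_eq ?_
    congr 2
    ring

end Phi

section Bilin

variable {X : Type*} [NormedAddCommGroup X] [NormedSpace ℂ X]

/-- `φ(tA)` in the coordinates `z = e^w`, `t = e^{-u}`. -/
theorem IsSectorial.funCalc_smul {A : X →ₗ.[ℂ] X} {ω ν : ℝ} (hA : IsSectorial A ω) (hν : ω < ν)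
    (hν' : ν < Real.pi) (u : ℝ) (φ : ℂ → ℂ) :
    funCalc ν φ (((Real.exp (-u) : ℝ) : ℂ) • A) =
      logCalc ν (logRes A) fun w => φ (Complex.exp (w - u)) := by
  have ht : ((Real.exp (-u) : ℝ) : ℂ) ≠ 0 := by exact_mod_cast (Real.exp_pos _).ne'
  rw [funCalc, smul_sectorIntegral_eq_contourMean, logCalc,
    ← contourMean_comp_add_ofReal ν u fun w => φ (Complex.exp (w - u)) • logRes A w]
  refine contourMean_congr (hA.nonneg.trans hν.le) fun w hw => ?_
  have h1 : Complex.exp w / ((Real.exp (-u) : ℝ) : ℂ) = Complex.exp (w + u) := by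
    rw [Complex.ofReal_exp, ← Complex.exp_sub]
    push_cast
    ring_nf
  have him : (w + u).im = w.im := by simp
  have h2 := hA.isResolvent_exp hν (w := w + u) (by rw [him]; exact hw.ge)
    (by rw [him]; linarith)
  rw [← h1] at h2
  rw [(h2.smul ht).resolvent_eq, logRes, ← h1, add_sub_cancel_right]
  simp only [smul_smul]
  congr 1
  rw [div_eq_mul_inv]
  ring

/-- `ψ(tB)` in the coordinate `t = e^{-u}`. -/
theorem IsSectorial.psiOp_smul {B : X →ₗ.[ℂ] X} {ω ρ θ : ℝ} (hB : IsSectorial B ω)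
    (hρ : ρ < Real.pi - ω) (hθ : |θ| = ρ) (u : ℝ) :
    psiOp θ (((Real.exp (-u) : ℝ) : ℂ) • B) =
      Complex.exp (-(θ * Complex.I)) • logRes B (u + θ * Complex.I + Real.pi * Complex.I) := by
  have ht : ((Real.exp (-u) : ℝ) : ℂ) ≠ 0 := by exact_mod_cast (Real.exp_pos _).ne'
  have him : ((u : ℂ) + θ * Complex.I + Real.pi * Complex.I).im = θ + Real.pi := by simp
  obtain ⟨h3, h4⟩ := abs_le.1 hθ.le
  have h5 := hB.nonneg
  have h2 := hB.isResolvent_exp (θ := Real.pi - ρ) (by linarith)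
    (w := u + θ * Complex.I + Real.pi * Complex.I)
    (by rw [him, abs_of_nonneg (by linarith)]; linarith)
    (by rw [him, abs_of_nonneg (by linarith)]; linarith)
  have hexp : Complex.exp (u + θ * Complex.I + Real.pi * Complex.I) =
      -(Complex.exp u * Complex.exp (θ * Complex.I)) := by
    rw [Complex.exp_add, Complex.exp_pi_mul_I, Complex.exp_add]
    ring
  have hinv : ((Real.exp (-u) : ℝ) : ℂ)⁻¹ = Complex.exp u := by
    rw [Complex.ofReal_exp, ← Complex.exp_neg]
    push_cast
    rw [neg_neg]
  have h1 : -Complex.exp (θ * Complex.I) / ((Real.exp (-u) : ℝ) : ℂ) =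
      Complex.exp (u + θ * Complex.I + Real.pi * Complex.I) := by
    rw [hexp, div_eq_mul_inv, hinv]
    ring
  rw [← h1] at h2
  rw [psiOp, (h2.smul ht).boundedInverse_shift_eq, logRes, ← h1, hinv, ← neg_smul, smul_smul,
    div_eq_mul_inv, hinv]
  congr 1
  have h6 : Complex.exp (-(θ * Complex.I)) * Complex.exp (θ * Complex.I) = 1 := by
    rw [← Complex.exp_add]; simp
  linear_combination Complex.exp u * h6

end Bilin

/-! ### Decay on ranges and domains, and the reproducing formula -/

section Single

variable {X : Type*} [NormedAddCommGroup X] [NormedSpace ℂ X]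

theorem IsResolvent.mem_graph_iff {A : X →ₗ.[ℂ] X} {z : ℂ} {R : X →L[ℂ] X}
    (h : IsResolvent A z R) {x y : X} : (x, y) ∈ A.graph ↔ x = R (z • x - y) := by
  constructor
  · intro hxy
    rw [map_sub, map_smul, h.2 x y hxy]
    abel
  · intro hx
    have h1 := h.1 (z • x - y)
    rw [← hx, sub_sub_cancel] at h1
    exact h1

theorem IsResolvent.map_mem_graph {A : X →ₗ.[ℂ] X} {z : ℂ} {R S : X →L[ℂ] X}
    (h : IsResolvent A z R) (hS : Commute S R) {x y : X} (hxy : (x, y) ∈ A.graph) :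
    (S x, S y) ∈ A.graph := by
  have h1 := congrArg S (h.mem_graph_iff.1 hxy)
  have h2 : S (R (z • x - y)) = R (S (z • x - y)) := by
    have := congrArg (fun T : X →L[ℂ] X => T (z • x - y)) hS.eq
    exact this
  rw [h2, map_sub, map_smul] at h1
  exact h.mem_graph_iff.2 h1

theorem IsBoundedInverse.range_eq {T : X →ₗ.[ℂ] X} {R : X →L[ℂ] X} (h : IsBoundedInverse T R) :
    Set.range R = (T.domain : Set X) := by
  ext x
  constructor
  · rintro ⟨y, rfl⟩
    exact (h.1 y).1
  · exact fun hx => ⟨T ⟨x, hx⟩, h.2 ⟨x, hx⟩⟩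

theorem logRes_mul_eq {A : X →ₗ.[ℂ] X} {w z : ℂ} {R : X →L[ℂ] X}
    (h : IsResolvent A (Complex.exp w) (resolvent (Complex.exp w) A)) (hR : IsResolvent A z R) :
    logRes A w * (z • R - 1) = Complex.exp w • ((logRes A w - 1) * R) := by
  ext x
  exact logRes_apply_of_mem_graph h (hR.1 x)

/-- `λ R(λ, A)` is `O(|λ|)` at `0` on the range of `A`. -/
theorem norm_logRes_mul_le {A : X →ₗ.[ℂ] X} {w z : ℂ} {R : X →L[ℂ] X} {M : ℝ}
    (h : IsResolvent A (Complex.exp w) (resolvent (Complex.exp w) A)) (hR : IsResolvent A z R)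
    (hM : ‖logRes A w‖ ≤ M) :
    ‖logRes A w * (1 - z • R)‖ ≤ (M + 1) * ‖R‖ * Real.exp w.re := by
  rw [← neg_sub, mul_neg, norm_neg, logRes_mul_eq h hR, norm_smul, Complex.norm_exp, mul_comm]
  refine mul_le_mul_of_nonneg_right ?_ (Real.exp_pos _).le
  refine (norm_mul_le _ _).trans (mul_le_mul_of_nonneg_right ?_ (norm_nonneg _))
  refine (norm_sub_le _ _).trans (add_le_add hM ?_)
  exact ContinuousLinearMap.norm_id_le

/-- `λ R(λ, A) - 1` is `O(1 / |λ|)` at `∞` on the domain of `A`. -/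
theorem norm_logRes_sub_one_mul_le {A : X →ₗ.[ℂ] X} {w z : ℂ} {R : X →L[ℂ] X} {M : ℝ}
    (h : IsResolvent A (Complex.exp w) (resolvent (Complex.exp w) A)) (hR : IsResolvent A z R)
    (hM : ‖logRes A w‖ ≤ M) :
    ‖(logRes A w - 1) * R‖ ≤ M * ‖z • R - 1‖ * Real.exp (-w.re) := by
  have h1 : (logRes A w - 1) * R = Complex.exp (-w) • (logRes A w * (z • R - 1)) := by
    rw [logRes_mul_eq h hR, smul_smul, ← Complex.exp_add]
    simp
  rw [h1, norm_smul, Complex.norm_exp, mul_comm, Complex.neg_re]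
  refine mul_le_mul_of_nonneg_right ?_ (Real.exp_pos _).le
  exact (norm_mul_le _ _).trans (mul_le_mul_of_nonneg_right hM (norm_nonneg _))

theorem commute_logCalc {𝒜 : Type*} [NormedRing 𝒜] [NormedAlgebra ℂ 𝒜] [CompleteSpace 𝒜]
    {ν₀ ν₁ ν M : ℝ} {a : ℂ → 𝒜} {f : ℂ → ℂ} (ha : IsLogResolvent ν₀ ν₁ M a) (h0 : 0 ≤ ν₀)
    (h1 : ν₀ ≤ ν) (h2 : ν ≤ ν₁) (hf : IsStripTest ν f) {c : 𝒜}
    (hc : ∀ w : ℂ, |w.im| = ν → Commute c (a w)) : Commute c (logCalc ν a f) := by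
  have hint := lineIntegrable_test_smul ha h0 h1 h2 hf
  have e1 := contourMean_map hint (ContinuousLinearMap.mul ℂ 𝒜 c)
  have e2 := contourMean_map hint ((ContinuousLinearMap.mul ℂ 𝒜).flip c)
  simp only [ContinuousLinearMap.flip_apply, ContinuousLinearMap.mul_apply'] at e1 e2
  change c * contourMean ν _ = contourMean ν _ * c
  rw [← e1, ← e2]
  refine contourMean_congr (h0.trans h1) fun w hw => ?_
  rw [mul_smul_comm, smul_mul_assoc, (hc w hw).eq]

/-- The functional calculus reproduces the resolvent: the contour is moved to the two sides of the
strip `{ν ≤ Im w ≤ 2π - ν}`, where the pole of `1 / (e^w - e^{iρ})` is the only singularity. -/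
theorem IsSectorial.contourMean_kernel_logRes [CompleteSpace X] {A : X →ₗ.[ℂ] X} {ω ν ρ : ℝ}
    (hA : IsSectorial A ω) (hν : ω < ν) (hνρ : ν < ρ) (hρ : ρ < Real.pi) {x y : X}
    (hxy : (x, y) ∈ A.graph) :
    contourMean ν (fun w => (Complex.exp w - Complex.exp (ρ * Complex.I))⁻¹ • logRes A w y) =
      -(resolvent (Complex.exp (ρ * Complex.I)) A y) := by
  have hν0 : 0 < ν := hA.nonneg.trans_lt hν
  obtain ⟨M, hM0, hM⟩ := hA.exists_norm_logRes_le hν (hνρ.trans hρ)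
  have him : ((ρ : ℂ) * Complex.I).im = ρ := by simp
  have hstrip : ∀ w : ℂ, ν ≤ w.im → w.im ≤ 2 * Real.pi - ν →
      ν ≤ |w.im| ∧ |w.im| ≤ 2 * Real.pi - ν := fun w h1 h2 => by
    rw [abs_of_nonneg (hν0.le.trans h1)]; exact ⟨h1, h2⟩
  have hper : lineIntegral (-ν) (fun w =>
      (Complex.exp w - Complex.exp (ρ * Complex.I))⁻¹ • logRes A w y) =
      lineIntegral (2 * Real.pi - ν) fun w =>
        (Complex.exp w - Complex.exp (ρ * Complex.I))⁻¹ • logRes A w y := by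
    unfold lineIntegral
    congr 1
    funext s
    have h1 : Complex.exp ((s : ℂ) + ((2 * Real.pi - ν : ℝ) : ℂ) * Complex.I) =
        Complex.exp ((s : ℂ) + ((-ν : ℝ) : ℂ) * Complex.I) := by
      rw [← mul_one (Complex.exp ((s : ℂ) + ((-ν : ℝ) : ℂ) * Complex.I)),
        ← Complex.exp_two_pi_mul_I, ← Complex.exp_add]
      congr 1
      push_cast
      ring
    simp only [logRes, h1]
  have hres := lineIntegral_sub_lineIntegral_kernel (a := ν) (b := 2 * Real.pi - ν)
    (w₀ := ρ * Complex.I) (G := fun w => logRes A w y) (by rw [him]; exact hνρ)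
    (by rw [him]; linarith) (by rw [him]; linarith) (by rw [him]; linarith)
    (fun w h1 h2 => (hA.differentiableAt_logRes hν (hstrip w h1 h2).1
      (hstrip w h1 h2).2).clm_apply (differentiableAt_const y))
    ⟨max ((M + 1) * ‖x‖) (M * ‖y‖), 1, one_pos, fun w h1 h2 => ?_⟩
  · have hpi : (2 * Real.pi * Complex.I : ℂ) ≠ 0 := by simp [Real.pi_ne_zero]
    have h3 : Complex.exp (-(ρ * Complex.I)) • logRes A (ρ * Complex.I) y =
        resolvent (Complex.exp (ρ * Complex.I)) A y := by
      rw [logRes, smul_apply, smul_smul, ← Complex.exp_add]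
      simp
    rw [h3] at hres
    rw [contourMean, hper, ← neg_sub, hres, smul_neg, inv_smul_smul₀ hpi]
  · obtain ⟨h3, h4⟩ := hstrip w h1 h2
    have h5 := hM w h3 h4
    refine le_exp_neg_abs_mul (by positivity) ((logRes A w).le_of_opNorm_le h5 y) ?_
    change ‖logRes A w y‖ ≤ _
    rw [logRes_apply_of_mem_graph (hA.isResolvent_exp hν h3 h4) hxy, norm_smul, Complex.norm_exp,
      mul_comm]
    refine mul_le_mul_of_nonneg_right ?_ (Real.exp_pos _).le
    refine (norm_sub_le _ _).trans ?_
    have := (logRes A w).le_of_opNorm_le h5 x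
    linarith

end Single

/-! ### Pairs of sectorial operators -/

section Pair

variable {X : Type*} [NormedAddCommGroup X] [NormedSpace ℂ X]

/-- `e^w (e^w + B)⁻¹`, expressed through the resolvents of `B` by `e^{w + πi} = -e^w`. -/
def logResNeg (B : X →ₗ.[ℂ] X) (w : ℂ) : X →L[ℂ] X :=
  logRes B (w + Real.pi * Complex.I)

theorem exp_add_pi_mul_I_eq_neg (w : ℂ) :
    Complex.exp (w + Real.pi * Complex.I) = -Complex.exp w := by
  rw [Complex.exp_add, Complex.exp_pi_mul_I, mul_neg_one]

variable {A B : X →ₗ.[ℂ] X} {ωA ωB ρ ν : ℝ}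

theorem AssumptionSigma.rho_lt_pi (h : AssumptionSigma A B ωA ωB ρ) : ρ < Real.pi := by
  linarith [h.rho_lt, h.sectorial_right.nonneg]

theorem AssumptionSigma.rho_pos (h : AssumptionSigma A B ωA ωB ρ) : 0 < ρ :=
  h.sectorial_left.nonneg.trans_lt h.lt_rho

theorem AssumptionSigma.abs_im_add_pi (h : AssumptionSigma A B ωA ωB ρ) {w : ℂ}
    (hw : |w.im| ≤ ρ) : Real.pi - ρ ≤ |(w + Real.pi * Complex.I).im| ∧
      |(w + Real.pi * Complex.I).im| ≤ 2 * Real.pi - (Real.pi - ρ) := by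
  obtain ⟨h1, h2⟩ := abs_le.1 hw
  have h3 : (w + Real.pi * Complex.I).im = w.im + Real.pi := by simp
  rw [h3, abs_of_nonneg (by linarith [h.rho_lt_pi])]
  constructor <;> linarith

theorem AssumptionSigma.isResolvent_neg_exp (h : AssumptionSigma A B ωA ωB ρ) {w : ℂ}
    (hw : |w.im| ≤ ρ) : IsResolvent B (Complex.exp (w + Real.pi * Complex.I))
      (resolvent (Complex.exp (w + Real.pi * Complex.I)) B) :=
  h.sectorial_right.isResolvent_exp (by linarith [h.rho_lt]) (h.abs_im_add_pi hw).1
    (h.abs_im_add_pi hw).2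

theorem AssumptionSigma.boundedInverse_shift (h : AssumptionSigma A B ωA ωB ρ) {w : ℂ}
    (hw : |w.im| ≤ ρ) :
    boundedInverse (shift (Complex.exp w) B) = Complex.exp (-w) • logResNeg B w := by
  have h1 := h.isResolvent_neg_exp hw
  rw [logResNeg, logRes, smul_smul]
  rw [exp_add_pi_mul_I_eq_neg] at h1 ⊢
  rw [h1.boundedInverse_shift_eq, mul_neg, ← Complex.exp_add]
  simp

theorem AssumptionSigma.differentiableAt_logResNeg (h : AssumptionSigma A B ωA ωB ρ) {w : ℂ}
    (hw : |w.im| ≤ ρ) : DifferentiableAt ℂ (logResNeg B) w := by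
  have h1 := h.sectorial_right.differentiableAt_logRes (by linarith [h.rho_lt])
    (h.abs_im_add_pi hw).1 (h.abs_im_add_pi hw).2
  exact h1.comp w (by fun_prop)

theorem AssumptionSigma.exists_norm_logResNeg_le (h : AssumptionSigma A B ωA ωB ρ) :
    ∃ N : ℝ, 0 ≤ N ∧ ∀ w : ℂ, |w.im| ≤ ρ → ‖logResNeg B w‖ ≤ N := by
  obtain ⟨N, hN, hb⟩ := h.sectorial_right.exists_norm_logRes_le
    (θ := Real.pi - ρ) (by linarith [h.rho_lt]) (by linarith [h.rho_pos])
  exact ⟨N, hN, fun w hw => hb _ (h.abs_im_add_pi hw).1 (h.abs_im_add_pi hw).2⟩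

theorem AssumptionSigma.commute_resolvent (h : AssumptionSigma A B ωA ωB ρ) {z z' : ℂ}
    {R S : X →L[ℂ] X} (hR : IsResolvent A z R) (hS : IsResolvent B z' S) : Commute R S := by
  rw [← hR.resolvent_eq, ← hS.resolvent_eq]
  exact h.commute z ⟨R, isBoundedInverse_shift_neg_iff.2 hR⟩ z'
    ⟨S, isBoundedInverse_shift_neg_iff.2 hS⟩

theorem AssumptionSigma.commute_logRes (h : AssumptionSigma A B ωA ωB ρ) (hν : ωA < ν)
    {w w' : ℂ} (hw : ν ≤ |w.im|) (hw2 : |w.im| ≤ ρ) (hw' : |w'.im| ≤ ρ) :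
    Commute (logResNeg B w') (logRes A w) := by
  have h1 := h.sectorial_left.isResolvent_exp hν hw (by linarith [h.rho_lt_pi])
  have h2 := h.isResolvent_neg_exp hw'
  exact ((h.commute_resolvent h1 h2).symm.smul_left _).smul_right _

/-- The bilinear form of the hypothesis, in the coordinate `t = e^{-u}`. -/
theorem AssumptionSigma.bilin_eq [CompleteSpace X] (h : AssumptionSigma A B ωA ωB ρ)
    (hν : ωA < ν) (hνρ : ν < ρ) {θ : ℝ} (hθ : |θ| = ρ) (x : X) (x' : StrongDual ℂ X) :
    bilin A B ν θ x x' = Complex.exp (-(3 * θ / 2 * Complex.I)) * lineIntegral θ fun w' =>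
      x' ((logResNeg B w' * logCalc ν (logRes A) (sqrtKernel w')) x) := by
  have hν0 : 0 < ν := h.sectorial_left.nonneg.trans_lt hν
  have hρπ := h.rho_lt_pi
  obtain ⟨M, ha⟩ := h.sectorial_left.exists_isLogResolvent hν hνρ.le hρπ
  have hmid : ν < (ν + ρ) / 2 := by linarith
  have hmid' : (ν + ρ) / 2 < |θ| := by linarith
  have key : ∀ u : ℝ, (x'.comp (funCalc ν (phi θ) (((Real.exp (-u) : ℝ) : ℂ) • A)))
      (psiOp θ (((Real.exp (-u) : ℝ) : ℂ) • B)
        (funCalc ν (phi θ) (((Real.exp (-u) : ℝ) : ℂ) • A) x)) =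
      Complex.exp (-(3 * θ / 2 * Complex.I)) *
        x' ((logResNeg B (u + θ * Complex.I) *
          logCalc ν (logRes A) (sqrtKernel (u + θ * Complex.I))) x) := by
    intro u
    have hθ' : |θ| < Real.pi := by rw [hθ]; exact hρπ
    have hw' : |((u : ℂ) + θ * Complex.I).im| = ρ := by rw [abs_im_ofReal_add_mul_I, hθ]
    rw [h.sectorial_left.funCalc_smul hν (hνρ.trans hρπ) u,
      h.sectorial_right.psiOp_smul h.rho_lt hθ u]
    have htest := isStripTest_phi hθ' hmid' u
    set F := logCalc ν (logRes A) fun w => phi θ (Complex.exp (w - u)) with hF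
    have hcomm : Commute (logResNeg B (u + θ * Complex.I)) F :=
      commute_logCalc ha hν0.le le_rfl hνρ.le (htest.mono hmid.le) fun w hw =>
        h.commute_logRes hν hw.ge (hw ▸ hνρ.le) hw'.le
    have hFF : F * F = Complex.exp (-(θ / 2 * Complex.I)) •
        logCalc ν (logRes A) (sqrtKernel (u + θ * Complex.I)) := by
      rw [hF, logCalc_mul_logCalc ha hν0 le_rfl hmid (by linarith) hρπ htest htest, logCalc,
        logCalc, ← contourMean_const_smul]
      refine contourMean_congr hν0.le fun w hw => ?_
      rw [phi_mul_phi hθ' u (by linarith), smul_smul]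
    have h1 : F * ((Complex.exp (-(θ * Complex.I)) • logResNeg B (u + θ * Complex.I)) * F) =
        Complex.exp (-(3 * θ / 2 * Complex.I)) • (logResNeg B (u + θ * Complex.I) *
          logCalc ν (logRes A) (sqrtKernel (u + θ * Complex.I))) := by
      rw [smul_mul_assoc, mul_smul_comm, ← mul_assoc, ← hcomm.eq, mul_assoc, hFF, mul_smul_comm,
        smul_smul, ← Complex.exp_add]
      congr 2
      ring
    have h2 := congrArg (fun T : X →L[ℂ] X => x' (T x)) h1
    simp only [smul_apply, map_smul, smul_eq_mul] at h2
    rw [← h2]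
    rfl
  rw [bilin, integral_Ioi_eq_integral_exp, ← integral_neg_eq_self, lineIntegral,
    ← integral_const_mul]
  congr 1
  funext u
  rw [key u, ← Complex.coe_smul, smul_eq_mul, mul_inv_cancel_left₀]
  exact_mod_cast (Real.exp_pos _).ne'

end Pair

/-! ### The regularizing operator -/

section Regularizer

variable {X : Type*} [NormedAddCommGroup X] [NormedSpace ℂ X]

/-- The factor `R(μ, A⁻¹) (μ + B)⁻¹ (μ + B⁻¹)⁻¹` of the regularizing operator, `μ = e^{iρ}`. -/
def regularizer (A B : X →ₗ.[ℂ] X) (ρ : ℝ) : X →L[ℂ] X :=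
  resolvent (Complex.exp (ρ * Complex.I)) A.inverse *
    boundedInverse (shift (Complex.exp (ρ * Complex.I)) B) *
    boundedInverse (shift (Complex.exp (ρ * Complex.I)) B.inverse)

variable {A B : X →ₗ.[ℂ] X} {ωA ωB ρ ν : ℝ}

theorem domS_eq_range : domS A B ρ = LinearMap.range
    ((resolvent (Complex.exp (ρ * Complex.I)) A * regularizer A B ρ : X →L[ℂ] X) : X →ₗ[ℂ] X) := by
  rw [domS, regularizer, mul_assoc, mul_assoc, mul_assoc]

theorem AssumptionSigma.isResolvent_left (h : AssumptionSigma A B ωA ωB ρ) :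
    IsResolvent A (Complex.exp (ρ * Complex.I)) (resolvent (Complex.exp (ρ * Complex.I)) A) := by
  have him : ((ρ : ℂ) * Complex.I).im = ρ := by simp
  exact h.sectorial_left.isResolvent_exp h.lt_rho (by rw [him]; exact le_abs_self ρ)
    (by rw [him, abs_of_pos h.rho_pos]; linarith [h.rho_lt_pi])

theorem AssumptionSigma.isResolvent_left_inv (h : AssumptionSigma A B ωA ωB ρ) :
    IsResolvent A (Complex.exp (ρ * Complex.I))⁻¹
      (resolvent (Complex.exp (ρ * Complex.I))⁻¹ A) := by
  have him : (-((ρ : ℂ) * Complex.I)).im = -ρ := by simp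
  rw [← Complex.exp_neg]
  exact h.sectorial_left.isResolvent_exp h.lt_rho (by rw [him, abs_neg]; exact le_abs_self ρ)
    (by rw [him, abs_neg, abs_of_pos h.rho_pos]; linarith [h.rho_lt_pi])

theorem AssumptionSigma.isResolvent_right (h : AssumptionSigma A B ωA ωB ρ) :
    IsResolvent B (-Complex.exp (ρ * Complex.I))
      (resolvent (-Complex.exp (ρ * Complex.I)) B) := by
  rw [← exp_add_pi_mul_I_eq_neg]
  exact h.isResolvent_neg_exp (by simp [abs_of_pos h.rho_pos])

theorem AssumptionSigma.isResolvent_right_inv (h : AssumptionSigma A B ωA ωB ρ) :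
    IsResolvent B (-Complex.exp (ρ * Complex.I))⁻¹
      (resolvent (-Complex.exp (ρ * Complex.I))⁻¹ B) := by
  rw [inv_neg, ← Complex.exp_neg, ← exp_add_pi_mul_I_eq_neg]
  exact h.isResolvent_neg_exp (by simp [abs_of_pos h.rho_pos])

theorem AssumptionSigma.isResolvent_left_inverse (h : AssumptionSigma A B ωA ωB ρ) :
    IsResolvent A.inverse (Complex.exp (ρ * Complex.I)) ((Complex.exp (ρ * Complex.I))⁻¹ •
      (1 - (Complex.exp (ρ * Complex.I))⁻¹ • resolvent (Complex.exp (ρ * Complex.I))⁻¹ A)) :=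
  h.isResolvent_left_inv.inverse (Complex.exp_ne_zero _)
    (h.sectorial_left.ker_eq_bot h.dense_range_left)

theorem AssumptionSigma.isResolvent_right_inverse (h : AssumptionSigma A B ωA ωB ρ) :
    IsResolvent B.inverse (-Complex.exp (ρ * Complex.I)) ((-Complex.exp (ρ * Complex.I))⁻¹ •
      (1 - (-Complex.exp (ρ * Complex.I))⁻¹ • resolvent (-Complex.exp (ρ * Complex.I))⁻¹ B)) :=
  h.isResolvent_right_inv.inverse (neg_ne_zero.2 (Complex.exp_ne_zero _))
    (h.sectorial_right.ker_eq_bot h.dense_range_right)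

theorem AssumptionSigma.regularizer_eq (h : AssumptionSigma A B ωA ωB ρ) :
    regularizer A B ρ = ((Complex.exp (ρ * Complex.I))⁻¹ •
      (1 - (Complex.exp (ρ * Complex.I))⁻¹ • resolvent (Complex.exp (ρ * Complex.I))⁻¹ A)) *
      -resolvent (-Complex.exp (ρ * Complex.I)) B *
      -((-Complex.exp (ρ * Complex.I))⁻¹ •
        (1 - (-Complex.exp (ρ * Complex.I))⁻¹ •
          resolvent (-Complex.exp (ρ * Complex.I))⁻¹ B)) := by
  rw [regularizer, h.isResolvent_left_inverse.resolvent_eq,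
    h.isResolvent_right.boundedInverse_shift_eq,
    h.isResolvent_right_inverse.boundedInverse_shift_eq]

theorem AssumptionSigma.commute_regularizer (h : AssumptionSigma A B ωA ωB ρ) {S : X →L[ℂ] X}
    (h1 : Commute S (resolvent (Complex.exp (ρ * Complex.I))⁻¹ A))
    (h2 : Commute S (resolvent (-Complex.exp (ρ * Complex.I)) B))
    (h3 : Commute S (resolvent (-Complex.exp (ρ * Complex.I))⁻¹ B)) :
    Commute S (regularizer A B ρ) := by
  rw [h.regularizer_eq]
  exact ((((Commute.one_right S).sub_right (h1.smul_right _)).smul_right _).mul_right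
    h2.neg_right).mul_right ((((Commute.one_right S).sub_right (h3.smul_right _)).smul_right
      _).neg_right)

theorem AssumptionSigma.commute_regularizer_left (h : AssumptionSigma A B ωA ωB ρ) {z : ℂ}
    {R : X →L[ℂ] X} (hR : IsResolvent A z R) : Commute R (regularizer A B ρ) :=
  h.commute_regularizer (hR.commute h.isResolvent_left_inv)
    (h.commute_resolvent hR h.isResolvent_right) (h.commute_resolvent hR h.isResolvent_right_inv)

theorem AssumptionSigma.commute_regularizer_right (h : AssumptionSigma A B ωA ωB ρ) {z : ℂ}
    {R : X →L[ℂ] X} (hR : IsResolvent B z R) : Commute R (regularizer A B ρ) :=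
  h.commute_regularizer (h.commute_resolvent h.isResolvent_left_inv hR).symm
    (hR.commute h.isResolvent_right) (hR.commute h.isResolvent_right_inv)

theorem AssumptionSigma.isResolvent_logRes (h : AssumptionSigma A B ωA ωB ρ) (hν : ωA < ν) {w : ℂ}
    (hw : ν ≤ |w.im|) (hw' : |w.im| ≤ ρ) :
    IsResolvent A (Complex.exp w) (resolvent (Complex.exp w) A) :=
  h.sectorial_left.isResolvent_exp hν hw (by linarith [h.rho_lt_pi, h.lt_rho])

/-- Decay of the integrands after regularization: at `-∞` by the ranges, at `+∞` by the domains. -/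
theorem AssumptionSigma.exists_bounds [CompleteSpace X] (h : AssumptionSigma A B ωA ωB ρ)
    (hν : ωA < ν) (hνρ : ν < ρ) : ∃ K : ℝ,
      (∀ w : ℂ, ν ≤ |w.im| → |w.im| ≤ ρ →
        ‖logRes A w * regularizer A B ρ‖ ≤ K * Real.exp w.re) ∧
      (∀ w : ℂ, ν ≤ |w.im| → |w.im| ≤ ρ →
        ‖logRes A w * (resolvent (Complex.exp (ρ * Complex.I)) A * regularizer A B ρ)‖ ≤
          K * Real.exp w.re) ∧
      (∀ w : ℂ, ν ≤ |w.im| → |w.im| ≤ ρ →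
        ‖(logRes A w - 1) * (resolvent (Complex.exp (ρ * Complex.I)) A * regularizer A B ρ)‖ ≤
          K * Real.exp (-w.re)) ∧
      (∀ w : ℂ, |w.im| ≤ ρ →
        ‖logResNeg B w * (resolvent (Complex.exp (ρ * Complex.I)) A * regularizer A B ρ)‖ ≤
          K * Real.exp w.re) ∧
      ∀ w : ℂ, ν ≤ |w.im| → |w.im| ≤ ρ →
        ‖logResNeg B w * (logRes A w *
          (resolvent (Complex.exp (ρ * Complex.I)) A * regularizer A B ρ))‖ ≤
          K * (Real.exp w.re * Real.exp w.re) := by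
  obtain ⟨M, ha⟩ := h.sectorial_left.exists_isLogResolvent hν hνρ.le h.rho_lt_pi
  have hM := ha.nonneg (h.sectorial_left.nonneg.trans hν.le) hνρ.le
  obtain ⟨N, hN, hb⟩ := h.exists_norm_logResNeg_le
  rw [h.regularizer_eq]
  set μ := Complex.exp (ρ * Complex.I) with hμ
  set P := resolvent μ A with hP
  set QA := μ⁻¹ • (1 - μ⁻¹ • resolvent μ⁻¹ A) with hQA
  set R := -resolvent (-μ) B with hR
  set QB := -((-μ)⁻¹ • (1 - (-μ)⁻¹ • resolvent (-μ)⁻¹ B)) with hQB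
  have e1 : ∀ w : ℂ, ν ≤ |w.im| → |w.im| ≤ ρ → ‖logRes A w * QA‖ ≤
      ‖μ⁻¹‖ * ((M + 1) * ‖resolvent μ⁻¹ A‖) * Real.exp w.re := by
    intro w h1 h2
    rw [hQA, mul_smul_comm, norm_smul, mul_assoc]
    exact mul_le_mul_of_nonneg_left (norm_logRes_mul_le (h.isResolvent_logRes hν h1 h2)
      h.isResolvent_left_inv (ha.norm_le w h1 h2)) (norm_nonneg _)
  have e2 : ∀ w : ℂ, ν ≤ |w.im| → |w.im| ≤ ρ → ‖(logRes A w - 1) * P‖ ≤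
      M * ‖μ • P - 1‖ * Real.exp (-w.re) := fun w h1 h2 =>
    norm_logRes_sub_one_mul_le (h.isResolvent_logRes hν h1 h2) h.isResolvent_left
      (ha.norm_le w h1 h2)
  have e3 : ∀ w : ℂ, |w.im| ≤ ρ → ‖logResNeg B w * QB‖ ≤
      ‖(-μ)⁻¹‖ * ((N + 1) * ‖resolvent (-μ)⁻¹ B‖) * Real.exp w.re := by
    intro w h2
    have hre : (w + Real.pi * Complex.I).re = w.re := by simp
    have h3 := norm_logRes_mul_le (h.isResolvent_neg_exp h2) h.isResolvent_right_inv (hb w h2)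
    rw [hre] at h3
    rw [hQB, mul_neg, norm_neg, mul_smul_comm, norm_smul, mul_assoc]
    exact mul_le_mul_of_nonneg_left h3 (norm_nonneg _)
  set K1 := ‖μ⁻¹‖ * ((M + 1) * ‖resolvent μ⁻¹ A‖) with hK1
  set K2 := M * ‖μ • P - 1‖ with hK2
  set K3 := ‖(-μ)⁻¹‖ * ((N + 1) * ‖resolvent (-μ)⁻¹ B‖) with hK3
  have hK1' : 0 ≤ K1 := by positivity
  have hK2' : 0 ≤ K2 := by positivity
  have hK3' : 0 ≤ K3 := by positivity
  have caP : ∀ w : ℂ, ν ≤ |w.im| → |w.im| ≤ ρ → Commute (logRes A w) P := fun w h1 h2 =>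
    ((h.isResolvent_logRes hν h1 h2).commute h.isResolvent_left).smul_left _
  have cbA : ∀ w : ℂ, |w.im| ≤ ρ → ∀ {z : ℂ} {S : X →L[ℂ] X}, IsResolvent A z S →
      Commute (logResNeg B w) S := fun w h1 z S hS =>
    (h.commute_resolvent hS (h.isResolvent_neg_exp h1)).symm.smul_left _
  have cbQA : ∀ w : ℂ, |w.im| ≤ ρ → Commute (logResNeg B w) QA := fun w h1 =>
    ((Commute.one_right _).sub_right ((cbA w h1 h.isResolvent_left_inv).smul_right _)).smul_right _
  have cbR : ∀ w : ℂ, |w.im| ≤ ρ → Commute (logResNeg B w) R := fun w h1 =>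
    (((h.isResolvent_neg_exp h1).commute h.isResolvent_right).smul_left _).neg_right
  have hexp := fun w : ℂ => (Real.exp_pos w.re).le
  have hexp' := fun w : ℂ => (Real.exp_pos (-w.re)).le
  set L1 := K1 * ‖R * QB‖
  set L2 := ‖P‖ * (K1 * ‖R * QB‖)
  set L3 := K2 * ‖QA * R * QB‖
  set L4 := ‖P * QA * R‖ * K3
  set L5 := ‖P‖ * K1 * (‖R‖ * K3)
  have hL1 : 0 ≤ L1 := by positivity
  have hL2 : 0 ≤ L2 := by positivity
  have hL3 : 0 ≤ L3 := by positivity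
  have hL4 : 0 ≤ L4 := by positivity
  have hL5 : 0 ≤ L5 := by positivity
  have f1 : ∀ w : ℂ, ν ≤ |w.im| → |w.im| ≤ ρ → ‖logRes A w * (QA * R * QB)‖ ≤
      L1 * Real.exp w.re := by
    intro w h1 h2
    have : logRes A w * (QA * R * QB) = (logRes A w * QA) * (R * QB) := by simp only [mul_assoc]
    rw [this]
    refine (norm_mul_le _ _).trans ((mul_le_mul_of_nonneg_right (e1 w h1 h2)
      (norm_nonneg _)).trans_eq ?_)
    ring
  refine ⟨L1 + L2 + L3 + L4 + L5, fun w h1 h2 => (f1 w h1 h2).trans ?_, fun w h1 h2 => ?_,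
    fun w h1 h2 => ?_, fun w h2 => ?_, fun w h1 h2 => ?_⟩
  · exact mul_le_mul_of_nonneg_right (by linarith) (hexp w)
  · have e : logRes A w * (P * (QA * R * QB)) = P * (logRes A w * (QA * R * QB)) := by
      rw [← mul_assoc, (caP w h1 h2).eq, mul_assoc]
    have h3 : ‖logRes A w * (P * (QA * R * QB))‖ ≤ L2 * Real.exp w.re := by
      rw [e]
      refine (norm_mul_le _ _).trans ((mul_le_mul_of_nonneg_left (f1 w h1 h2)
        (norm_nonneg _)).trans_eq ?_)
      ring
    exact h3.trans (mul_le_mul_of_nonneg_right (by linarith) (hexp w))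
  · have h3 : ‖(logRes A w - 1) * (P * (QA * R * QB))‖ ≤ L3 * Real.exp (-w.re) := by
      rw [← mul_assoc]
      refine (norm_mul_le _ _).trans ((mul_le_mul_of_nonneg_right (e2 w h1 h2)
        (norm_nonneg _)).trans_eq ?_)
      ring
    exact h3.trans (mul_le_mul_of_nonneg_right (by linarith) (hexp' w))
  · have e : logResNeg B w * (P * (QA * R * QB)) = (P * QA * R) * (logResNeg B w * QB) := by
      have c := ((cbA w h2 h.isResolvent_left).mul_right (cbQA w h2)).mul_right (cbR w h2)
      have : P * (QA * R * QB) = P * QA * R * QB := by simp only [mul_assoc]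
      rw [this, ← mul_assoc, c.eq, mul_assoc]
    have h3 : ‖logResNeg B w * (P * (QA * R * QB))‖ ≤ L4 * Real.exp w.re := by
      rw [e]
      refine (norm_mul_le _ _).trans ((mul_le_mul_of_nonneg_left (e3 w h2)
        (norm_nonneg _)).trans_eq ?_)
      ring
    exact h3.trans (mul_le_mul_of_nonneg_right (by linarith) (hexp w))
  · have e : logResNeg B w * (logRes A w * (P * (QA * R * QB))) =
        P * (logRes A w * QA) * (R * (logResNeg B w * QB)) := by
      have c : Commute (logResNeg B w) (P * (logRes A w * QA) * R) :=
        ((cbA w h2 h.isResolvent_left).mul_right ((h.commute_logRes hν h1 h2 h2).mul_right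
          (cbQA w h2))).mul_right (cbR w h2)
      have : logRes A w * (P * (QA * R * QB)) = P * (logRes A w * QA) * R * QB := by
        rw [← mul_assoc, (caP w h1 h2).eq]
        simp only [mul_assoc]
      rw [this, ← mul_assoc, c.eq]
      simp only [mul_assoc]
    have h3 : ‖logResNeg B w * (logRes A w * (P * (QA * R * QB)))‖ ≤
        L5 * (Real.exp w.re * Real.exp w.re) := by
      rw [e]
      calc _ ≤ (‖P‖ * ‖logRes A w * QA‖) * (‖R‖ * ‖logResNeg B w * QB‖) :=
            (norm_mul_le _ _).trans (mul_le_mul (norm_mul_le _ _) (norm_mul_le _ _)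
              (norm_nonneg _) (by positivity))
        _ ≤ (‖P‖ * (K1 * Real.exp w.re)) * (‖R‖ * (K3 * Real.exp w.re)) := by
            gcongr
            · exact e1 w h1 h2
            · exact e3 w h2
        _ = _ := by ring
    exact h3.trans (mul_le_mul_of_nonneg_right (by linarith) (mul_nonneg (hexp w) (hexp w)))

/-- The regularizing operator is injective with dense range. -/
theorem AssumptionSigma.injective_denseRange (h : AssumptionSigma A B ωA ωB ρ) :
    Function.Injective (resolvent (Complex.exp (ρ * Complex.I)) A * regularizer A B ρ) ∧
    DenseRange (resolvent (Complex.exp (ρ * Complex.I)) A * regularizer A B ρ) := by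
  have b1 := isBoundedInverse_shift_neg_iff.2 h.isResolvent_left
  have b2 := isBoundedInverse_shift_neg_iff.2 h.isResolvent_left_inverse
  have b3 : IsBoundedInverse (shift (Complex.exp (ρ * Complex.I)) B)
      (-resolvent (-Complex.exp (ρ * Complex.I)) B) :=
    isBoundedInverse_shift_iff.2 (by rw [neg_neg]; exact h.isResolvent_right)
  have b4 : IsBoundedInverse (shift (Complex.exp (ρ * Complex.I)) B.inverse)
      (-((-Complex.exp (ρ * Complex.I))⁻¹ • (1 - (-Complex.exp (ρ * Complex.I))⁻¹ •
        resolvent (-Complex.exp (ρ * Complex.I))⁻¹ B))) :=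
    isBoundedInverse_shift_iff.2 (by rw [neg_neg]; exact h.isResolvent_right_inverse)
  have d1 : DenseRange (resolvent (Complex.exp (ρ * Complex.I)) A) := by
    rw [DenseRange, b1.range_eq]
    exact h.dense_domain_left
  have d3 : DenseRange (-resolvent (-Complex.exp (ρ * Complex.I)) B) := by
    rw [DenseRange, b3.range_eq]
    exact h.dense_domain_right
  have d2 : DenseRange ((Complex.exp (ρ * Complex.I))⁻¹ • (1 - (Complex.exp (ρ * Complex.I))⁻¹ •
      resolvent (Complex.exp (ρ * Complex.I))⁻¹ A) : X →L[ℂ] X) := by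
    rw [DenseRange, b2.range_eq]
    change Dense (A.inverse.domain : Set X)
    rw [LinearPMap.inverse_domain]
    exact h.dense_range_left
  have d4 : DenseRange (-((-Complex.exp (ρ * Complex.I))⁻¹ •
      (1 - (-Complex.exp (ρ * Complex.I))⁻¹ •
        resolvent (-Complex.exp (ρ * Complex.I))⁻¹ B)) : X →L[ℂ] X) := by
    rw [DenseRange, b4.range_eq]
    change Dense (B.inverse.domain : Set X)
    rw [LinearPMap.inverse_domain]
    exact h.dense_range_right
  rw [h.regularizer_eq]
  constructor
  · exact b1.injective.comp ((b2.injective.comp b3.injective).comp b4.injective)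
  · exact d1.comp ((d2.comp d3 (ContinuousLinearMap.continuous _)).comp d4
      ((ContinuousLinearMap.continuous _).comp (ContinuousLinearMap.continuous _)))
        (ContinuousLinearMap.continuous _)

end Regularizer

/-! ### The bounded extension of `A S` and the closedness of `A + B` -/

section Transform

variable {X : Type*} [NormedAddCommGroup X] [NormedSpace ℂ X]

/-- The operator `-A S J`, where `J` is the regularizing operator whose range is the domain of `S`,
as an integral over the inner contour `Im w = ± ν`. -/
def sumTransform (A B : X →ₗ.[ℂ] X) (ρ ν : ℝ) : X →L[ℂ] X :=
  contourMean ν fun w => (Complex.exp w - Complex.exp (ρ * Complex.I))⁻¹ •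
    (logResNeg B w * (logRes A w * regularizer A B ρ))

variable {A B : X →ₗ.[ℂ] X} {ωA ωB ρ ν : ℝ}

theorem resolvent_eq_smul_logRes (w : ℂ) :
    resolvent (Complex.exp w) A = Complex.exp (-w) • logRes A w := by
  rw [logRes, smul_smul, ← Complex.exp_add]
  simp

theorem AssumptionSigma.lineIntegrable_sumTransform [CompleteSpace X]
    (h : AssumptionSigma A B ωA ωB ρ)
    (hν : ωA < ν) (hνρ : ν < ρ) : LineIntegrable ν fun w =>
      (Complex.exp w - Complex.exp (ρ * Complex.I))⁻¹ •
        (logResNeg B w * (logRes A w * regularizer A B ρ)) := by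
  obtain ⟨M, ha⟩ := h.sectorial_left.exists_isLogResolvent hν hνρ.le h.rho_lt_pi
  obtain ⟨N, -, hb⟩ := h.exists_norm_logResNeg_le
  obtain ⟨K, hQ, -⟩ := h.exists_bounds hν hνρ
  exact lineIntegrable_kernel_mul (h.sectorial_left.nonneg.trans_lt hν) hνρ h.rho_lt_pi ha
    (fun w hw => h.differentiableAt_logResNeg hw) hb hQ

/-- The hypothesis on the bilinear forms bounds `A S` on the domain of `S`. -/
theorem AssumptionSigma.norm_sumTransform_apply_le [CompleteSpace X]
    (h : AssumptionSigma A B ωA ωB ρ)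
    (hν : ωA < ν) (hνρ : ν < ρ) {C : ℝ} (hest : ∀ θ : ℝ, (θ = ρ ∨ θ = -ρ) →
      ∀ x ∈ domS A B ρ, ∀ x' : StrongDual ℂ X, ‖bilin A B ν θ x x'‖ ≤ C * ‖x‖ * ‖x'‖) (y : X) :
    ‖sumTransform A B ρ ν y‖ ≤ |C| *
      ‖(resolvent (Complex.exp (ρ * Complex.I)) A * regularizer A B ρ) y‖ := by
  have hν0 : 0 < ν := h.sectorial_left.nonneg.trans_lt hν
  have hρ0 := h.rho_pos
  obtain ⟨M, ha⟩ := h.sectorial_left.exists_isLogResolvent hν hνρ.le h.rho_lt_pi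
  obtain ⟨N, hN, hb⟩ := h.exists_norm_logResNeg_le
  obtain ⟨K, hQ, -⟩ := h.exists_bounds hν hνρ
  obtain ⟨hint, heq⟩ := contourMean_mul_logCalc_sqrtKernel (P :=
    resolvent (Complex.exp (ρ * Complex.I)) A) (Q := regularizer A B ρ) hν0 hνρ h.rho_lt_pi ha
    (fun w hw => h.differentiableAt_logResNeg hw) hb
    (fun w hw => hQ w hw.ge (hw ▸ hνρ.le)) (resolvent_eq_smul_logRes _)
  set J := resolvent (Complex.exp (ρ * Complex.I)) A * regularizer A B ρ with hJ
  -- The absolute value of `C` is needed for the bound to be nonnegative.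
  refine NormedSpace.norm_le_dual_bound ℂ _ (by positivity) fun x' => ?_
  have hmap := contourMean_map hint (x'.comp (ContinuousLinearMap.apply ℂ X y))
  rw [heq] at hmap
  have hline : ∀ θ : ℝ, (θ = ρ ∨ θ = -ρ) → ‖lineIntegral θ fun w' =>
      x' ((logResNeg B w' * logCalc ν (logRes A) (sqrtKernel w')) (J y))‖ ≤
        |C| * ‖J y‖ * ‖x'‖ := by
    intro θ hθ
    have hθ' : |θ| = ρ := by
      rcases hθ with rfl | rfl
      · exact abs_of_pos hρ0
      · rw [abs_neg, abs_of_pos hρ0]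
    have h1 := hest θ hθ (J y) (by rw [domS_eq_range]; exact ⟨y, rfl⟩) x'
    have h2 : ‖Complex.exp (-(3 * θ / 2 * Complex.I))‖ = 1 := by
      rw [Complex.norm_exp]
      simp
    rw [h.bilin_eq hν hνρ hθ', norm_mul, h2, one_mul] at h1
    exact h1.trans (by gcongr; exact le_abs_self C)
  have hpi : ‖(2 * Real.pi * Complex.I : ℂ)⁻¹‖ ≤ 1 / 2 := by
    rw [norm_inv, norm_mul, norm_mul, Complex.norm_I, Complex.norm_real, Complex.norm_ofNat,
      Real.norm_of_nonneg Real.pi_pos.le, mul_one, one_div]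
    exact inv_anti₀ two_pos (by linarith [Real.pi_gt_three])
  have hval : x' (sumTransform A B ρ ν y) = contourMean ρ fun w' =>
      x' ((logResNeg B w' * logCalc ν (logRes A) (sqrtKernel w')) (J y)) := hmap.symm
  rw [hval, contourMean, norm_smul]
  calc _ ≤ 1 / 2 * (|C| * ‖J y‖ * ‖x'‖ + |C| * ‖J y‖ * ‖x'‖) :=
        mul_le_mul hpi ((norm_sub_le _ _).trans (add_le_add (hline _ (.inr rfl))
          (hline _ (.inl rfl)))) (norm_nonneg _) (by norm_num)
    _ = _ := by ring

theorem AssumptionSigma.exp_smul_integrandS (h : AssumptionSigma A B ωA ωB ρ) {w : ℂ}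
    (hw : |w.im| ≤ ρ) (x : X) : Complex.exp w • integrandS A B x (Complex.exp w) =
      Complex.exp (-w) • logResNeg B w (logRes A w x) := by
  rw [integrandS, h.boundedInverse_shift hw, resolvent_eq_smul_logRes, smul_apply, smul_apply,
    map_smul, smul_smul, ← Complex.exp_add]
  simp

theorem AssumptionSigma.lineIntegrable_opS [CompleteSpace X]
    (h : AssumptionSigma A B ωA ωB ρ)
    (hν : ωA < ν) (hνρ : ν < ρ) : LineIntegrable ρ fun w => Complex.exp (-w) •
      (logResNeg B w * (logRes A w *
        (resolvent (Complex.exp (ρ * Complex.I)) A * regularizer A B ρ))) := by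
  have hν0 : 0 < ν := h.sectorial_left.nonneg.trans_lt hν
  obtain ⟨M, ha⟩ := h.sectorial_left.exists_isLogResolvent hν hνρ.le h.rho_lt_pi
  obtain ⟨N, hN, hb⟩ := h.exists_norm_logResNeg_le
  obtain ⟨K, -, -, -, -, hK⟩ := h.exists_bounds hν hνρ
  set J := resolvent (Complex.exp (ρ * Complex.I)) A * regularizer A B ρ with hJ
  refine lineIntegrable_of_bound h.rho_pos.le (fun w hw => ?_) one_pos fun w hw =>
    le_exp_neg_abs (K := K) (M := N * (M * ‖J‖)) ?_ ?_
  · have h1 := (h.differentiableAt_logResNeg hw.le).continuousAt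
    have h2 := (ha.differentiableAt w (hw ▸ hνρ.le) hw.le).continuousAt
    exact (Complex.continuous_exp.comp continuous_neg).continuousAt.smul
      (h1.mul (h2.mul continuousAt_const))
  · rw [norm_smul, Complex.norm_exp, Complex.neg_re]
    refine (mul_le_mul_of_nonneg_left (hK w (hw ▸ hνρ.le) hw.le)
      (Real.exp_pos _).le).trans_eq ?_
    have h1 : Real.exp (-w.re) * Real.exp w.re = 1 := by rw [← Real.exp_add]; simp
    linear_combination K * Real.exp w.re * h1
  · rw [norm_smul, Complex.norm_exp, Complex.neg_re, mul_comm]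
    refine mul_le_mul_of_nonneg_right ?_ (Real.exp_pos _).le
    exact (norm_mul_le _ _).trans (mul_le_mul (hb w hw.le) ((norm_mul_le _ _).trans
      (mul_le_mul_of_nonneg_right (ha.norm_le w (hw ▸ hνρ.le) hw.le) (norm_nonneg _)))
      (norm_nonneg _) hN)

theorem AssumptionSigma.integrableOn_integrandS [CompleteSpace X]
    (h : AssumptionSigma A B ωA ωB ρ)
    {x : X} (hx : x ∈ domS A B ρ) {θ : ℝ} (hθ : θ = ρ ∨ θ = -ρ) : IntegrableOn
      (fun r : ℝ => integrandS A B x (r * Complex.exp (θ * Complex.I))) (Ioi 0) := by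
  obtain ⟨ν, hν, hνρ⟩ := exists_between h.lt_rho
  rw [domS_eq_range] at hx
  obtain ⟨y, rfl⟩ := hx
  have hint := h.lineIntegrable_opS hν hνρ
  set J := resolvent (Complex.exp (ρ * Complex.I)) A * regularizer A B ρ with hJ
  have hθ' : |θ| = ρ := by
    rcases hθ with rfl | rfl
    · exact abs_of_pos h.rho_pos
    · rw [abs_neg, abs_of_pos h.rho_pos]
  have h1 : Integrable fun s : ℝ => Complex.exp (-((s : ℂ) + θ * Complex.I)) •
      (logResNeg B (s + θ * Complex.I) * (logRes A (s + θ * Complex.I) * J)) := by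
    rcases hθ with rfl | rfl
    · exact hint.2
    · exact hint.1
  rw [integrableOn_Ioi_iff_integrable_exp]
  refine (((ContinuousLinearMap.apply ℂ X y).integrable_comp h1).smul
    (Complex.exp (-(θ * Complex.I)))).congr (.of_forall fun s => ?_)
  have h2 := h.exp_smul_integrandS (w := s + θ * Complex.I)
    (by rw [abs_im_ofReal_add_mul_I, hθ']) (J y)
  change Complex.exp (-(θ * Complex.I)) • Complex.exp (-((s : ℂ) + θ * Complex.I)) •
    logResNeg B (s + θ * Complex.I) (logRes A (s + θ * Complex.I) (J y)) =
      Real.exp s • integrandS A B (J y) (((Real.exp s : ℝ) : ℂ) * Complex.exp (θ * Complex.I))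
  rw [← h2, smul_smul, ← Complex.exp_add, ofReal_exp_mul_exp_mul_I, ← Complex.coe_smul,
    Complex.ofReal_exp]
  congr 2
  ring

/-- `S J` maps into the domain of `A`, and `A S J` is given by the integral over the inner
contour. -/
theorem AssumptionSigma.opS_mem_graph [CompleteSpace X]
    (h : AssumptionSigma A B ωA ωB ρ)
    (hν : ωA < ν) (hνρ : ν < ρ) (y : X) :
    (opS A B ρ ((resolvent (Complex.exp (ρ * Complex.I)) A * regularizer A B ρ) y),
      -sumTransform A B ρ ν y) ∈ A.graph := by
  have hν0 : 0 < ν := h.sectorial_left.nonneg.trans_lt hν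
  obtain ⟨M, ha⟩ := h.sectorial_left.exists_isLogResolvent hν hνρ.le h.rho_lt_pi
  obtain ⟨N, hN, hb⟩ := h.exists_norm_logResNeg_le
  obtain ⟨K, hQ, haJ, haJ', hbJ, -⟩ := h.exists_bounds hν hνρ
  have heq := contourMean_kernel_eq_neg (P :=
    resolvent (Complex.exp (ρ * Complex.I)) A) (Q := regularizer A B ρ) hν0 hνρ h.rho_lt_pi ha
    (fun w hw => h.differentiableAt_logResNeg hw) hb hQ (resolvent_eq_smul_logRes _) haJ haJ' hbJ
  have hint := h.lineIntegrable_opS hν hνρ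
  have hP := h.isResolvent_left
  set P := resolvent (Complex.exp (ρ * Complex.I)) A with hPdef
  set J := P * regularizer A B ρ with hJ
  set F₁ : ℂ → X →L[ℂ] X := fun w => Complex.exp (-w) • (logResNeg B w * (logRes A w * J)) with hF₁
  set F₂ : ℂ → X →L[ℂ] X := fun w => logResNeg B w * ((logRes A w - 1) * J) with hF₂
  have hint₂ : LineIntegrable ρ F₂ := by
    refine lineIntegrable_of_bound h.rho_pos.le (fun w hw => ?_) one_pos fun w hw =>
      le_exp_neg_abs (K := N * K + K) (M := N * K) ?_ ?_
    · exact (h.differentiableAt_logResNeg hw.le).continuousAt.mul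
        (((ha.differentiableAt w (hw ▸ hνρ.le) hw.le).continuousAt.sub continuousAt_const).mul
          continuousAt_const)
    · have e : F₂ w = logResNeg B w * (logRes A w * J) - logResNeg B w * J := by
        simp only [hF₂, sub_mul, one_mul, mul_sub]
      rw [e, add_mul]
      refine (norm_sub_le _ _).trans (add_le_add ?_ (hbJ w hw.le))
      rw [mul_assoc]
      exact (norm_mul_le _ _).trans (mul_le_mul (hb w hw.le) (haJ w (hw ▸ hνρ.le) hw.le)
        (norm_nonneg _) hN)
    · rw [mul_assoc]
      exact (norm_mul_le _ _).trans (mul_le_mul (hb w hw.le) (haJ' w (hw ▸ hνρ.le) hw.le)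
        (norm_nonneg _) hN)
  have hpoint : ∀ w : ℂ, |w.im| = ρ →
      P * (Complex.exp (ρ * Complex.I) • F₁ w - F₂ w) = F₁ w := by
    intro w hw
    have hRw := h.isResolvent_logRes hν (hw ▸ hνρ.le) hw.le
    have hcomm : Commute (logResNeg B w) P :=
      (h.commute_resolvent hP (h.isResolvent_neg_exp hw.le)).symm.smul_left _
    ext x
    have h1 := hP.mem_graph_iff.1 (hP.map_mem_graph hcomm (hRw.1 (J x)))
    have e1 : logResNeg B w (resolvent (Complex.exp w) A (J x)) = F₁ w x := by
      rw [resolvent_eq_smul_logRes, smul_apply, map_smul]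
      rfl
    have e2 : logResNeg B w (Complex.exp w • resolvent (Complex.exp w) A (J x) - J x) =
        F₂ w x := rfl
    rw [e1, e2] at h1
    exact h1.symm
  have hopS : opS A B ρ (J y) = contourMean ρ F₁ y := by
    have h1 := contourMean_map hint (ContinuousLinearMap.apply ℂ X y)
    rw [opS, smul_sectorIntegral_eq_contourMean]
    refine Eq.trans (contourMean_congr h.rho_pos.le fun w hw => ?_) h1
    exact h.exp_smul_integrandS hw.le (J y)
  have h2 := contourMean_map ((hint.const_smul (Complex.exp (ρ * Complex.I))).sub hint₂)
    (ContinuousLinearMap.mul ℂ (X →L[ℂ] X) P)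
  simp only [ContinuousLinearMap.mul_apply'] at h2
  rw [contourMean_congr h.rho_pos.le hpoint,
    contourMean_sub (hint.const_smul _) hint₂, contourMean_const_smul] at h2
  have h3 : contourMean ρ F₂ = -sumTransform A B ρ ν := by
    rw [sumTransform, heq, neg_neg]
  rw [h3] at h2
  rw [hopS]
  exact hP.mem_graph_iff.2 (congrArg (fun T : X →L[ℂ] X => T y) h2)

/-- On the range of `A + B`, the inner contour integral reduces to the resolvent of `A`: the part
of the integrand that involves only `B` is holomorphic inside of the contour. -/
theorem AssumptionSigma.sumTransform_apply_add [CompleteSpace X]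
    (h : AssumptionSigma A B ωA ωB ρ)
    (hν : ωA < ν) (hνρ : ν < ρ) {x p q : X} (hp : (x, p) ∈ A.graph) (hq : (x, q) ∈ B.graph) :
    sumTransform A B ρ ν (p + q) =
      -(resolvent (Complex.exp (ρ * Complex.I)) A * regularizer A B ρ) p := by
  have hν0 : 0 < ν := h.sectorial_left.nonneg.trans_lt hν
  have hint := h.lineIntegrable_sumTransform hν hνρ
  obtain ⟨M, ha⟩ := h.sectorial_left.exists_isLogResolvent hν hνρ.le h.rho_lt_pi
  have hM := ha.nonneg hν0.le hνρ.le
  obtain ⟨N, hN, hb⟩ := h.exists_norm_logResNeg_le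
  have hpA := h.isResolvent_left.map_mem_graph
    (h.commute_regularizer_left h.isResolvent_left).symm hp
  have hqB := h.isResolvent_right.map_mem_graph
    (h.commute_regularizer_right h.isResolvent_right).symm hq
  have hmap := contourMean_map hint (ContinuousLinearMap.apply ℂ X (p + q))
  set Q := regularizer A B ρ with hQ
  have ea : ∀ w : ℂ, |w.im| = ν →
      logRes A w (Q p) = Complex.exp w • (logRes A w (Q x) - Q x) := fun w hw =>
    logRes_apply_of_mem_graph (h.isResolvent_logRes hν hw.ge (hw ▸ hνρ.le)) hpA
  have eb : ∀ w : ℂ, |w.im| ≤ ν →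
      logResNeg B w (Q q) = -Complex.exp w • (logResNeg B w (Q x) - Q x) := fun w hw => by
    have h1 := logRes_apply_of_mem_graph (h.isResolvent_neg_exp (hw.trans hνρ.le)) hqB
    rwa [exp_add_pi_mul_I_eq_neg] at h1
  have nb : ∀ w : ℂ, |w.im| ≤ ν → ‖logResNeg B w (Q q)‖ ≤
      (N * ‖Q x‖ + ‖Q x‖) * Real.exp w.re := fun w hw => by
    rw [eb w hw, norm_smul, norm_neg, Complex.norm_exp, mul_comm]
    refine mul_le_mul_of_nonneg_right ((norm_sub_le _ _).trans (add_le_add_left ?_ _))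
      (Real.exp_pos _).le
    exact (logResNeg B w).le_of_opNorm_le (hb w (hw.trans hνρ.le)) _
  have na : ∀ w : ℂ, |w.im| = ν → ‖logRes A w (Q p)‖ ≤
      (M * ‖Q x‖ + ‖Q x‖) * Real.exp w.re := fun w hw => by
    rw [ea w hw, norm_smul, Complex.norm_exp, mul_comm]
    refine mul_le_mul_of_nonneg_right ((norm_sub_le _ _).trans (add_le_add_left ?_ _))
      (Real.exp_pos _).le
    exact (logRes A w).le_of_opNorm_le (ha.norm_le w hw.ge (hw ▸ hνρ.le)) _
  have db : ∀ w : ℂ, |w.im| ≤ ν → DifferentiableAt ℂ (fun w => logResNeg B w (Q q)) w :=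
    fun w hw => (h.differentiableAt_logResNeg (hw.trans hνρ.le)).clm_apply
      (differentiableAt_const _)
  have ia := lineIntegrable_kernel (G := fun w => logRes A w (Q p)) (M := M * ‖Q p‖) hν0.le hνρ
    h.rho_lt_pi (by positivity) (fun w hw => ((ha.differentiableAt w hw.ge
      (hw ▸ hνρ.le)).clm_apply (differentiableAt_const _)).continuousAt)
    (fun w hw => (logRes A w).le_of_opNorm_le (ha.norm_le w hw.ge (hw ▸ hνρ.le)) _) na
  have ib := lineIntegrable_kernel (G := fun w => logResNeg B w (Q q)) (M := N * ‖Q q‖) hν0.le hνρ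
    h.rho_lt_pi (by positivity) (fun w hw => (db w hw.le).continuousAt)
    (fun w hw => (logResNeg B w).le_of_opNorm_le (hb w (hw ▸ hνρ.le)) _) fun w hw => nb w hw.le
  have hzero := contourMean_kernel_eq_zero (G := fun w => logResNeg B w (Q q)) hν0 hνρ
    h.rho_lt_pi (by positivity) db
    (fun w hw => (logResNeg B w).le_of_opNorm_le (hb w (hw.trans hνρ.le)) _) nb
  have hsplit : ∀ w : ℂ, |w.im| = ν → (Complex.exp w - Complex.exp (ρ * Complex.I))⁻¹ •
      logResNeg B w (logRes A w (Q (p + q))) =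
      (Complex.exp w - Complex.exp (ρ * Complex.I))⁻¹ • logRes A w (Q p) +
        (Complex.exp w - Complex.exp (ρ * Complex.I))⁻¹ • logResNeg B w (Q q) := by
    intro w hw
    have hc := congrArg (fun T : X →L[ℂ] X => T (Q q))
      (h.commute_logRes hν hw.ge (hw ▸ hνρ.le) (hw ▸ hνρ.le)).eq
    have hc' : logResNeg B w (logRes A w (Q q)) = logRes A w (logResNeg B w (Q q)) := hc
    have hcx : logResNeg B w (logRes A w (Q x)) = logRes A w (logResNeg B w (Q x)) :=
      congrArg (fun T : X →L[ℂ] X => T (Q x))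
        (h.commute_logRes hν hw.ge (hw ▸ hνρ.le) (hw ▸ hνρ.le)).eq
    rw [← smul_add, map_add, map_add, map_add, hc', ea w hw, eb w hw.le, map_smul, map_smul,
      map_sub, map_sub, hcx]
    congr 1
    module
  have hval : sumTransform A B ρ ν (p + q) = contourMean ν fun w =>
      (Complex.exp w - Complex.exp (ρ * Complex.I))⁻¹ •
        logResNeg B w (logRes A w (Q (p + q))) := hmap.symm
  rw [hval, contourMean_congr hν0.le hsplit, contourMean_add ia ib, hzero, add_zero,
    h.sectorial_left.contourMean_kernel_logRes hν hνρ h.rho_lt_pi hpA]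
  rfl

theorem AssumptionSigma.commute_sumTransform [CompleteSpace X]
    (h : AssumptionSigma A B ωA ωB ρ)
    (hν : ωA < ν) (hνρ : ν < ρ) : Commute
      (resolvent (Complex.exp (ρ * Complex.I)) A * regularizer A B ρ) (sumTransform A B ρ ν) := by
  have hν0 : 0 < ν := h.sectorial_left.nonneg.trans_lt hν
  have hint := h.lineIntegrable_sumTransform hν hνρ
  have hPQ := h.commute_regularizer_left h.isResolvent_left
  set P := resolvent (Complex.exp (ρ * Complex.I)) A with hP
  set J := P * regularizer A B ρ with hJ
  have e1 := contourMean_map hint (ContinuousLinearMap.mul ℂ (X →L[ℂ] X) J)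
  have e2 := contourMean_map hint ((ContinuousLinearMap.mul ℂ (X →L[ℂ] X)).flip J)
  simp only [ContinuousLinearMap.flip_apply, ContinuousLinearMap.mul_apply'] at e1 e2
  change J * contourMean ν _ = contourMean ν _ * J
  rw [← e1, ← e2]
  refine contourMean_congr hν0.le fun w hw => ?_
  have hRA := h.isResolvent_logRes hν hw.ge (hw ▸ hνρ.le)
  have hRB := h.isResolvent_neg_exp (w := w) (hw ▸ hνρ.le)
  have c1 : Commute J (logRes A w) :=
    ((h.isResolvent_left.commute hRA).mul_left (h.commute_regularizer_left hRA).symm).smul_right _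
  have c2 : Commute J (logResNeg B w) :=
    ((h.commute_resolvent h.isResolvent_left hRB).mul_left
      (h.commute_regularizer_right hRB).symm).smul_right _
  have c3 : Commute J (regularizer A B ρ) := hPQ.mul_left (Commute.refl _)
  rw [mul_smul_comm, smul_mul_assoc, (c2.mul_right (c1.mul_right c3)).eq]

/-- `A S` extends to a bounded operator `T`, and `T (A + B) x = A x`: both sides agree after
application of the injective regularizing operator. -/
theorem AssumptionSigma.exists_extension [CompleteSpace X]
    (h : AssumptionSigma A B ωA ωB ρ)
    (hν : ωA < ν) (hνρ : ν < ρ) {C : ℝ} (hest : ∀ θ : ℝ, (θ = ρ ∨ θ = -ρ) →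
      ∀ x ∈ domS A B ρ, ∀ x' : StrongDual ℂ X, ‖bilin A B ν θ x x'‖ ≤ C * ‖x‖ * ‖x'‖) :
    ∃ T : X →L[ℂ] X, (∀ x ∈ domS A B ρ, (opS A B ρ x, T x) ∈ A.graph) ∧
      ∀ x p q : X, (x, p) ∈ A.graph → (x, q) ∈ B.graph → T (p + q) = p := by
  obtain ⟨hinj, hdense⟩ := h.injective_denseRange
  have hbound := h.norm_sumTransform_apply_le hν hνρ hest
  have hgraph := h.opS_mem_graph hν hνρ
  have hadd := fun {x p q : X} => h.sumTransform_apply_add hν hνρ (x := x) (p := p) (q := q)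
  have hcomm := h.commute_sumTransform hν hνρ
  rw [domS_eq_range]
  set J := resolvent (Complex.exp (ρ * Complex.I)) A * regularizer A B ρ with hJ
  set T := (-(sumTransform A B ρ ν : X →ₗ[ℂ] X)).extendOfNorm (J : X →ₗ[ℂ] X) with hT
  have hTJ : ∀ y, T (J y) = -sumTransform A B ρ ν y := fun y =>
    LinearMap.extendOfNorm_eq (f := -(sumTransform A B ρ ν : X →ₗ[ℂ] X))
      (e := (J : X →ₗ[ℂ] X)) hdense
      ⟨|C|, fun x => by
        change ‖-sumTransform A B ρ ν x‖ ≤ _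
        rw [norm_neg]
        exact hbound x⟩ y
  refine ⟨T, ?_, fun x p q hp hq => hinj ?_⟩
  · rintro _ ⟨y, rfl⟩
    have := hgraph y
    rw [← hTJ] at this
    exact this
  · have hJT : ∀ z, J (T z) = T (J z) := by
      intro z
      have hJTc : Continuous fun z => J (T z) := by fun_prop
      have hTJc : Continuous fun z => T (J z) := by fun_prop
      refine congrFun (hdense.equalizer hJTc hTJc (funext fun y => ?_)) z
      change J (T (J y)) = T (J (J y))
      rw [hTJ, hTJ, map_neg]
      exact congrArg Neg.neg (congrArg (fun S : X →L[ℂ] X => S y) hcomm.eq)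
    rw [hJT, hTJ, hadd hp hq, neg_neg]

theorem mem_graph_add_iff {x y : X} :
    (x, y) ∈ (A + B).graph ↔ ∃ p q, (x, p) ∈ A.graph ∧ (x, q) ∈ B.graph ∧ y = p + q := by
  simp only [LinearPMap.mem_graph_iff]
  constructor
  · rintro ⟨⟨x', hx'⟩, rfl, rfl⟩
    exact ⟨A ⟨x', hx'.1⟩, B ⟨x', hx'.2⟩, ⟨_, rfl, rfl⟩, ⟨_, rfl, rfl⟩, LinearPMap.add_apply _ _ _⟩
  · rintro ⟨p, q, ⟨⟨a, ha⟩, h1, h2⟩, ⟨⟨b, hb⟩, h3, h4⟩, rfl⟩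
    simp only at h1 h3
    subst h1
    subst h3
    subst h2
    subst h4
    exact ⟨⟨b, ha, hb⟩, rfl, LinearPMap.add_apply _ _ _⟩

/-- If `T (A + B) x = A x` for a bounded operator `T`, the graph of `A + B` is an intersection of
preimages of the graphs of `A` and `B`. -/
theorem isClosed_add_of_apply_eq (hA : A.IsClosed) (hB : B.IsClosed) (T : X →L[ℂ] X)
    (hT : ∀ x p q : X, (x, p) ∈ A.graph → (x, q) ∈ B.graph → T (p + q) = p) :
    (A + B).IsClosed := by
  have hset : ((A + B).graph : Set (X × X)) =
      (fun z : X × X => (z.1, T z.2)) ⁻¹' (A.graph : Set (X × X)) ∩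
        (fun z : X × X => (z.1, z.2 - T z.2)) ⁻¹' (B.graph : Set (X × X)) := by
    ext ⟨x, y⟩
    simp only [SetLike.mem_coe, mem_inter_iff, mem_preimage, mem_graph_add_iff]
    constructor
    · rintro ⟨p, q, hp, hq, rfl⟩
      rw [hT x p q hp hq, add_sub_cancel_left]
      exact ⟨hp, hq⟩
    · rintro ⟨h1, h2⟩
      exact ⟨_, _, h1, h2, (add_sub_cancel _ _).symm⟩
  rw [LinearPMap.IsClosed, hset]
  exact (IsClosed.preimage (by fun_prop) hA).inter (IsClosed.preimage (by fun_prop) hB)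

end Transform

end OperatorSum

end

theorem mainTheorem8 {X : Type*} [NormedAddCommGroup X] [NormedSpace ℂ X] [CompleteSpace X]
    (A B : X →ₗ.[ℂ] X) (ωA ωB ρ : ℝ) (hAB : OperatorSum.AssumptionSigma A B ωA ωB ρ)
    (ν : ℝ) (hν : ωA < ν) (hνρ : ν < ρ)
    (hest : ∃ C : ℝ, ∀ θ : ℝ, (θ = ρ ∨ θ = -ρ) →
      ∀ x ∈ OperatorSum.domS A B ρ, ∀ x' : StrongDual ℂ X,
        ‖OperatorSum.bilin A B ν θ x x'‖ ≤ C * ‖x‖ * ‖x'‖) :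
    (Dense (OperatorSum.domS A B ρ : Set X) ∧
      ∀ x ∈ OperatorSum.domS A B ρ, ∀ θ : ℝ, (θ = ρ ∨ θ = -ρ) →
        MeasureTheory.IntegrableOn
          (fun r : ℝ => OperatorSum.integrandS A B x (r * Complex.exp (θ * Complex.I)))
          (Set.Ioi 0)) ∧
    (∃ T : X →L[ℂ] X, ∀ x ∈ OperatorSum.domS A B ρ,
      ∃ h : OperatorSum.opS A B ρ x ∈ A.domain, A ⟨OperatorSum.opS A B ρ x, h⟩ = T x) ∧
    (A + B).IsClosed := by
  obtain ⟨C, hC⟩ := hest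
  obtain ⟨T, hT, hT'⟩ := hAB.exists_extension hν hνρ hC
  refine ⟨⟨?_, fun x hx θ hθ => hAB.integrableOn_integrandS hx hθ⟩, ⟨T, fun x hx => ?_⟩,
    OperatorSum.isClosed_add_of_apply_eq hAB.sectorial_left.closed hAB.sectorial_right.closed T hT'⟩
  · rw [OperatorSum.domS_eq_range]
    exact hAB.injective_denseRange.2
  · obtain ⟨⟨z, hz⟩, h1, h2⟩ := (LinearPMap.mem_graph_iff _).1 (hT x hx)
    simp only at h1
    subst h1
    exact ⟨hz, h2⟩
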